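/- A lattice $(d,k)$-polytope is a non-empty polytope in $\mathbb{R}^d$ (not necessarily of dimension $d$) all of whose vertices belong to $\{0,1,\dots,k\}^d$. The diameter of a polytope is the diameter of its graph, whose nodes are the vertices of the polytope and whose edges are its one-dimensional faces, and $\delta(d,k)$ denotes the largest possible diameter of a lattice $(d,k)$-polytope. Then $$\delta(4,3)=8.$$ That is, every lattice $(4,3)$-polytope has diameter at most $8$, and some lattice $(4,3)$-polytope has diameter exactly $8$. The same value is obtained when only the lattice $(4,3)$-polytopes of dimension $4$ are considered. -/

import Mathlib

/-- The grid `{0, 1, …, k}^d`, seen inside `ℝ^d`. -/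
def latticeGrid (d k : ℕ) : Set (Fin d → ℝ) :=
  {x | ∃ z : Fin d → ℤ, (∀ i, 0 ≤ z i ∧ z i ≤ (k : ℤ)) ∧ x = fun i => (z i : ℝ)}

/-- A lattice polytope: the convex hull of a nonempty finite set of integer points. -/
def IsLatticePolytope {d : ℕ} (P : Set (Fin d → ℝ)) : Prop :=
  ∃ S : Finset (Fin d → ℤ), S.Nonempty ∧
    P = convexHull ℝ ((fun (z : Fin d → ℤ) (i : Fin d) => (z i : ℝ)) '' (S : Set (Fin d → ℤ)))

/-- A lattice `(d,k)`-polytope: a lattice polytope in `ℝ^d`, not necessarily full-dimensional,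
all of whose vertices belong to `{0, 1, …, k}^d`. -/
def IsLatticeDKPolytope (d k : ℕ) (P : Set (Fin d → ℝ)) : Prop :=
  IsLatticePolytope P ∧ P.extremePoints ℝ ⊆ latticeGrid d k

/-- The graph of a polytope `P`: its nodes are the vertices of `P`, and two distinct vertices are
adjacent when the segment between them is a face of `P`, that is, the set of points of `P` at
which some linear functional is maximal over `P`. -/
def polytopeGraph {d : ℕ} (P : Set (Fin d → ℝ)) : SimpleGraph (P.extremePoints ℝ) where
  Adj u v := u ≠ v ∧ IsExposed ℝ P (segment ℝ (u : Fin d → ℝ) (v : Fin d → ℝ))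
  symm := ⟨fun u v h => ⟨h.1.symm, by rw [segment_symm]; exact h.2⟩⟩
  loopless := ⟨fun _ h => h.1 rfl⟩

/-- The diameter of a polytope: the diameter of its graph, in `ℕ∞`
(it would be `⊤` if the graph were disconnected). -/
noncomputable def polytopeDiam {d : ℕ} (P : Set (Fin d → ℝ)) : ℕ∞ :=
  (polytopeGraph P).ediam

/-- The set of the diameters of all lattice `(d,k)`-polytopes. -/
def latticeDiameters (d k : ℕ) : Set ℕ∞ :=
  {n | ∃ P : Set (Fin d → ℝ), IsLatticeDKPolytope d k P ∧ polytopeDiam P = n}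

/-- The set of the diameters of all `d`-dimensional lattice `(d,k)`-polytopes. -/
def fullDimLatticeDiameters (d k : ℕ) : Set ℕ∞ :=
  {n | ∃ P : Set (Fin d → ℝ),
    IsLatticeDKPolytope d k P ∧ affineSpan ℝ P = ⊤ ∧ polytopeDiam P = n}

/-!
A polytope is replaced by its vertex set `V`, a finite set of integer points in convex position, and
walks in its graph are produced by the simplex method (`exists_improving`): a vertex at which a
linear functional is not maximal has a neighbour at which it is larger. For an integral functional
each step gains at least one, so a facet `x i = m` in the boundary of the box is reached in as many
steps as the distance of the `i`-th coordinate from `m`. Walking to the same facet from both ends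
gives an induction on the dimension, `DiamLE.succ`, and shows that points at nearly maximal distance
are opposite in the box (`opposite_of_far`).

This induction gives the bound `9` in dimension four, from the bounds `1`, `4`, `6` in lower
dimensions (the last of which improves `7`). To gain one more step, one needs to know which points
attain the maximal distance `4` in the plane (`plane_far`) and `6` in space (`space_far`): they are
opposite points, in the plane with exactly one extreme coordinate, in space with at least one.
These two tables are proved by a search over partial configurations, in which each node supposes
that certain points are vertices within given distances of one of the two ends, and branches over
the improving neighbours of one of them for a given functional. The kernel carries out the search
along a given list of moves (`run_space`), and `Search.run_sound` shows that it means what it should.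
One case in space is better treated by hand, in `center_close`.

In dimension four, suppose that `u` and `v` are at distance nine. Reflect the box so that all
coordinates of `u` are `0` or `1`; then `v` is opposite to `u`. In each facet of the box, a point
near `u` and a point near `v` have maximal distance, hence are opposite by `space_far`. This
determines the neighbours of `u` and of `v` on the facets to such an extent that the possible numbers
of zeros of `u` can be excluded one by one, by three collinear points (`Far.not_four`,
`Far.not_three`), by `u` not being exposed (`Far.not_two`), or by a comparison of the two pairings of
the coordinates given by the neighbours of `u` and of `v` (`Far.not_zero`). A single zero is
impossible by `Far.exists_opposite`.

The value `8` is attained by a zonotope with eight pairwise non-parallel generators whose sum is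
`(3, 3, 3, 3)`: along an edge, only one generator is added or removed, so the vertices `0` and
`(3, 3, 3, 3)` are at distance at least eight.
-/

/-! ### Finite sets of integer points in convex position -/

/-- The value at the integer point `x` of the linear functional with coefficient vector `c`. -/
def ev {d : ℕ} (c : Fin d → ℝ) (x : Fin d → ℤ) : ℝ := ∑ i, c i * (x i : ℝ)

/-- Every point of `V` is the unique maximizer over `V` of some linear functional, that is,
`V` is the vertex set of its convex hull. -/
def ConvPos {d : ℕ} (V : Finset (Fin d → ℤ)) : Prop :=
  ∀ z ∈ V, ∃ c, ∀ x ∈ V, x ≠ z → ev c x < ev c z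

/-- Adjacency of `a` and `b` in the graph of the convex hull of `V`: some linear functional is
maximal over `V` exactly at `a` and `b`. -/
def VAdj {d : ℕ} (V : Finset (Fin d → ℤ)) (a b : Fin d → ℤ) : Prop :=
  a ∈ V ∧ b ∈ V ∧ a ≠ b ∧
    ∃ c, ev c a = ev c b ∧ ∀ x ∈ V, x ≠ a → x ≠ b → ev c x < ev c a

/-- `Reach V n a b`: there is a walk of at most `n` edges from `a` to `b`. -/
inductive Reach {d : ℕ} (V : Finset (Fin d → ℤ)) : ℕ → (Fin d → ℤ) → (Fin d → ℤ) → Prop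
  | refl {n : ℕ} {a : Fin d → ℤ} : a ∈ V → Reach V n a a
  | step {n : ℕ} {a b c : Fin d → ℤ} : VAdj V a b → Reach V n b c → Reach V (n + 1) a c

/-- `W` is a face of `V`: the set of maximizers over `V` of a linear functional (or empty). -/
def Face {d : ℕ} (V W : Finset (Fin d → ℤ)) : Prop :=
  W ⊆ V ∧ ∃ (g : Fin d → ℝ) (M : ℝ), (∀ x ∈ W, ev g x = M) ∧ ∀ x ∈ V, x ∉ W → ev g x < M

section Basic

variable {d : ℕ} {V W : Finset (Fin d → ℤ)} {a b z : Fin d → ℤ}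

theorem ev_add (c e : Fin d → ℝ) (x : Fin d → ℤ) : ev (c + e) x = ev c x + ev e x := by
  simp [ev, add_mul, Finset.sum_add_distrib]

theorem ev_smul (r : ℝ) (c : Fin d → ℝ) (x : Fin d → ℤ) : ev (r • c) x = r * ev c x := by
  simp [ev, Finset.mul_sum, mul_assoc]

theorem ev_single (i : Fin d) (r : ℝ) (x : Fin d → ℤ) : ev (Pi.single i r) x = r * x i := by
  simp [ev, Pi.single_apply, ite_mul]

theorem ev_zero (x : Fin d → ℤ) : ev 0 x = 0 := by simp [ev]

theorem VAdj.symm (h : VAdj V a b) : VAdj V b a := by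
  obtain ⟨ha, hb, hne, c, hc, hx⟩ := h
  exact ⟨hb, ha, hne.symm, c, hc.symm, fun x h h1 h2 => hc ▸ hx x h h2 h1⟩

namespace Reach

theorem mem_right {n : ℕ} (h : Reach V n a b) : b ∈ V := by
  induction h with
  | refl h => exact h
  | step _ _ ih => exact ih

theorem mono {n m : ℕ} (h : Reach V n a b) (hnm : n ≤ m) : Reach V m a b := by
  induction h generalizing m with
  | refl h => exact .refl h
  | step h _ ih =>
    obtain ⟨k, rfl⟩ : ∃ k, m = k + 1 := ⟨m - 1, by omega⟩
    exact .step h (ih (by omega))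

theorem trans {n m : ℕ} (h : Reach V n a b) (h' : Reach V m b z) : Reach V (n + m) a z := by
  induction h with
  | refl _ => exact h'.mono (by omega)
  | @step n a b c hab _ ih =>
    have := Reach.step hab (ih h')
    exact this.mono (by omega)

theorem single (h : VAdj V a b) : Reach V 1 a b := .step h (.refl h.2.1)

theorem symm {n : ℕ} (h : Reach V n a b) : Reach V n b a := by
  induction h with
  | refl h => exact .refl h
  | step h _ ih => exact ih.trans (.single h.symm)

end Reach

theorem ConvPos.subset (hV : ConvPos V) (h : W ⊆ V) : ConvPos W := fun z hz => by
  obtain ⟨c, hc⟩ := hV z (h hz)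
  exact ⟨c, fun x hx => hc x (h hx)⟩

/-- A functional that is maximal on a face, added with a large weight, makes a functional
supporting an edge of the face support it on the whole set. -/
theorem Face.adj (hF : Face V W) (h : VAdj W a b) : VAdj V a b := by
  obtain ⟨hWV, g, M, hg, hlt⟩ := hF
  obtain ⟨ha, hb, hne, c, hc, hx⟩ := h
  have hev : ∀ᶠ N : ℝ in Filter.atTop, ∀ x ∈ V, x ∉ W →
      ev c x - ev c a < N * (M - ev g x) := by
    rw [Filter.eventually_all_finset]
    intro x hxV
    by_cases hxW : x ∈ W
    · exact Filter.Eventually.of_forall fun _ h => absurd hxW h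
    · have hpos : 0 < M - ev g x := sub_pos.2 (hlt x hxV hxW)
      refine (Filter.eventually_gt_atTop ((ev c x - ev c a) / (M - ev g x))).mono fun N hN _ => ?_
      exact (div_lt_iff₀ hpos).1 hN
  obtain ⟨N, hN⟩ := hev.exists
  refine ⟨hWV ha, hWV hb, hne, N • g + c, ?_, fun x hxV hxa hxb => ?_⟩
  · simp only [ev_add, ev_smul, hg a ha, hg b hb, hc]
  · simp only [ev_add, ev_smul, hg a ha]
    by_cases hxW : x ∈ W
    · have := hx x hxW hxa hxb
      rw [hg x hxW]
      linarith
    · have := hN x hxV hxW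
      nlinarith

theorem Face.reach {n : ℕ} (hF : Face V W) (h : Reach W n a b) : Reach V n a b := by
  induction h with
  | refl h => exact .refl (hF.1 h)
  | step h _ ih => exact .step (hF.adj h) ih

/-- Tilting a functional `e` exposed at `z` in the direction `c` until a new maximizer appears. -/
theorem exists_tilt {c e : Fin d → ℝ} {y : Fin d → ℤ} (he : ∀ x ∈ V, x ≠ z → ev e x < ev e z)
    (hy : y ∈ V) (hc : ev c z < ev c y) :
    ∃ r : ℝ, 0 < r ∧ (∀ x ∈ V, ev (e + r • c) x ≤ ev (e + r • c) z) ∧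
      (∃ x ∈ V, ev c z < ev c x ∧ ev (e + r • c) x = ev (e + r • c) z) ∧
      ∀ x ∈ V, x ≠ z → ev (e + r • c) x = ev (e + r • c) z → ev c z < ev c x := by
  have hne : (V.filter fun x => ev c z < ev c x).Nonempty := ⟨y, by simp [hy, hc]⟩
  obtain ⟨w, hw, hmin⟩ := Finset.exists_min_image _
    (fun x => (ev e z - ev e x) / (ev c x - ev c z)) hne
  simp only [Finset.mem_filter] at hw hmin
  have hwc : 0 < ev c w - ev c z := sub_pos.2 hw.2
  have hwz : w ≠ z := fun h => by simp [h] at hw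
  set r := (ev e z - ev e w) / (ev c w - ev c z) with hr
  have hr0 : 0 < r := div_pos (sub_pos.2 (he w hw.1 hwz)) hwc
  refine ⟨r, hr0, fun x hx => ?_, ⟨w, hw.1, hw.2, ?_⟩, fun x hx hxz hxe => ?_⟩
  · simp only [ev_add, ev_smul]
    rcases lt_or_ge (ev c z) (ev c x) with h | h
    · have := (le_div_iff₀ (sub_pos.2 h)).1 (hmin x ⟨hx, h⟩)
      nlinarith
    · rcases eq_or_ne x z with rfl | hxz
      · exact le_rfl
      · have := he x hx hxz
        nlinarith
  · simp only [ev_add, ev_smul]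
    have : r * (ev c w - ev c z) = ev e z - ev e w := div_mul_cancel₀ _ hwc.ne'
    linarith
  · simp only [ev_add, ev_smul] at hxe
    have := he x hx hxz
    by_contra h
    push Not at h
    nlinarith

theorem face_argmax {g : Fin d → ℝ} (h : ∀ x ∈ V, ev g x ≤ ev g z) :
    Face V (V.filter fun x => ev g x = ev g z) :=
  ⟨Finset.filter_subset _ _, g, ev g z, fun _ hx => (Finset.mem_filter.1 hx).2, fun x hx hxW =>
    lt_of_le_of_ne (h x hx) fun h' => hxW (Finset.mem_filter.2 ⟨hx, h'⟩)⟩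

/-- The simplex method never gets stuck: a vertex at which a linear functional is not maximal has
a neighbour at which it is larger. -/
theorem exists_improving (hV : ConvPos V) {c : Fin d → ℝ} {y : Fin d → ℤ} (hz : z ∈ V)
    (hy : y ∈ V) (hc : ev c z < ev c y) : ∃ w, VAdj V z w ∧ ev c z < ev c w := by
  induction hn : V.card using Nat.strong_induction_on generalizing V c y with
  | _ n ih =>
  obtain ⟨e, he⟩ := hV z hz
  -- the induction hypothesis, for a proper face through `z`
  have key : ∀ {c' g : Fin d → ℝ} {y' x' : Fin d → ℤ}, (∀ x ∈ V, ev g x ≤ ev g z) →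
      x' ∈ V → ev g x' ≠ ev g z → y' ∈ V → ev g y' = ev g z → ev c' z < ev c' y' →
      ∃ w, VAdj V z w ∧ ev c' z < ev c' w ∧ ev g w = ev g z := by
    intro c' g y' x' hg hx' hx'g hy' hy'g hc'
    have hF := face_argmax hg
    have hlt : (V.filter fun x => ev g x = ev g z).card < n := by
      rw [← hn]
      exact Finset.card_lt_card (Finset.filter_ssubset.2 ⟨x', hx', hx'g⟩)
    obtain ⟨w, hw, hcw⟩ := ih _ hlt (hV.subset hF.1) (c := c') (y := y') (by simp [hz])
      (by simp [hy', hy'g]) hc' rfl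
    exact ⟨w, hF.adj hw, hcw, (Finset.mem_filter.1 hw.2.1).2⟩
  obtain ⟨r, -, hg, ⟨w, hw, hcw, hgw⟩, hS⟩ := exists_tilt he hy hc
  by_cases hall : ∃ x ∈ V, ev (e + r • c) x ≠ ev (e + r • c) z
  · obtain ⟨x, hx, hxg⟩ := hall
    obtain ⟨w', h1, h2, -⟩ := key hg hx hxg hw hgw hcw
    exact ⟨w', h1, h2⟩
  push Not at hall
  -- now `c` is larger at every other point, so any neighbour will do
  have hup : ∀ x ∈ V, x ≠ z → ev c z < ev c x := fun x hx hxz => hS x hx hxz (hall x hx)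
  have hyz : y ≠ z := fun h => by simp [h] at hc
  by_cases h2 : ∃ x ∈ V, x ≠ z ∧ x ≠ y
  · obtain ⟨x, hx, hxz, hxy⟩ := h2
    obtain ⟨p, q, hp, hq, hpz, hqz, hpq, hle⟩ : ∃ p q, p ∈ V ∧ q ∈ V ∧ p ≠ z ∧ q ≠ z ∧ p ≠ q ∧
        ev e p ≤ ev e q := by
      rcases le_total (ev e x) (ev e y) with h | h
      · exact ⟨x, y, hx, hy, hxz, hyz, hxy, h⟩
      · exact ⟨y, x, hy, hx, hyz, hxz, hxy.symm, h⟩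
    -- tilting `e` towards a functional exposed at `q` gives a face that does not contain `p`
    obtain ⟨f, hf⟩ := hV q hq
    obtain ⟨s, hs, hg', ⟨w', hw', hcw', hgw'⟩, -⟩ := exists_tilt he hq (hf z hz hqz.symm)
    have hw'z : w' ≠ z := fun h => by simp [h] at hcw'
    obtain ⟨x', hx', hx'g⟩ : ∃ x' ∈ V, ev (e + s • f) x' ≠ ev (e + s • f) z := by
      by_contra hcon
      push Not at hcon
      have h1 := hcon p hp
      have h2 := hcon q hq
      simp only [ev_add, ev_smul] at h1 h2
      have := mul_lt_mul_of_pos_left (hf p hp hpq) hs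
      linarith
    obtain ⟨w'', h1, h2, -⟩ := key hg' hx' hx'g hw' hgw' (hup w' hw' hw'z)
    exact ⟨w'', h1, h2⟩
  · push Not at h2
    exact ⟨y, ⟨hz, hy, hyz.symm, 0, by simp [ev_zero], fun x hx h h' => absurd (h2 x hx h) h'⟩, hc⟩

/-- `exists_improving` for a functional with integer coefficients. -/
theorem exists_improving_int (hV : ConvPos V) (c : Fin d → ℤ) {y : Fin d → ℤ} (hz : z ∈ V)
    (hy : y ∈ V) (hc : ∑ i, c i * z i < ∑ i, c i * y i) :
    ∃ w, VAdj V z w ∧ ∑ i, c i * z i < ∑ i, c i * w i := by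
  have hcast : ∀ x : Fin d → ℤ, ev (fun i => (c i : ℝ)) x = ((∑ i, c i * x i : ℤ) : ℝ) :=
    fun x => by simp [ev]
  obtain ⟨w, hw, h⟩ := exists_improving hV (c := fun i => (c i : ℝ)) hz hy
    (by rw [hcast, hcast]; exact_mod_cast hc)
  exact ⟨w, hw, by rw [hcast, hcast] at h; exact_mod_cast h⟩

/-- Each improving step raises an integral functional by at least one. -/
theorem exists_reach_max (hV : ConvPos V) (c : Fin d → ℤ) {M : ℤ}
    (hM : ∀ x ∈ V, ∑ i, c i * x i ≤ M) {y : Fin d → ℤ} (hy : y ∈ V) (hyM : ∑ i, c i * y i = M)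
    (n : ℕ) (hz : z ∈ V) (hn : M - ∑ i, c i * z i ≤ n) :
    ∃ w ∈ V, ∑ i, c i * w i = M ∧ Reach V n z w := by
  induction n generalizing z with
  | zero =>
    have := hM z hz
    exact ⟨z, hz, by push_cast at hn; omega, .refl hz⟩
  | succ n ih =>
    by_cases h : ∑ i, c i * z i = M
    · exact ⟨z, hz, h, .refl hz⟩
    · obtain ⟨w, hw, hlt⟩ := exists_improving_int hV c hz hy
        (by have := hM z hz; omega)
      obtain ⟨w', h1, h2, h3⟩ := ih hw.2.1 (by push_cast at hn; omega)
      exact ⟨w', h1, h2, .step hw h3⟩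

theorem face_eq_top {i : Fin d} {m : ℤ} (h : ∀ x ∈ V, x i ≤ m) :
    Face V (V.filter fun x => x i = m) := by
  refine ⟨Finset.filter_subset _ _, Pi.single i 1, m, fun x hx => ?_, fun x hx hxW => ?_⟩
  · rw [ev_single, (Finset.mem_filter.1 hx).2, one_mul]
  · rw [ev_single, one_mul]
    exact_mod_cast lt_of_le_of_ne (h x hx) fun h' => hxW (Finset.mem_filter.2 ⟨hx, h'⟩)

theorem face_eq_bot {i : Fin d} {m : ℤ} (h : ∀ x ∈ V, m ≤ x i) :
    Face V (V.filter fun x => x i = m) := by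
  refine ⟨Finset.filter_subset _ _, Pi.single i (-1), -m, fun x hx => ?_, fun x hx hxW => ?_⟩
  · rw [ev_single, (Finset.mem_filter.1 hx).2]; ring
  · rw [ev_single, neg_one_mul, neg_lt_neg_iff]
    exact_mod_cast lt_of_le_of_ne (h x hx) fun h' => hxW (Finset.mem_filter.2 ⟨hx, h'.symm⟩)

/-- No point of a set in convex position is between two others. -/
theorem ConvPos.not_between (hV : ConvPos V) {c : Fin d → ℤ} (ha : a ∈ V) (hb : b ∈ V)
    (hc : c ∈ V) {p q : ℤ} (hp : 0 < p) (hq : 0 < q) (hab : a ≠ b)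
    (h : ∀ i, p * a i + q * c i = (p + q) * b i) : False := by
  obtain ⟨e, he⟩ := hV b hb
  have hsum : p * ev e a + q * ev e c = (p + q) * ev e b := by
    simp only [ev, Finset.mul_sum, ← Finset.sum_add_distrib]
    refine Finset.sum_congr rfl fun i _ => ?_
    have := congrArg (Int.cast : ℤ → ℝ) (h i)
    push_cast at this
    linear_combination e i * this
  have hp' : (0 : ℝ) < p := by exact_mod_cast hp
  have hq' : (0 : ℝ) < q := by exact_mod_cast hq
  have h1 := he a ha hab
  have h2 : ev e c ≤ ev e b := by
    rcases eq_or_ne c b with rfl | h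
    · exact le_rfl
    · exact (he c hc h).le
  nlinarith

/-- The points of `V` on a face given by fixing extreme coordinates are reached in as many steps
as the distance of these coordinates. Here `c i` is `0` for a free coordinate, and `-1` or `1`
according as the coordinate of `y` is the least or the largest on `V`. -/
theorem exists_reach_face (hV : ConvPos V) {c y q : Fin d → ℤ} (hy : y ∈ V)
    (h : ∀ x ∈ V, ∀ i, c i * x i ≤ c i * y i) (hq : q ∈ V) {n : ℕ}
    (hn : ∑ i, c i * (y i - q i) ≤ n) :
    ∃ w ∈ V, (∀ i, c i * w i = c i * y i) ∧ Reach V n q w := by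
  obtain ⟨w, hw, hwM, hr⟩ := exists_reach_max hV c (M := ∑ i, c i * y i)
    (fun x hx => Finset.sum_le_sum fun i _ => h x hx i) hy rfl n hq
    (by rw [← Finset.sum_sub_distrib]; simpa only [mul_sub] using hn)
  exact ⟨w, hw, fun i => (Finset.sum_eq_sum_iff_of_le fun i _ => h w hw i).1 hwM i
    (Finset.mem_univ i), hr⟩

/-- A set in convex position does not contain three collinear points. -/
theorem ConvPos.not_collinear (hV : ConvPos V) {c : Fin d → ℤ} (ha : a ∈ V) (hb : b ∈ V)
    (hc : c ∈ V) {k : Fin d} (hab : a k ≠ b k) (hac : a ≠ c) (hbc : b ≠ c)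
    (h : ∀ i, (b k - a k) * (c i - a i) = (c k - a k) * (b i - a i)) : False := by
  have hac' : a k ≠ c k := fun h' => hac <| funext fun i => by
    have := h i
    rw [h', sub_self, zero_mul, mul_eq_zero] at this
    omega
  have hbc' : b k ≠ c k := fun h' => hbc <| funext fun i => by
    have := h i
    rw [← h'] at this
    have := mul_left_cancel₀ (sub_ne_zero.2 hab.symm) this
    omega
  have key : ∀ {y z w : Fin d → ℤ}, y ∈ V → z ∈ V → w ∈ V →
      (∀ i, (z k - y k) * (w i - y i) = (w k - y k) * (z i - y i)) →
      ¬(y k < z k ∧ z k < w k) := fun {y z w} hy hz hw hk ⟨h1, h2⟩ =>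
    hV.not_between hy hz hw (p := w k - z k) (q := z k - y k) (by omega) (by omega)
      (fun h => by simp [h] at h1) fun i => by linear_combination hk i
  have h1 := key ha hb hc h
  have h2 := key hc hb ha fun i => by linear_combination -h i
  have h3 := key ha hc hb fun i => by linear_combination -h i
  have h4 := key hb hc ha fun i => by linear_combination h i
  have h5 := key hb ha hc fun i => by linear_combination -h i
  have h6 := key hc ha hb fun i => by linear_combination h i
  omega

/-- Points in convex position on a line parallel to a coordinate axis: there are at most two. -/
theorem ConvPos.eq_or_eq_of_line (hV : ConvPos V) {k : Fin d} {x : Fin d → ℤ} (ha : a ∈ V)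
    (hb : b ∈ V) (hx : x ∈ V) (hab : a ≠ b) (hb' : ∀ i, i ≠ k → b i = a i)
    (hx' : ∀ i, i ≠ k → x i = a i) : x = a ∨ x = b := by
  by_contra! hne
  have hk : a k ≠ b k := fun h => hab <| funext fun i => by
    by_cases hi : i = k
    · rw [hi, h]
    · rw [hb' i hi]
  refine hV.not_collinear ha hb hx hk hne.1.symm hne.2.symm fun i => ?_
  by_cases hi : i = k
  · rw [hi]; ring
  · rw [hb' i hi, hx' i hi]; ring

theorem reach_one_of_line (hV : ConvPos V) {k : Fin d} (h : ∀ x ∈ V, ∀ i, i ≠ k → x i = a i)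
    (ha : a ∈ V) (hb : b ∈ V) : Reach V 1 a b := by
  rcases eq_or_ne a b with rfl | hne
  · exact .refl ha
  · exact .single ⟨ha, hb, hne, 0, by simp [ev_zero], fun x hx hxa hxb =>
      ((hV.eq_or_eq_of_line ha hb hx hne (h b hb) (h x hx)).elim hxa hxb).elim⟩

/-- The coordinate `i` has the value `a` at some point of `V`, and this is the least or the
largest value of the coordinate on `V`. -/
def Extreme (V : Finset (Fin d → ℤ)) (i : Fin d) (a : ℤ) : Prop :=
  (∃ x ∈ V, x i = a) ∧ ((∀ x ∈ V, a ≤ x i) ∨ ∀ x ∈ V, x i ≤ a)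

theorem Extreme.face {i : Fin d} {m : ℤ} (h : Extreme V i m) :
    Face V (V.filter fun x => x i = m) :=
  h.2.elim face_eq_bot face_eq_top

theorem Extreme.exists_reach {i : Fin d} {m : ℤ} (h : Extreme V i m) (hV : ConvPos V)
    {x : Fin d → ℤ} (hx : x ∈ V) : ∃ y ∈ V, y i = m ∧ Reach V (x i - m).natAbs x y := by
  obtain ⟨⟨y, hy, rfl⟩, hm⟩ := h
  obtain ⟨s, hs, hsV⟩ : ∃ s : ℤ, s ≠ 0 ∧
      ∀ z ∈ V, s * z i ≤ s * y i ∧ s * (y i - z i) = (z i - y i).natAbs := by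
    rcases hm with hm | hm
    · exact ⟨-1, by norm_num, fun z hz => by have := hm z hz; omega⟩
    · exact ⟨1, by norm_num, fun z hz => by have := hm z hz; omega⟩
  obtain ⟨w, hw, hwy, hr⟩ := exists_reach_face hV (c := Pi.single i s) hy
    (fun z hz j => by
      by_cases hj : j = i
      · subst hj; simpa using (hsV z hz).1
      · simp [hj]) hx (n := (x i - y i).natAbs)
    (by simp only [Pi.single_apply, ite_mul, zero_mul, Finset.sum_ite_eq', Finset.mem_univ, if_true]
        exact (hsV x hx).2.le)
  exact ⟨w, hw, by simpa [hs] using hwy i, hr⟩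

/-- The points of `V` with two prescribed extreme coordinates are reached in as many steps as the
distance of these coordinates. -/
theorem Extreme.exists_reach₂ {i j : Fin d} {m n : ℤ} (hi : Extreme V i m) (hj : Extreme V j n)
    (hij : i ≠ j) (hV : ConvPos V) {x y : Fin d → ℤ} (hy : y ∈ V) (hyi : y i = m) (hyj : y j = n)
    (hx : x ∈ V) :
    ∃ w ∈ V, w i = m ∧ w j = n ∧ Reach V ((x i - m).natAbs + (x j - n).natAbs) x w := by
  subst hyi hyj
  have sign : ∀ {k}, Extreme V k (y k) → ∃ s : ℤ, s ≠ 0 ∧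
      ∀ z ∈ V, s * z k ≤ s * y k ∧ s * (y k - z k) = (z k - y k).natAbs := by
    intro k hk
    rcases hk.2 with hm | hm
    · exact ⟨-1, by norm_num, fun z hz => by have := hm z hz; omega⟩
    · exact ⟨1, by norm_num, fun z hz => by have := hm z hz; omega⟩
  obtain ⟨s, hs, hsV⟩ := sign hi
  obtain ⟨r, hr, hrV⟩ := sign hj
  obtain ⟨w, hw, hwy, hreach⟩ := exists_reach_face hV (c := Pi.single i s + Pi.single j r) hy
    (fun z hz l => by
      simp only [Pi.add_apply, Pi.single_apply]
      by_cases hl : l = i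
      · subst hl; simpa [hij] using (hsV z hz).1
      · by_cases hl' : l = j
        · subst hl'; simpa [hl] using (hrV z hz).1
        · simp [hl, hl']) hx (n := (x i - y i).natAbs + (x j - y j).natAbs)
    (by simp only [Pi.add_apply, add_mul, Finset.sum_add_distrib, Pi.single_apply, ite_mul,
          zero_mul, Finset.sum_ite_eq', Finset.mem_univ, if_true]
        rw [(hsV x hx).2, (hrV x hx).2]
        push_cast
        exact le_rfl)
  exact ⟨w, hw, by simpa [Pi.single_apply, hij, hs] using hwy i,
    by simpa [Pi.single_apply, hij.symm, hr] using hwy j, hreach⟩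

end Basic

/-! ### Changes of coordinates -/

section Transport

variable {d d' : ℕ} {V : Finset (Fin d → ℤ)} {f : (Fin d → ℤ) → (Fin d' → ℤ)}

/-- On `V`, linear functionals pull back and push forward along `f` up to constants:
`f` is an affine isomorphism between the affine spans of `V` and of its image. -/
structure AffineOn (V : Finset (Fin d → ℤ)) (f : (Fin d → ℤ) → (Fin d' → ℤ)) : Prop where
  pull : ∀ c' : Fin d' → ℝ, ∃ (c : Fin d → ℝ) (k : ℝ), ∀ x ∈ V, ev c' (f x) = ev c x + k
  push : ∀ c : Fin d → ℝ, ∃ (c' : Fin d' → ℝ) (k : ℝ), ∀ x ∈ V, ev c' (f x) = ev c x + k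

theorem AffineOn.injOn (hf : AffineOn V f) (hV : ConvPos V) {a b : Fin d → ℤ} (ha : a ∈ V)
    (hb : b ∈ V) (h : f a = f b) : a = b := by
  by_contra hne
  obtain ⟨c, hc⟩ := hV a ha
  obtain ⟨c', k, hk⟩ := hf.push c
  have h1 := hc b hb (Ne.symm hne)
  have h2 := hk a ha
  have h3 := hk b hb
  rw [h] at h2
  linarith

theorem AffineOn.convPos (hf : AffineOn V f) (hV : ConvPos V) : ConvPos (V.image f) := by
  intro z' hz'
  obtain ⟨z, hz, rfl⟩ := Finset.mem_image.1 hz'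
  obtain ⟨c, hc⟩ := hV z hz
  obtain ⟨c', k, hk⟩ := hf.push c
  refine ⟨c', fun x' hx' hne => ?_⟩
  obtain ⟨x, hx, rfl⟩ := Finset.mem_image.1 hx'
  rw [hk x hx, hk z hz]
  have := hc x hx fun h => hne (by rw [h])
  linarith

theorem AffineOn.adj (hf : AffineOn V f) (hV : ConvPos V) {a b : Fin d → ℤ} (ha : a ∈ V)
    (hb : b ∈ V) (h : VAdj (V.image f) (f a) (f b)) : VAdj V a b := by
  obtain ⟨-, -, hne, c', hc', hlt⟩ := h
  obtain ⟨c, k, hk⟩ := hf.pull c'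
  refine ⟨ha, hb, fun h => hne (by rw [h]), c, ?_, fun x hx hxa hxb => ?_⟩
  · rw [hk a ha, hk b hb] at hc'; linarith
  · have := hlt (f x) (Finset.mem_image_of_mem f hx) (fun h => hxa (hf.injOn hV hx ha h))
      (fun h => hxb (hf.injOn hV hx hb h))
    rw [hk x hx, hk a ha] at this
    linarith

theorem AffineOn.reach (hf : AffineOn V f) (hV : ConvPos V) {n : ℕ} {a b : Fin d → ℤ} (ha : a ∈ V)
    (hb : b ∈ V) (h : Reach (V.image f) n (f a) (f b)) : Reach V n a b := by
  generalize hA : f a = A at h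
  generalize hB : f b = B at h
  induction h generalizing a with
  | refl _ => rw [hf.injOn hV ha hb (hA.trans hB.symm)]; exact .refl hb
  | step hab _ ih =>
    obtain ⟨w, hw, rfl⟩ := Finset.mem_image.1 hab.2.1
    subst hA
    exact .step (hf.adj hV ha hw hab) (ih hw rfl hB)

/-- Reflections and translations of the coordinates. -/
theorem affineOn_reflect (V : Finset (Fin d → ℤ)) {s : Fin d → ℤ} (hs : ∀ i, s i * s i = 1)
    (t : Fin d → ℤ) : AffineOn V fun x i => s i * x i + t i := by
  have hs' : ∀ i, (s i : ℝ) * s i = 1 := fun i => by exact_mod_cast hs i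
  constructor
  · intro c
    refine ⟨fun i => c i * s i, ∑ i, c i * t i, fun x _ => ?_⟩
    simp only [ev, ← Finset.sum_add_distrib]
    exact Finset.sum_congr rfl fun i _ => by push_cast; ring
  · intro c
    refine ⟨fun i => c i * s i, ∑ i, c i * s i * t i, fun x _ => ?_⟩
    simp only [ev, ← Finset.sum_add_distrib]
    refine Finset.sum_congr rfl fun i _ => ?_
    push_cast
    linear_combination c i * x i * hs' i

/-- Permuting the coordinates and forgetting those that are constant on `V`. -/
theorem affineOn_comp {ι : Fin d' → Fin d} (hι : Function.Injective ι) {y : Fin d → ℤ}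
    (h : ∀ x ∈ V, ∀ i, i ∉ Set.range ι → x i = y i) : AffineOn V fun x i => x (ι i) := by
  classical
  have hsplit : ∀ g : Fin d → ℝ, ∑ i, g i = ∑ j, g (ι j) + ∑ i with i ∉ Set.range ι, g i := by
    intro g
    rw [← Finset.sum_filter_add_sum_filter_not Finset.univ (fun i => i ∈ Set.range ι)]
    congr 1
    rw [← Finset.sum_image (f := g) (g := ι) (s := Finset.univ) fun a _ b _ h => hι h]
    refine Finset.sum_congr ?_ fun _ _ => rfl
    ext i
    simp
  constructor
  · intro c
    refine ⟨Function.extend ι c 0, 0, fun x _ => ?_⟩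
    rw [ev, ev, hsplit, add_zero, Finset.sum_eq_zero (s := Finset.univ.filter _), add_zero]
    · exact Finset.sum_congr rfl fun j _ => by rw [hι.extend_apply]
    · intro i hi
      rw [Function.extend_apply' _ _ _ (by simpa using hi)]
      simp
  · intro c
    refine ⟨fun j => c (ι j), -∑ i with i ∉ Set.range ι, c i * y i, fun x hx => ?_⟩
    rw [ev, ev, hsplit]
    have : ∑ i with i ∉ Set.range ι, c i * (x i : ℝ) = ∑ i with i ∉ Set.range ι, c i * y i :=
      Finset.sum_congr rfl fun i hi => by rw [h x hx i (Finset.mem_filter.1 hi).2]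
    rw [this]
    ring

theorem AffineOn.comp {d'' : ℕ} {g : (Fin d' → ℤ) → (Fin d'' → ℤ)} (hg : AffineOn (V.image f) g)
    (hf : AffineOn V f) : AffineOn V fun x => g (f x) := by
  constructor
  · intro c
    obtain ⟨c', k, h⟩ := hg.pull c
    obtain ⟨c'', k', h'⟩ := hf.pull c'
    exact ⟨c'', k' + k, fun x hx => by
      rw [h _ (Finset.mem_image_of_mem f hx), h' x hx, add_assoc]⟩
  · intro c
    obtain ⟨c', k, h⟩ := hf.push c
    obtain ⟨c'', k', h'⟩ := hg.push c'
    exact ⟨c'', k + k', fun x hx => by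
      rw [h' _ (Finset.mem_image_of_mem f hx), h x hx, add_assoc]⟩

end Transport

/-! ### Facets in the boundary of the box -/

section Slice

variable {d : ℕ} {V : Finset (Fin (d + 1) → ℤ)} {i : Fin (d + 1)} {m : ℤ}

/-- Forgetting the coordinate `i`. -/
def drop (i : Fin (d + 1)) (x : Fin (d + 1) → ℤ) : Fin d → ℤ := fun j => x (i.succAbove j)

/-- The points of `V` with `i`-th coordinate `m`, seen in one dimension less. -/
def slice (V : Finset (Fin (d + 1) → ℤ)) (i : Fin (d + 1)) (m : ℤ) : Finset (Fin d → ℤ) :=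
  (V.filter fun x => x i = m).image (drop i)

theorem mem_slice {y : Fin d → ℤ} : y ∈ slice V i m ↔ ∃ x ∈ V, x i = m ∧ drop i x = y := by
  simp [slice, and_assoc]

theorem drop_mem_slice {x : Fin (d + 1) → ℤ} (hx : x ∈ V) (hi : x i = m) :
    drop i x ∈ slice V i m := mem_slice.2 ⟨x, hx, hi, rfl⟩

theorem affineOn_drop (V : Finset (Fin (d + 1) → ℤ)) (i : Fin (d + 1)) (m : ℤ) :
    AffineOn (V.filter fun x => x i = m) (drop i) :=
  affineOn_comp (y := fun _ => m) Fin.succAbove_right_injective fun x hx j hj => by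
    obtain rfl : j = i := by simpa [Fin.range_succAbove] using hj
    exact (Finset.mem_filter.1 hx).2

theorem ConvPos.slice (hV : ConvPos V) (i : Fin (d + 1)) (m : ℤ) : ConvPos (slice V i m) :=
  (affineOn_drop V i m).convPos (hV.subset (Finset.filter_subset _ _))

theorem Extreme.reach (h : Extreme V i m) (hV : ConvPos V) {n : ℕ} {x y : Fin (d + 1) → ℤ}
    (hx : x ∈ V) (hy : y ∈ V) (hxm : x i = m) (hym : y i = m)
    (hr : Reach (_root_.slice V i m) n (drop i x) (drop i y)) : Reach V n x y :=
  h.face.reach ((affineOn_drop V i m).reach (hV.subset (Finset.filter_subset _ _))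
    (Finset.mem_filter.2 ⟨hx, hxm⟩) (Finset.mem_filter.2 ⟨hy, hym⟩) hr)

theorem exists_extreme_bot (i : Fin (d + 1)) (hV : V.Nonempty) :
    ∃ m, Extreme V i m ∧ ∀ x ∈ V, m ≤ x i := by
  obtain ⟨x, hx, h⟩ := Finset.exists_min_image V (fun x => x i) hV
  exact ⟨x i, ⟨⟨x, hx, rfl⟩, .inl h⟩, h⟩

theorem exists_extreme_top (i : Fin (d + 1)) (hV : V.Nonempty) :
    ∃ m, Extreme V i m ∧ ∀ x ∈ V, x i ≤ m := by
  obtain ⟨x, hx, h⟩ := Finset.exists_max_image V (fun x => x i) hV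
  exact ⟨x i, ⟨⟨x, hx, rfl⟩, .inr h⟩, h⟩

/-- All points of `V` are in the grid `{0, 1, 2, 3}^d`. -/
def Boxed {d : ℕ} (V : Finset (Fin d → ℤ)) : Prop := ∀ x ∈ V, ∀ i, 0 ≤ x i ∧ x i ≤ 3

theorem Boxed.slice (hB : Boxed V) (i : Fin (d + 1)) (m : ℤ) : Boxed (slice V i m) := by
  intro y hy j
  obtain ⟨x, hx, -, rfl⟩ := mem_slice.1 hy
  exact hB x hx _

/-- Every lattice `(d, 3)`-polytope, given by its vertex set, has diameter at most `D`. -/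
def DiamLE (d D : ℕ) : Prop :=
  ∀ V : Finset (Fin d → ℤ), ConvPos V → Boxed V → ∀ u ∈ V, ∀ v ∈ V, Reach V D u v

/-- Walk to a facet of the bounding box from both ends, then within this facet. -/
theorem Extreme.reach_via (h : Extreme V i m) (hV : ConvPos V) (hB : Boxed V) {D : ℕ}
    (hD : DiamLE d D) {u v : Fin (d + 1) → ℤ} (hu : u ∈ V) (hv : v ∈ V) :
    Reach V ((u i - m).natAbs + (v i - m).natAbs + D) u v := by
  obtain ⟨x, hx, hxm, h1⟩ := h.exists_reach hV hu
  obtain ⟨y, hy, hym, h2⟩ := h.exists_reach hV hv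
  exact ((h1.trans (h.reach hV hx hy hxm hym (hD _ (hV.slice i m) (hB.slice i m) _
    (drop_mem_slice hx hxm) _ (drop_mem_slice hy hym)))).trans h2.symm).mono (by omega)

/-- At distance more than `D + 2`, the two points are opposite in each coordinate. -/
theorem opposite_of_far (hV : ConvPos V) (hB : Boxed V) {D : ℕ} (hD : DiamLE d D)
    {u v : Fin (d + 1) → ℤ} (hu : u ∈ V) (hv : v ∈ V) (hfar : ¬Reach V (D + 2) u v)
    (i : Fin (d + 1)) : u i + v i = 3 ∧ Extreme V i 0 ∧ Extreme V i 3 := by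
  obtain ⟨m, hm, hm'⟩ := exists_extreme_bot i ⟨u, hu⟩
  obtain ⟨n, hn, hn'⟩ := exists_extreme_top i ⟨u, hu⟩
  have h1 : ¬_ := fun hle => hfar ((hm.reach_via hV hB hD hu hv).mono hle)
  have h2 : ¬_ := fun hle => hfar ((hn.reach_via hV hB hD hu hv).mono hle)
  have hu' := hB u hu i
  have hv' := hB v hv i
  have := hm' u hu
  have := hm' v hv
  have := hn' u hu
  have := hn' v hv
  obtain ⟨x, hx, hxm⟩ := hm.1
  obtain ⟨y, hy, hyn⟩ := hn.1
  have hx' := hB x hx i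
  have hy' := hB y hy i
  obtain rfl : m = 0 := by omega
  obtain rfl : n = 3 := by omega
  exact ⟨by omega, hm, hn⟩

/-- The coordinate sum `u i + v i` is at most three from one side or the other, which bounds the
length of a walk through one of the two extreme facets. -/
theorem DiamLE.succ {D : ℕ} (hD : DiamLE d D) : DiamLE (d + 1) (D + 3) := by
  intro V hV hB u hu v hv
  by_contra hfar
  have h := opposite_of_far hV hB hD hu hv (fun h => hfar (h.mono (by omega))) 0
  have hu' := hB u hu 0
  have hv' := hB v hv 0
  exact hfar ((h.2.1.reach_via hV hB hD hu hv).mono (by omega))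

theorem diamLE_one : DiamLE 1 1 := fun _ hV _ _ hu _ hv =>
  reach_one_of_line (k := 0) hV (fun _ _ i hi => absurd (Subsingleton.elim i 0) hi) hu hv

theorem diamLE_two : DiamLE 2 4 := diamLE_one.succ

end Slice

/-! ### The search: data and moves

Points of `{0, 1, 2, 3}³` are coded by numbers below `64` in base four, and sets of points by the
binary digits of a natural number (a *mask*), so that the kernel evaluates the search with its
built-in arithmetic. For points `u`, `v` and a vertex set `V`, the number `256 * k + 64 * t + z`
codes the assertion that the point `z` is in `V` and within distance `t` of `u` (for `k = 0`) or of
`v` (for `k = 1`). -/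

namespace Search

/-- The `i`-th base-four digit of `n`. -/
def dig (n i : ℕ) : ℕ := n / 4 ^ i % 4

/-- Apply `k` to `n`. The recursion makes the kernel evaluate `n` before substituting it. -/
def force {α : Type} (n : ℕ) (k : ℕ → α) : α := Nat.casesOn n (k 0) fun m => k (Nat.succ m)

/-- The mask of the points whose `i`-th coordinate is `a`. -/
def slab (i a : ℕ) : ℕ :=
  (match i with
    | 0 => 0x1111111111111111
    | 1 => 0x000f000f000f000f
    | _ => 0xffff) <<< (a * 4 ^ i)

/-- The difference of two masks. -/
def andNot (a r : ℕ) : ℕ := a ^^^ (a &&& r)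

/-- The union of a list of masks. -/
def lorAll : List ℕ → ℕ
  | [] => 0
  | a :: l => a ||| lorAll l

/-- Whether `a` is extreme for the coordinate `i` in the box with largest corner `W`. -/
def isExt (W i a : ℕ) : Bool := a == 0 || a == dig W i

/-- The facet of the box `x i = z i`, or the empty mask if this is not a facet. -/
def facetMask (W z i : ℕ) : ℕ := if isExt W i (dig z i) then slab i (dig z i) else 0

/-- The point whose `i`-th coordinate is that of `z`, the two others being those of `3 - z`. -/
def flipTwo (z i : ℕ) : ℕ := 63 - z + 2 * dig z i * 4 ^ i - 3 * 4 ^ i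

/-- The only point of the facet `x i = z i` that may be at distance four from `z` within the facet:
it is opposite to `z` in an octagon, which takes a square of side three and exactly one extreme
coordinate `j` or `k`. -/
def octMask (W z i j k : ℕ) : ℕ :=
  if dig W j == 3 && (dig W k == 3 && (isExt W j (dig z j) != isExt W k (dig z k))) then
    1 <<< flipTwo z i else 0

/-- Points that are certainly within distance `m` of `z`, if they belong to `V`: those on a common
edge of the box, and those on a common facet when `m` is large enough. Here `e` bounds the
diameter of the facets. -/
def near (W e z m : ℕ) : ℕ :=
  match m with
  | 0 => 1 <<< z
  | _ =>
    force (facetMask W z 0) fun f0 => force (facetMask W z 1) fun f1 =>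
    force (facetMask W z 2) fun f2 =>
      (1 <<< z) ||| ((f0 &&& f1) ||| ((f0 &&& f2) ||| ((f1 &&& f2) |||
        (if e ≤ m then f0 ||| (f1 ||| f2)
        else if e = m + 1 then
          andNot f0 (octMask W z 0 1 2) ||| (andNot f1 (octMask W z 1 0 2) |||
            andNot f2 (octMask W z 2 0 1))
        else 0))))

/-- The assertions that would give a walk shorter than `b` from `u` to `v`, together with the
assertion coded by `f`. -/
def contra (W b e f : ℕ) : ℕ :=
  lorAll ((List.range 4).map fun t =>
    if f / 64 % 4 + t < b then
      near W e (f % 64) (b - 1 - (f / 64 % 4 + t)) <<< (256 * (1 - f / 256) + 64 * t) else 0)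

/-- A node of the search tree. -/
structure State where
  /-- The largest corner of the box. -/
  W : ℕ
  /-- The supposed lower bound for the distance of `u` and `v`. -/
  b : ℕ
  /-- An upper bound for the diameter of the facets. -/
  e : ℕ
  /-- The mask of the assertions that are not excluded. -/
  al : ℕ
  /-- The assertions supposed to hold, the latest first. -/
  F : List ℕ

/-- Suppose the assertion `f`, and exclude what is incompatible with it. -/
def State.add (s : State) (f : ℕ) : State :=
  match s with
  | ⟨W, b, e, al, F⟩ => force f fun f => ⟨W, b, e, andNot al (contra W b e f), f :: F⟩

/-- The members of the mask `m < 2 ^ n`, in descending order. -/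
def bits : ℕ → ℕ → List ℕ
  | 0, _ => []
  | n + 1, m => force m fun m => if m = 0 then [] else
      force (Nat.log2 m) fun k => k :: bits n (m % 2 ^ k)

/-- The value at the point `z` of the functional with coefficients `c i - 4`, where the `c i` are
the base-sixteen digits of `c`; the constant `36` is added to make it a natural number. -/
def value (c z : ℕ) : ℕ :=
  c % 16 * (z % 4) + c / 16 % 16 * (z / 4 % 4) + c / 256 % 16 * (z / 16 % 4) +
    4 * (9 - (z % 4 + z / 4 % 4 + z / 16 % 4))

/-- Whether the functional `c` is larger at `w` than at `z`. -/
def above (c z w : ℕ) : Bool := Nat.blt (value c z) (value c w)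

/-- Suppose that no point of `V` is above `z`. -/
def removePts (s : State) (c z : ℕ) : State :=
  match s with
  | ⟨W, b, e, al, F⟩ =>
    force (lorAll (((List.range 64).filter (above c z)).map fun w => 1 <<< w)) fun up =>
      ⟨W, b, e, andNot al (lorAll ((List.range 8).map fun j => up <<< (64 * j))), F⟩

/-- Whether `c` is plus or minus a coordinate that is not largest on the box at `z`. Then some point
of `V` is above `z`, because the coordinates have their full range on `V`. -/
def axisWit (W c z : ℕ) : Bool :=
  (c == 0x445 && Nat.blt (dig z 0) (dig W 0)) || (c == 0x443 && Nat.blt 0 (dig z 0)) ||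
  (c == 0x454 && Nat.blt (dig z 1) (dig W 1)) || (c == 0x434 && Nat.blt 0 (dig z 1)) ||
  (c == 0x544 && Nat.blt (dig z 2) (dig W 2)) || (c == 0x344 && Nat.blt 0 (dig z 2))

/-- Whether `b` is between `a` and `c`, with weights `p` and `q`. -/
def collinearTest (a b c p q : ℕ) : Bool :=
  Nat.blt 0 p && Nat.blt 0 q && a % 64 != b % 64 &&
  p * dig a 0 + q * dig c 0 == (p + q) * dig b 0 &&
  p * dig a 1 + q * dig c 1 == (p + q) * dig b 1 &&
  p * dig a 2 + q * dig c 2 == (p + q) * dig b 2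

/-- One move. The two lowest bits of the number `tok` select one of three kinds.
* Kind `0` chooses an assertion, about a point `z`, and a functional `c`, and branches over the
  neighbour of `z` above `z`. If the existence of a point above `z` is not witnessed (by the range
  of a coordinate, or by the point of another assertion), there is an additional branch without
  such points.
* Kind `1` closes the node: an assertion supposed to hold has been excluded.
* Kind `2` closes the node: one of three points of `V` is between the others. -/
def step (s : State) (tok : ℕ) : Option (List State) :=
  match s with
  | ⟨W, b, e, al, F⟩ =>
  force al fun al =>
  match F[tok / 4 % 64]? with
  | none => none
  | some f =>
    match tok % 4 with
    | 0 =>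
      force (f % 64) fun z => force (tok / 2 ^ 14) fun c => force (f - z + 64) fun f' =>
      if f / 64 % 4 = 3 then none else
      let cs := ((bits 64 (al / 2 ^ f' % 2 ^ 64)).filter (above c z)).map fun w =>
        State.add ⟨W, b, e, al, F⟩ (f' + w)
      match tok / 2 ^ 8 % 64 with
      | 0 => some (cs ++ [removePts ⟨W, b, e, al, F⟩ c z])
      | w + 1 =>
        if w = 62 then if axisWit W c z then some cs else none else
        match F[w]? with
        | none => none
        | some g => if above c z g then some cs else none
    | 1 => if al.testBit f then none else some []
    | _ =>
      match F[tok / 2 ^ 8 % 64]?, F[tok / 2 ^ 14 % 64]? with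
      | some g, some h =>
        if collinearTest f g h (tok / 2 ^ 22 % 4) (tok / 2 ^ 20 % 4) then some [] else none
      | _, _ => none

/-- Depth-first search: `run n N stack` makes at most `n` moves, which are the 28-bit digits of
`N`, and succeeds if all nodes get closed. -/
def run : ℕ → ℕ → List State → Bool
  | _, _, [] => true
  | 0, _, _ :: _ => false
  | n + 1, N, s :: st => force N fun N =>
    match step s (N % 2 ^ 28) with
    | none => false
    | some l => run n (N / 2 ^ 28) (l ++ st)

/-- The distance of two natural numbers. -/
def dist (a b : ℕ) : ℕ := (a - b) + (b - a)

/-- Points `z` which, when within distance `t` of one end, give a walk shorter than `b` to the other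
end `v`, through a facet, an edge or a vertex of the box. -/
def excluded (W b e t v : ℕ) : ℕ :=
  let fs := fun i => [0, dig W i]
  lorAll ((List.range 3).map fun i => lorAll ((fs i).map fun a => lorAll ((List.range 4).map fun x =>
    if t + dist x a + dist (dig v i) a + e < b then slab i x else 0))) |||
  (lorAll ((fs 0).map fun a0 => lorAll ((fs 1).map fun a1 =>
    if t + dist (dig v 0) a0 + dist (dig v 1) a1 + 1 < b then slab 0 a0 &&& slab 1 a1 else 0)) |||
  (lorAll ((fs 0).map fun a0 => lorAll ((fs 2).map fun a1 =>
    if t + dist (dig v 0) a0 + dist (dig v 2) a1 + 1 < b then slab 0 a0 &&& slab 2 a1 else 0)) |||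
  (lorAll ((fs 1).map fun a0 => lorAll ((fs 2).map fun a1 =>
    if t + dist (dig v 1) a0 + dist (dig v 2) a1 + 1 < b then slab 1 a0 &&& slab 2 a1 else 0)) |||
  lorAll ((fs 0).map fun a0 => lorAll ((fs 1).map fun a1 => lorAll ((fs 2).map fun a2 =>
    if t + dist (dig v 0) a0 + dist (dig v 1) a1 + dist (dig v 2) a2 < b then
      slab 0 a0 &&& (slab 1 a1 &&& slab 2 a2) else 0))))))

/-- The points that are not in the box. -/
def outside (W : ℕ) : ℕ :=
  lorAll ((List.range 3).map fun i => lorAll ((List.range 4).map fun a =>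
    if dig W i < a then slab i a else 0))

/-- The root of the search tree. -/
def start (W b e u v : ℕ) : State :=
  ((⟨W, b, e, andNot (2 ^ 512 - 1) (lorAll ((List.range 4).map fun t =>
      (excluded W b e t v ||| outside W) <<< (64 * t) |||
      (excluded W b e t u ||| outside W) <<< (256 + 64 * t))), []⟩ : State).add u).add (256 + v)

/-- Sorting the coordinates by this number makes a choice among the permutations of the
coordinates. -/
def key (W u v i : ℕ) : ℕ := 16 * (3 - dig W i) + 4 * dig u i + dig v i

/-- Whether `u` is in the half of the box next to the origin. -/
def low (W u : ℕ) : Bool :=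
  Nat.ble (2 * dig u 0) (dig W 0) && Nat.ble (2 * dig u 1) (dig W 1) &&
    Nat.ble (2 * dig u 2) (dig W 2)

/-- The distance to be excluded: only opposite points of the cube of side three may be at
distance six. -/
def bound (W u v : ℕ) : ℕ := if W = 63 ∧ u + v = 63 then 7 else 6

/-- Whether the walks through the facets of the box leave the distance `b` possible. -/
def admissible (W b u v : ℕ) : Bool :=
  (List.range 3).all fun i => Nat.ble (dig u i) (dig W i) && Nat.ble (dig v i) (dig W i) &&
    Nat.ble b (dig u i + dig v i + 4) && Nat.ble (b + dig u i + dig v i) (2 * dig W i + 4)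

/-- The roots for the box with largest corner `W`. The opposite points `(1, 1, 1)` (code `21`) and
`(2, 2, 2)` (code `42`) of the cube of side three are left out. -/
def pairs (W : ℕ) : List State :=
  ((List.range 64).filter (low W)).flatMap fun u =>
    ((List.range 64).filter fun v => Nat.ble (key W u v 0) (key W u v 1) &&
        Nat.ble (key W u v 1) (key W u v 2) && admissible W (bound W u v) u v &&
        (u != 21 || v != 42 || W != 63)).map fun v => start W (bound W u v) 4 u v

end Search

/-! ### The search: soundness -/

namespace Search

theorem force_eq {α : Type} (n : ℕ) (k : ℕ → α) : force n k = k n := by cases n <;> rfl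

theorem dig_lt (n i : ℕ) : dig n i < 4 := Nat.mod_lt _ (by norm_num)

theorem dig_mod (n : ℕ) {i : ℕ} (hi : i < 3) : dig (n % 64) i = dig n i := by
  unfold dig
  interval_cases i <;> norm_num <;> omega

theorem dig_inj {z w : ℕ} (hz : z < 64) (hw : w < 64) (h0 : dig z 0 = dig w 0)
    (h1 : dig z 1 = dig w 1) (h2 : dig z 2 = dig w 2) : z = w := by
  simp only [dig] at h0 h1 h2
  norm_num at h0 h1 h2
  omega

theorem slab_lt {i a : ℕ} (hi : i < 3) (ha : a < 4) : slab i a < 2 ^ 64 := by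
  interval_cases i <;> interval_cases a <;> decide +kernel

theorem testBit_slab {i a n : ℕ} (hi : i < 3) (ha : a < 4) :
    (slab i a).testBit n = true ↔ n < 64 ∧ dig n i = a := by
  rcases lt_or_ge n 64 with hn | hn
  · have key : ∀ i < 3, ∀ a < 4, ∀ n < 64, ((slab i a).testBit n = true ↔ dig n i = a) := by
      decide +kernel
    rw [key i hi a ha n hn]
    simp [hn]
  · have := Nat.testBit_lt_two_pow ((slab_lt hi ha).trans_le (Nat.pow_le_pow_right two_pos hn))
    simp [this, hn]

theorem testBit_andNot (a r n : ℕ) :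
    (andNot a r).testBit n = (a.testBit n && !r.testBit n) := by
  simp only [andNot, Nat.testBit_xor, Nat.testBit_and]
  cases a.testBit n <;> cases r.testBit n <;> rfl

theorem testBit_lorAll (l : List ℕ) (n : ℕ) :
    (lorAll l).testBit n = true ↔ ∃ a ∈ l, a.testBit n = true := by
  induction l with
  | nil => simp [lorAll]
  | cons a l ih => simp [lorAll, Nat.testBit_or, ih]

theorem testBit_one_shiftLeft (z n : ℕ) : (1 <<< z).testBit n = true ↔ n = z := by
  rw [Nat.one_shiftLeft, Nat.testBit_two_pow]
  simp [eq_comm]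

/-- The point with code `n`. -/
def pt (n : ℕ) : Fin 3 → ℤ := fun i => (dig n i : ℤ)

theorem pt_mod (n : ℕ) : pt (n % 64) = pt n := funext fun i => by
  simp only [pt, dig_mod n i.isLt]

/-- Codes for the points of the grid. -/
theorem exists_pt {x : Fin 3 → ℤ} (h : ∀ i, 0 ≤ x i ∧ x i ≤ 3) : ∃ n < 64, pt n = x := by
  have h0 := h 0
  have h1 := h 1
  have h2 := h 2
  refine ⟨(x 0 + 4 * x 1 + 16 * x 2).toNat, by omega, ?_⟩
  funext i
  fin_cases i <;> simp [pt, dig] <;> omega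

/-- The situation examined by the search: `V` is in convex position, with coordinate ranges
exactly `0, …, dig W i`, and the points with codes `u` and `v` are at distance at least `b`.
The diameter of the facets in the boundary of the box is at most `e`, and exactly `e` only between
points as in a planar octagon. -/
structure Ctx (V : Finset (Fin 3 → ℤ)) (W b e u v : ℕ) : Prop where
  conv : ConvPos V
  box : ∀ x ∈ V, ∀ i, 0 ≤ x i ∧ x i ≤ dig W i
  bot : ∀ i, ∃ x ∈ V, x i = 0
  top : ∀ i : Fin 3, ∃ x ∈ V, x i = dig W i
  left : pt u ∈ V
  right : pt v ∈ V
  far : ¬Reach V (b - 1) (pt u) (pt v)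
  facet : ∀ x ∈ V, ∀ y ∈ V, ∀ i : Fin 3, x i = y i → x i = 0 ∨ x i = dig W i → Reach V e x y
  octagon : ∀ x ∈ V, ∀ y ∈ V, ∀ i : Fin 3, x i = y i → x i = 0 ∨ x i = dig W i →
    ∀ m, e = m + 1 → Reach V m x y ∨ ∀ j k : Fin 3, j ≠ i → k ≠ i → j ≠ k →
      dig W j = 3 ∧ dig W k = 3 ∧ x j + y j = 3 ∧ x k + y k = 3 ∧
        ((x j = 0 ∨ x j = dig W j) ↔ ¬(x k = 0 ∨ x k = dig W k))

namespace Ctx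

variable {V : Finset (Fin 3 → ℤ)} {W b e u v : ℕ}

theorem face (h : Ctx V W b e u v) {i : Fin 3} {a : ℤ} (ha : a = 0 ∨ a = dig W i) :
    Face V (V.filter fun x => x i = a) := by
  rcases ha with rfl | rfl
  · exact face_eq_bot fun x hx => (h.box x hx i).1
  · exact face_eq_top fun x hx => (h.box x hx i).2

theorem reach_edge (h : Ctx V W b e u v) {i j k : Fin 3} (hijk : ∀ l, l = i ∨ l = j ∨ l = k)
    {x y : Fin 3 → ℤ} (hx : x ∈ V) (hy : y ∈ V) (hi : x i = y i) (hi' : x i = 0 ∨ x i = dig W i)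
    (hj : x j = y j) (hj' : x j = 0 ∨ x j = dig W j) : Reach V 1 x y := by
  refine (h.face hi').reach (Face.reach (W := (V.filter fun z => z i = x i).filter
    fun z => z j = x j) ?_ ?_)
  · have hsub : ∀ z ∈ V.filter (fun z => z i = x i), z ∈ V := fun z hz =>
      (Finset.mem_filter.1 hz).1
    rcases hj' with hj' | hj' <;> rw [hj']
    · exact face_eq_bot fun z hz => (h.box z (hsub z hz) j).1
    · exact face_eq_top fun z hz => (h.box z (hsub z hz) j).2
  · refine reach_one_of_line (h.conv.subset ((Finset.filter_subset _ _).trans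
      (Finset.filter_subset _ _))) (k := k) (fun z hz l hl => ?_) (by simp [hx])
      (by simp [hy, hi, hj])
    simp only [Finset.mem_filter] at hz
    rcases hijk l with rfl | rfl | rfl
    · exact hz.1.2
    · exact hz.2
    · exact absurd rfl hl

end Ctx

theorem isExt_iff (W i a : ℕ) : isExt W i a = true ↔ (a : ℤ) = 0 ∨ (a : ℤ) = dig W i := by
  simp [isExt]

theorem testBit_facetMask {W z i n : ℕ} (hi : i < 3) : (facetMask W z i).testBit n = true ↔
    n < 64 ∧ dig z i = dig n i ∧ ((dig z i : ℤ) = 0 ∨ (dig z i : ℤ) = dig W i) := by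
  unfold facetMask
  by_cases h : isExt W i (dig z i) = true
  · rw [if_pos h, testBit_slab hi (dig_lt _ _)]
    rw [isExt_iff] at h
    tauto
  · rw [if_neg h]
    rw [isExt_iff] at h
    simp only [Nat.zero_testBit]
    tauto

theorem eq_flipTwo : ∀ z < 64, ∀ w < 64,
    (dig z 0 = dig w 0 → dig z 1 + dig w 1 = 3 → dig z 2 + dig w 2 = 3 → w = flipTwo z 0) ∧
    (dig z 1 = dig w 1 → dig z 0 + dig w 0 = 3 → dig z 2 + dig w 2 = 3 → w = flipTwo z 1) ∧
    (dig z 2 = dig w 2 → dig z 0 + dig w 0 = 3 → dig z 1 + dig w 1 = 3 → w = flipTwo z 2) := by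
  intro z hz w hw
  simp only [dig, flipTwo]
  norm_num
  refine ⟨fun h0 h1 h2 => ?_, fun h0 h1 h2 => ?_, fun h0 h1 h2 => ?_⟩ <;> omega

theorem testBit_octMask {W z i j k w : ℕ} (hj : dig W j = 3) (hk : dig W k = 3)
    (hjk : ((dig z j : ℤ) = 0 ∨ (dig z j : ℤ) = dig W j) ↔
      ¬((dig z k : ℤ) = 0 ∨ (dig z k : ℤ) = dig W k)) (hw : w = flipTwo z i) :
    (octMask W z i j k).testBit w = true := by
  have : (isExt W j (dig z j) != isExt W k (dig z k)) = true := by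
    rw [← isExt_iff, ← isExt_iff] at hjk
    cases h1 : isExt W j (dig z j) <;> cases h2 : isExt W k (dig z k) <;> simp [h1, h2] at hjk ⊢
  rw [octMask, if_pos (by simp only [hj, hk, this]; rfl), testBit_one_shiftLeft]
  exact hw

section Sound

variable {V : Finset (Fin 3 → ℤ)} {W b e u v : ℕ}

theorem Ctx.reach_of_near (h : Ctx V W b e u v) {z w m : ℕ} (hz : z < 64) (hzV : pt z ∈ V)
    (hwV : pt w ∈ V) (hw : w < 64) (hn : (near W e z m).testBit w = true) :
    Reach V m (pt z) (pt w) := by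
  have hself : w = z → Reach V m (pt z) (pt w) := fun h => by rw [h] at hwV ⊢; exact .refl hwV
  rcases m with - | m
  · exact hself ((testBit_one_shiftLeft _ _).1 hn)
  simp only [near, force_eq, Nat.testBit_or, Bool.or_eq_true, Nat.testBit_and, Bool.and_eq_true,
    testBit_one_shiftLeft] at hn
  have e0 := testBit_facetMask (W := W) (z := z) (n := w) (i := 0) (by norm_num)
  have e1 := testBit_facetMask (W := W) (z := z) (n := w) (i := 1) (by norm_num)
  have e2 := testBit_facetMask (W := W) (z := z) (n := w) (i := 2) (by norm_num)
  rcases hn with hn | ⟨h0, h1⟩ | ⟨h0, h1⟩ | ⟨h0, h1⟩ | hn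
  · exact hself hn
  · rw [e0] at h0; rw [e1] at h1
    exact (h.reach_edge (i := 0) (j := 1) (k := 2) (by decide) hzV hwV
      (congrArg Nat.cast h0.2.1) h0.2.2 (congrArg Nat.cast h1.2.1) h1.2.2).mono (by omega)
  · rw [e0] at h0; rw [e2] at h1
    exact (h.reach_edge (i := 0) (j := 2) (k := 1) (by decide) hzV hwV
      (congrArg Nat.cast h0.2.1) h0.2.2 (congrArg Nat.cast h1.2.1) h1.2.2).mono (by omega)
  · rw [e1] at h0; rw [e2] at h1
    exact (h.reach_edge (i := 1) (j := 2) (k := 0) (by decide) hzV hwV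
      (congrArg Nat.cast h0.2.1) h0.2.2 (congrArg Nat.cast h1.2.1) h1.2.2).mono (by omega)
  split_ifs at hn with hem hem
  · simp only [Nat.testBit_or, Bool.or_eq_true, e0, e1, e2] at hn
    rcases hn with hn | hn | hn
    · exact (h.facet _ hzV _ hwV 0 (congrArg Nat.cast hn.2.1) hn.2.2).mono hem
    · exact (h.facet _ hzV _ hwV 1 (congrArg Nat.cast hn.2.1) hn.2.2).mono hem
    · exact (h.facet _ hzV _ hwV 2 (congrArg Nat.cast hn.2.1) hn.2.2).mono hem
  · simp only [Nat.testBit_or, Bool.or_eq_true, testBit_andNot, Bool.and_eq_true, e0, e1, e2,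
      Bool.not_eq_true'] at hn
    obtain ⟨f0, f1, f2⟩ := eq_flipTwo z hz w hw
    rcases hn with ⟨hn, ho⟩ | ⟨hn, ho⟩ | ⟨hn, ho⟩
    · rcases h.octagon _ hzV _ hwV 0 (congrArg Nat.cast hn.2.1) hn.2.2 _ hem with hr | hr
      · exact hr
      · obtain ⟨a1, a2, a3, a4, a5⟩ := hr 1 2 (by decide) (by decide) (by decide)
        have a3 : (dig z 1 : ℤ) + dig w 1 = 3 := a3
        have a4 : (dig z 2 : ℤ) + dig w 2 = 3 := a4
        have := testBit_octMask a1 a2 a5 (f0 hn.2.1 (by exact_mod_cast a3) (by exact_mod_cast a4))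
        exact absurd (ho.symm.trans this) (by simp)
    · rcases h.octagon _ hzV _ hwV 1 (congrArg Nat.cast hn.2.1) hn.2.2 _ hem with hr | hr
      · exact hr
      · obtain ⟨a1, a2, a3, a4, a5⟩ := hr 0 2 (by decide) (by decide) (by decide)
        have a3 : (dig z 0 : ℤ) + dig w 0 = 3 := a3
        have a4 : (dig z 2 : ℤ) + dig w 2 = 3 := a4
        have := testBit_octMask a1 a2 a5 (f1 hn.2.1 (by exact_mod_cast a3) (by exact_mod_cast a4))
        exact absurd (ho.symm.trans this) (by simp)
    · rcases h.octagon _ hzV _ hwV 2 (congrArg Nat.cast hn.2.1) hn.2.2 _ hem with hr | hr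
      · exact hr
      · obtain ⟨a1, a2, a3, a4, a5⟩ := hr 0 1 (by decide) (by decide) (by decide)
        have a3 : (dig z 0 : ℤ) + dig w 0 = 3 := a3
        have a4 : (dig z 1 : ℤ) + dig w 1 = 3 := a4
        have := testBit_octMask a1 a2 a5 (f2 hn.2.1 (by exact_mod_cast a3) (by exact_mod_cast a4))
        exact absurd (ho.symm.trans this) (by simp)
  · simp at hn

/-- `near` has only bits below `64`. -/
theorem lt_of_testBit_near {z m n : ℕ} (hz : z < 64) (hn : (near W e z m).testBit n = true) :
    n < 64 := by
  rcases m with - | m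
  · rw [(testBit_one_shiftLeft _ _).1 hn]; exact hz
  simp only [near, force_eq, Nat.testBit_or, Bool.or_eq_true, Nat.testBit_and, Bool.and_eq_true,
    testBit_one_shiftLeft] at hn
  have e0 := testBit_facetMask (W := W) (z := z) (n := n) (i := 0) (by norm_num)
  have e1 := testBit_facetMask (W := W) (z := z) (n := n) (i := 1) (by norm_num)
  have e2 := testBit_facetMask (W := W) (z := z) (n := n) (i := 2) (by norm_num)
  split_ifs at hn <;>
  simp only [Nat.testBit_or, Bool.or_eq_true, testBit_andNot, Bool.and_eq_true, e0, e1, e2,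
    Nat.zero_testBit] at hn <;> grind

/-- The fact with code `256 * k + 64 * t + z`: the point with code `z` belongs to `V` and is within
distance `t` of `u` (if `k = 0`) or of `v` (if `k = 1`). -/
def Fact (V : Finset (Fin 3 → ℤ)) (u v n : ℕ) : Prop :=
  pt n ∈ V ∧ Reach V (n / 64 % 4) (pt (if n / 256 = 0 then u else v)) (pt n)

theorem Ctx.contra_sound (h : Ctx V W b e u v) {f g : ℕ} (hf : f < 512) (hg : g < 512)
    (hF : Fact V u v f) (hG : Fact V u v g) (hn : (contra W b e f).testBit g = true) : False := by
  rw [contra, testBit_lorAll] at hn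
  obtain ⟨a, ha, hn⟩ := hn
  obtain ⟨t, ht, rfl⟩ := List.mem_map.1 ha
  rw [List.mem_range] at ht
  split_ifs at hn with hb
  · rw [Nat.testBit_shiftLeft, Bool.and_eq_true, decide_eq_true_eq] at hn
    obtain ⟨hle, hn⟩ := hn
    have hlt := lt_of_testBit_near (Nat.mod_lt _ (by norm_num)) hn
    set w := g - (256 * (1 - f / 256) + 64 * t) with hw
    have hgw : g % 64 = w := by omega
    have hgt : g / 64 % 4 = t := by omega
    have hr := h.reach_of_near (Nat.mod_lt f (by norm_num)) (by rw [pt_mod]; exact hF.1)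
      (by rw [← hgw, pt_mod]; exact hG.1) hlt hn
    rw [pt_mod, ← hgw, pt_mod] at hr
    obtain ⟨-, hF⟩ := hF
    obtain ⟨-, hG⟩ := hG
    rcases Nat.eq_zero_or_pos (f / 256) with hk | hk
    · rw [if_pos hk] at hF
      rw [if_neg (by omega)] at hG
      exact h.far (((hF.trans hr).trans hG.symm).mono (by omega))
    · rw [if_neg hk.ne'] at hF
      rw [if_pos (by omega)] at hG
      exact h.far (((hG.trans hr.symm).trans hF.symm).mono (by omega))
  · simp at hn

/-- The state `s` is consistent with the facts about `V`, `u` and `v`. -/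
structure Holds (V : Finset (Fin 3 → ℤ)) (u v : ℕ) (s : State) : Prop where
  ctx : Ctx V s.W s.b s.e u v
  al : ∀ n < 512, Fact V u v n → s.al.testBit n = true
  F : ∀ n ∈ s.F, n < 512 ∧ Fact V u v n

theorem Holds.add {s : State} (h : Holds V u v s) {f : ℕ} (hf : f < 512) (hF : Fact V u v f) :
    Holds V u v (s.add f) := by
  obtain ⟨W, b, e, al, F⟩ := s
  simp only [State.add, force_eq]
  refine ⟨h.ctx, fun n hn hN => ?_, fun n hn => ?_⟩
  · simp only [testBit_andNot, h.al n hn hN, Bool.true_and, Bool.not_eq_true', Bool.eq_false_iff]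
    exact fun hc => h.ctx.contra_sound hf hn hF hN hc
  · rcases List.mem_cons.1 hn with rfl | hn
    · exact ⟨hf, hF⟩
    · exact h.F n hn

theorem mem_bits {n m w : ℕ} (hm : m < 2 ^ n) (hw : m.testBit w = true) : w ∈ bits n m := by
  induction n generalizing m with
  | zero => simp at hm; simp [hm] at hw
  | succ n ih =>
    have hm0 : m ≠ 0 := fun h => by simp [h] at hw
    simp only [bits, force_eq, if_neg hm0, List.mem_cons]
    rcases lt_trichotomy w m.log2 with h | h | h
    · right
      refine ih ((Nat.mod_lt _ (by positivity)).trans_le ?_) ?_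
      · have := (Nat.log2_lt hm0).2 hm
        exact Nat.pow_le_pow_right two_pos (by omega)
      · rw [Nat.testBit_mod_two_pow, hw]; simp [h]
    · exact .inl h
    · have := Nat.testBit_lt_two_pow (Nat.lt_log2_self.trans_le (Nat.pow_le_pow_right two_pos h))
      simp [this] at hw

/-- The functional with code `c`. -/
def coef (c : ℕ) : Fin 3 → ℤ := fun i => ((c / 16 ^ (i : ℕ) % 16 : ℕ) : ℤ) - 4

theorem value_eq (c z : ℕ) : (value c z : ℤ) = ∑ i, coef c i * pt z i + 36 := by
  have h : z % 4 + z / 4 % 4 + z / 16 % 4 ≤ 9 := by omega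
  simp only [value, coef, pt, dig, Fin.sum_univ_three]
  push_cast [Nat.cast_sub h]
  simp
  ring

theorem above_iff (c z w : ℕ) :
    above c z w = true ↔ ∑ i, coef c i * pt z i < ∑ i, coef c i * pt w i := by
  have h1 := value_eq c z
  have h2 := value_eq c w
  rw [above, Nat.blt_eq]
  omega

theorem Ctx.exists_pt_of_mem (h : Ctx V W b e u v) {x : Fin 3 → ℤ} (hx : x ∈ V) :
    ∃ n < 64, pt n = x :=
  exists_pt fun i => ⟨(h.box x hx i).1, (h.box x hx i).2.trans
    (by exact_mod_cast Nat.le_of_lt_succ (dig_lt W i))⟩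

theorem Holds.remove {s : State} (h : Holds V u v s) {c z : ℕ}
    (hc : ∀ w, pt w ∈ V → above c z w = true → False) : Holds V u v (removePts s c z) := by
  obtain ⟨W, b, e, al, F⟩ := s
  simp only [removePts, force_eq]
  refine ⟨h.ctx, fun n hn hN => ?_, h.F⟩
  simp only [testBit_andNot, h.al n hn hN, Bool.true_and, Bool.not_eq_true', Bool.eq_false_iff]
  intro hcon
  obtain ⟨a, ha, hcon⟩ := (testBit_lorAll _ _).1 hcon
  obtain ⟨j, -, rfl⟩ := List.mem_map.1 ha
  rw [Nat.testBit_shiftLeft, Bool.and_eq_true, decide_eq_true_eq, testBit_lorAll] at hcon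
  obtain ⟨hle, a, ha, hcon⟩ := hcon
  obtain ⟨w, hw, rfl⟩ := List.mem_map.1 ha
  rw [testBit_one_shiftLeft] at hcon
  rw [List.mem_filter, List.mem_range] at hw
  refine hc w ?_ hw.2
  have : n % 64 = w := by omega
  rw [← this, pt_mod]
  exact hN.1

theorem Ctx.axisWit_sound (h : Ctx V W b e u v) {c z : ℕ} (hc : axisWit W c z = true) :
    ∃ y ∈ V, ∑ i, coef c i * pt z i < ∑ i, coef c i * y i := by
  simp only [axisWit, Bool.or_eq_true, Bool.and_eq_true, beq_iff_eq, Nat.blt_eq] at hc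
  rcases hc with ((((hc | hc) | hc) | hc) | hc) | hc <;> obtain ⟨rfl, hlt⟩ := hc
  · obtain ⟨y, hy, hy'⟩ := h.top 0
    exact ⟨y, hy, by simp [coef, Fin.sum_univ_three, pt, hy'] at hlt ⊢; omega⟩
  · obtain ⟨y, hy, hy'⟩ := h.bot 0
    exact ⟨y, hy, by simp [coef, Fin.sum_univ_three, pt, hy'] at hlt ⊢; omega⟩
  · obtain ⟨y, hy, hy'⟩ := h.top 1
    exact ⟨y, hy, by simp [coef, Fin.sum_univ_three, pt, hy'] at hlt ⊢; omega⟩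
  · obtain ⟨y, hy, hy'⟩ := h.bot 1
    exact ⟨y, hy, by simp [coef, Fin.sum_univ_three, pt, hy'] at hlt ⊢; omega⟩
  · obtain ⟨y, hy, hy'⟩ := h.top 2
    exact ⟨y, hy, by simp [coef, Fin.sum_univ_three, pt, hy'] at hlt ⊢; omega⟩
  · obtain ⟨y, hy, hy'⟩ := h.bot 2
    exact ⟨y, hy, by simp [coef, Fin.sum_univ_three, pt, hy'] at hlt ⊢; omega⟩

theorem Holds.branch {s : State} (h : Holds V u v s) {c f : ℕ} (hf : f < 512) (hF : Fact V u v f)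
    (ht : f / 64 % 4 ≠ 3) {y : Fin 3 → ℤ} (hy : y ∈ V)
    (hc : ∑ i, coef c i * pt (f % 64) i < ∑ i, coef c i * y i) :
    ∃ w ∈ (bits 64 (s.al / 2 ^ (f - f % 64 + 64) % 2 ^ 64)).filter (above c (f % 64)),
      Holds V u v (s.add (f - f % 64 + 64 + w)) := by
  obtain ⟨x, hx, hlt⟩ := exists_improving_int h.ctx.conv (coef c)
    (by rw [pt_mod]; exact hF.1) hy hc
  obtain ⟨w, hw, rfl⟩ := h.ctx.exists_pt_of_mem hx.2.1
  have hmod : (f - f % 64 + 64 + w) % 64 = w := by omega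
  have hlt' : f - f % 64 + 64 + w < 512 := by omega
  have hfact : Fact V u v (f - f % 64 + 64 + w) := by
    rw [Fact, ← pt_mod (f - f % 64 + 64 + w), hmod]
    refine ⟨hx.2.1, ?_⟩
    have h1 : (f - f % 64 + 64 + w) / 64 % 4 = f / 64 % 4 + 1 := by omega
    have h2 : (f - f % 64 + 64 + w) / 256 = f / 256 := by omega
    rw [h1, h2]
    refine hF.2.trans (.single ?_)
    rwa [pt_mod] at hx
  refine ⟨w, List.mem_filter.2 ⟨mem_bits (Nat.mod_lt _ (by positivity)) ?_,
    (above_iff _ _ _).2 hlt⟩, h.add hlt' hfact⟩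
  rw [Nat.testBit_mod_two_pow, Nat.testBit_div_two_pow, Nat.add_comm, h.al _ hlt' hfact]
  simp [hw]

theorem Holds.not_collinear {s : State} (h : Holds V u v s) {f g k p q : ℕ} (hf : f ∈ s.F)
    (hg : g ∈ s.F) (hk : k ∈ s.F) (hc : collinearTest f g k p q = true) : False := by
  simp only [collinearTest, Bool.and_eq_true, Nat.blt_eq, bne_iff_ne, beq_iff_eq] at hc
  obtain ⟨⟨⟨⟨⟨hp, hq⟩, hne⟩, h0⟩, h1⟩, h2⟩ := hc
  refine h.ctx.conv.not_between (h.F f hf).2.1 (h.F g hg).2.1 (h.F k hk).2.1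
    (p := p) (q := q) (by omega) (by omega) (fun hfg => hne ?_) fun i => ?_
  · rw [← pt_mod f, ← pt_mod g] at hfg
    have hd : ∀ i : Fin 3, dig (f % 64) i = dig (g % 64) i := fun i => by
      exact Nat.cast_injective (R := ℤ) (congrFun hfg i)
    exact dig_inj (Nat.mod_lt _ (by norm_num)) (Nat.mod_lt _ (by norm_num)) (hd 0) (hd 1) (hd 2)
  · simp only [pt]
    fin_cases i
    · exact_mod_cast h0
    · exact_mod_cast h1
    · exact_mod_cast h2

theorem step_sound {s : State} (h : Holds V u v s) {tok : ℕ} {l : List State}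
    (hl : step s tok = some l) : ∃ s' ∈ l, Holds V u v s' := by
  obtain ⟨W, b, e, al, F⟩ := s
  simp only [step, force_eq] at hl
  split at hl
  · simp at hl
  rename_i f hfm
  have hf := h.F f (List.mem_of_getElem? hfm)
  split at hl
  · by_cases ht : f / 64 % 4 = 3
    · simp [ht] at hl
    rw [if_neg ht] at hl
    have key : ∀ y ∈ V, (∑ i, coef (tok / 2 ^ 14) i * pt (f % 64) i <
        ∑ i, coef (tok / 2 ^ 14) i * y i) → ∃ s' ∈ ((bits 64 (al / 2 ^ (f - f % 64 + 64) % 2 ^ 64)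
        ).filter (above (tok / 2 ^ 14) (f % 64))).map fun w =>
        State.add ⟨W, b, e, al, F⟩ (f - f % 64 + 64 + w), Holds V u v s' := by
      intro y hy hc
      obtain ⟨w, hw, hh⟩ := h.branch hf.1 hf.2 ht hy hc
      exact ⟨_, List.mem_map.2 ⟨w, hw, rfl⟩, hh⟩
    split at hl
    · obtain rfl := Option.some.inj hl
      by_cases hex : ∃ w, pt w ∈ V ∧ above (tok / 2 ^ 14) (f % 64) w = true
      · obtain ⟨w, hw, ha⟩ := hex
        obtain ⟨s', hs', hh⟩ := key _ hw ((above_iff _ _ _).1 ha)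
        exact ⟨s', List.mem_append_left _ hs', hh⟩
      · exact ⟨_, List.mem_append_right _ (List.mem_singleton_self _),
          h.remove fun w hw ha => hex ⟨w, hw, ha⟩⟩
    · rename_i w hw
      by_cases hw62 : w = 62
      · rw [if_pos hw62] at hl
        split_ifs at hl with hax
        obtain rfl := Option.some.inj hl
        obtain ⟨y, hy, hc⟩ := h.ctx.axisWit_sound hax
        exact key y hy hc
      · rw [if_neg hw62] at hl
        split at hl
        · simp at hl
        · rename_i g hg
          split_ifs at hl with ha
          obtain rfl := Option.some.inj hl
          exact key _ (h.F g (List.mem_of_getElem? hg)).2.1 ((above_iff _ _ _).1 ha)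
  · split_ifs at hl with ht
    exact absurd (h.al f hf.1 hf.2) ht
  · split at hl
    · rename_i g k hg hk
      split_ifs at hl with hc
      exact (h.not_collinear (List.mem_of_getElem? hfm) (List.mem_of_getElem? hg)
        (List.mem_of_getElem? hk) hc).elim
    · simp at hl

theorem run_sound {n N : ℕ} {st : List State} (h : run n N st = true) :
    ∀ s ∈ st, ¬Holds V u v s := by
  induction n generalizing N st with
  | zero => cases st with
    | nil => simp
    | cons s st => simp [run] at h
  | succ n ih => cases st with
    | nil => simp
    | cons s st =>
      simp only [run, force_eq] at h
      split at h
      · simp at h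
      rename_i l hl
      have := ih h
      intro s' hs'
      rcases List.mem_cons.1 hs' with rfl | hs'
      · intro hh
        obtain ⟨s'', h1, h2⟩ := step_sound hh hl
        exact this s'' (List.mem_append_left _ h1) h2
      · exact this s' (List.mem_append_right _ hs')

end Sound
end Search

namespace Search

variable {V : Finset (Fin 3 → ℤ)} {W b e u v : ℕ}

theorem dist_eq (a b : ℕ) : dist a b = ((a : ℤ) - b).natAbs := by
  unfold dist
  omega

namespace Ctx

theorem exists_sign (h : Ctx V W b e u v) (i : Fin 3) {a : ℤ} (ha : a = 0 ∨ a = dig W i) :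
    ∃ s : ℤ, s ≠ 0 ∧ ∀ x ∈ V, s * x i ≤ s * a ∧ s * (a - x i) = (x i - a).natAbs := by
  rcases ha with rfl | rfl
  · refine ⟨-1, by norm_num, fun x hx => ?_⟩
    have := h.box x hx i
    omega
  · refine ⟨1, by norm_num, fun x hx => ?_⟩
    have := h.box x hx i
    omega

theorem extreme (h : Ctx V W b e u v) (i : Fin 3) {a : ℤ} (ha : a = 0 ∨ a = dig W i) :
    Extreme V i a := by
  rcases ha with rfl | rfl
  · exact ⟨h.bot i, .inl fun x hx => (h.box x hx i).1⟩
  · exact ⟨h.top i, .inr fun x hx => (h.box x hx i).2⟩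

theorem reach_via_facet (h : Ctx V W b e u v) (i : Fin 3) {a : ℤ} (ha : a = 0 ∨ a = dig W i)
    {x y : Fin 3 → ℤ} (hx : x ∈ V) (hy : y ∈ V) :
    Reach V ((x i - a).natAbs + (y i - a).natAbs + e) x y := by
  obtain ⟨x', hx', hxa, h1⟩ := (h.extreme i ha).exists_reach h.conv hx
  obtain ⟨y', hy', hya, h2⟩ := (h.extreme i ha).exists_reach h.conv hy
  exact ((h1.trans (h.facet x' hx' y' hy' i (hxa.trans hya.symm) (hxa ▸ ha))).trans h2.symm).mono
    (by omega)

theorem reach_via_edge (h : Ctx V W b e u v) {i j k : Fin 3} (hijk : ∀ l, l = i ∨ l = j ∨ l = k)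
    (hij : i ≠ j) {x y : Fin 3 → ℤ} (hx : x ∈ V) (hy : y ∈ V) (hi : x i = 0 ∨ x i = dig W i)
    (hj : x j = 0 ∨ x j = dig W j) :
    Reach V ((y i - x i).natAbs + (y j - x j).natAbs + 1) x y := by
  obtain ⟨w, hw, h1, h2, hreach⟩ := (h.extreme i hi).exists_reach₂ (h.extreme j hj) hij h.conv hx
    rfl rfl hy
  exact ((h.reach_edge hijk hx hw h1.symm hi h2.symm hj).trans hreach.symm).mono (by omega)

theorem reach_via_vertex (h : Ctx V W b e u v) {x y : Fin 3 → ℤ} (hx : x ∈ V) (hy : y ∈ V)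
    (hi : ∀ i : Fin 3, x i = 0 ∨ x i = dig W i) :
    Reach V (∑ i, (y i - x i).natAbs) x y := by
  choose s hs hsV using fun i => h.exists_sign i (hi i)
  obtain ⟨w, hw, hwx, hreach⟩ := _root_.exists_reach_face h.conv (c := s) hx
    (fun z hz l => (hsV l z hz).1) hy (n := ∑ i, (y i - x i).natAbs)
    (by push_cast
        exact Finset.sum_le_sum fun i _ => by rw [(hsV i y hy).2]; simp)
  have : w = x := funext fun i => by simpa [hs i] using hwx i
  rw [this] at hreach
  exact hreach.symm

end Ctx

theorem testBit_excluded {t q z : ℕ} (hn : (excluded W b e t q).testBit z = true) :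
    z < 64 ∧ ((∃ i < 3, ∃ a, (a = 0 ∨ a = dig W i) ∧
        t + dist (dig z i) a + dist (dig q i) a + e < b) ∨
      (∃ i j k : Fin 3, (∀ l, l = i ∨ l = j ∨ l = k) ∧ i ≠ j ∧ (dig z i = 0 ∨ dig z i = dig W i) ∧
        (dig z j = 0 ∨ dig z j = dig W j) ∧
        t + dist (dig q i) (dig z i) + dist (dig q j) (dig z j) + 1 < b) ∨
      ((∀ i : Fin 3, dig z i = 0 ∨ dig z i = dig W i) ∧ t + dist (dig q 0) (dig z 0) +
        dist (dig q 1) (dig z 1) + dist (dig q 2) (dig z 2) < b)) := by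
  have hfs : ∀ {a i : ℕ}, a ∈ [0, dig W i] → (a = 0 ∨ a = dig W i) ∧ a < 4 := by
    intro a i ha
    have := dig_lt W i
    simp only [List.mem_cons, List.not_mem_nil, or_false] at ha
    exact ⟨ha, by rcases ha with rfl | rfl <;> omega⟩
  simp only [excluded, Nat.testBit_or, Bool.or_eq_true] at hn
  rcases hn with hn | hn | hn | hn | hn
  · obtain ⟨_, hm, hn⟩ := (testBit_lorAll _ _).1 hn
    obtain ⟨i, hi, rfl⟩ := List.mem_map.1 hm
    obtain ⟨_, hm, hn⟩ := (testBit_lorAll _ _).1 hn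
    obtain ⟨a, ha, rfl⟩ := List.mem_map.1 hm
    obtain ⟨_, hm, hn⟩ := (testBit_lorAll _ _).1 hn
    obtain ⟨x, hx, rfl⟩ := List.mem_map.1 hm
    rw [List.mem_range] at hi hx
    split_ifs at hn with hlt
    · obtain ⟨hz, rfl⟩ := (testBit_slab hi hx).1 hn
      exact ⟨hz, .inl ⟨i, hi, a, (hfs ha).1, hlt⟩⟩
    · simp at hn
  · obtain ⟨_, hm, hn⟩ := (testBit_lorAll _ _).1 hn
    obtain ⟨a, ha, rfl⟩ := List.mem_map.1 hm
    obtain ⟨_, hm, hn⟩ := (testBit_lorAll _ _).1 hn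
    obtain ⟨a', ha', rfl⟩ := List.mem_map.1 hm
    split_ifs at hn with hlt
    · rw [Nat.testBit_and, Bool.and_eq_true, testBit_slab (by norm_num) (hfs ha).2,
        testBit_slab (by norm_num) (hfs ha').2] at hn
      obtain ⟨⟨hz, rfl⟩, -, rfl⟩ := hn
      exact ⟨hz, .inr (.inl ⟨0, 1, 2, by decide, by decide, (hfs ha).1, (hfs ha').1, hlt⟩)⟩
    · simp at hn
  · obtain ⟨_, hm, hn⟩ := (testBit_lorAll _ _).1 hn
    obtain ⟨a, ha, rfl⟩ := List.mem_map.1 hm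
    obtain ⟨_, hm, hn⟩ := (testBit_lorAll _ _).1 hn
    obtain ⟨a', ha', rfl⟩ := List.mem_map.1 hm
    split_ifs at hn with hlt
    · rw [Nat.testBit_and, Bool.and_eq_true, testBit_slab (by norm_num) (hfs ha).2,
        testBit_slab (by norm_num) (hfs ha').2] at hn
      obtain ⟨⟨hz, rfl⟩, -, rfl⟩ := hn
      exact ⟨hz, .inr (.inl ⟨0, 2, 1, by decide, by decide, (hfs ha).1, (hfs ha').1, hlt⟩)⟩
    · simp at hn
  · obtain ⟨_, hm, hn⟩ := (testBit_lorAll _ _).1 hn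
    obtain ⟨a, ha, rfl⟩ := List.mem_map.1 hm
    obtain ⟨_, hm, hn⟩ := (testBit_lorAll _ _).1 hn
    obtain ⟨a', ha', rfl⟩ := List.mem_map.1 hm
    split_ifs at hn with hlt
    · rw [Nat.testBit_and, Bool.and_eq_true, testBit_slab (by norm_num) (hfs ha).2,
        testBit_slab (by norm_num) (hfs ha').2] at hn
      obtain ⟨⟨hz, rfl⟩, -, rfl⟩ := hn
      exact ⟨hz, .inr (.inl ⟨1, 2, 0, by decide, by decide, (hfs ha).1, (hfs ha').1, hlt⟩)⟩
    · simp at hn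
  · obtain ⟨_, hm, hn⟩ := (testBit_lorAll _ _).1 hn
    obtain ⟨a, ha, rfl⟩ := List.mem_map.1 hm
    obtain ⟨_, hm, hn⟩ := (testBit_lorAll _ _).1 hn
    obtain ⟨a', ha', rfl⟩ := List.mem_map.1 hm
    obtain ⟨_, hm, hn⟩ := (testBit_lorAll _ _).1 hn
    obtain ⟨a'', ha'', rfl⟩ := List.mem_map.1 hm
    split_ifs at hn with hlt
    · simp only [Nat.testBit_and, Bool.and_eq_true] at hn
      rw [testBit_slab (by norm_num) (hfs ha).2, testBit_slab (by norm_num) (hfs ha').2,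
        testBit_slab (by norm_num) (hfs ha'').2] at hn
      obtain ⟨⟨hz, rfl⟩, ⟨-, rfl⟩, -, rfl⟩ := hn
      refine ⟨hz, .inr (.inr ⟨fun i => ?_, hlt⟩)⟩
      fin_cases i
      exacts [(hfs ha).1, (hfs ha').1, (hfs ha'').1]
    · simp at hn

theorem Ctx.excluded_sound (h : Ctx V W b e u v) {t q z : ℕ} {p : Fin 3 → ℤ}
    (hr : Reach V t p (pt z)) (hq : pt q ∈ V) (hn : (excluded W b e t q).testBit z = true) :
    Reach V (b - 1) p (pt q) := by
  have hz := hr.mem_right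
  obtain ⟨-, hn⟩ := testBit_excluded hn
  simp only [dist_eq] at hn
  rcases hn with ⟨i, hi, a, ha, hlt⟩ | ⟨i, j, k, hijk, hij, hzi, hzj, hlt⟩ | ⟨hzi, hlt⟩
  · refine (hr.trans (h.reach_via_facet ⟨i, hi⟩ (a := a) ?_ hz hq)).mono ?_
    · exact_mod_cast ha
    · simp only [pt]; omega
  · refine (hr.trans (h.reach_via_edge hijk hij hz hq ?_ ?_)).mono ?_
    · simp only [pt]; exact_mod_cast hzi
    · simp only [pt]; exact_mod_cast hzj
    · simp only [pt]; omega
  · refine (hr.trans (h.reach_via_vertex hz hq fun i => ?_)).mono ?_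
    · simp only [pt]; exact_mod_cast hzi i
    · simp only [pt, Fin.sum_univ_three]
      change _ + (((dig q 0 : ℤ) - dig z 0).natAbs + ((dig q 1 : ℤ) - dig z 1).natAbs +
        ((dig q 2 : ℤ) - dig z 2).natAbs) ≤ _
      omega

theorem testBit_outside {z : ℕ} (hn : (outside W).testBit z = true) :
    z < 64 ∧ ∃ i < 3, dig W i < dig z i := by
  obtain ⟨_, hm, hn⟩ := (testBit_lorAll _ _).1 hn
  obtain ⟨i, hi, rfl⟩ := List.mem_map.1 hm
  obtain ⟨_, hm, hn⟩ := (testBit_lorAll _ _).1 hn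
  obtain ⟨a, ha, rfl⟩ := List.mem_map.1 hm
  rw [List.mem_range] at hi ha
  split_ifs at hn with hlt
  · obtain ⟨hz, rfl⟩ := (testBit_slab hi ha).1 hn
    exact ⟨hz, i, hi, hlt⟩
  · simp at hn

theorem Ctx.holds_start (h : Ctx V W b e u v) (hu : u < 64) (hv : v < 64) :
    Holds V u v (start W b e u v) := by
  refine Holds.add (Holds.add ⟨h, fun n hn hN => ?_, by simp⟩ (by omega) ?_) (by omega) ?_
  · rw [testBit_andNot, Nat.testBit_two_pow_sub_one, decide_eq_true hn, Bool.true_and,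
      Bool.not_eq_true', Bool.eq_false_iff]
    intro hcon
    obtain ⟨_, hm, hcon⟩ := (testBit_lorAll _ _).1 hcon
    obtain ⟨t, ht, rfl⟩ := List.mem_map.1 hm
    rw [List.mem_range] at ht
    simp only [Nat.testBit_or, Nat.testBit_shiftLeft, Bool.or_eq_true, Bool.and_eq_true,
      decide_eq_true_eq] at hcon
    obtain ⟨hnV, hr⟩ := hN
    -- a point outside the box does not belong to `V`
    have hout : ∀ z, pt z = pt n → (outside W).testBit z = true → False := by
      intro z hz hb
      obtain ⟨-, i, hi, hlt⟩ := testBit_outside hb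
      have := (h.box _ hnV ⟨i, hi⟩).2
      rw [← hz] at this
      simp only [pt] at this
      omega
    rcases hcon with ⟨hle, hb⟩ | ⟨hle, hb⟩
    · have hlt : n - 64 * t < 64 := by
        rcases hb with hb | hb
        · exact (testBit_excluded hb).1
        · exact (testBit_outside hb).1
      have hmod : n % 64 = n - 64 * t := by omega
      rw [← hmod] at hb
      rcases hb with hb | hb
      · rw [if_pos (by omega), show n / 64 % 4 = t by omega, ← pt_mod n] at hr
        exact h.far (h.excluded_sound hr h.right hb)
      · exact hout _ (pt_mod n) hb
    · have hlt : n - (256 + 64 * t) < 64 := by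
        rcases hb with hb | hb
        · exact (testBit_excluded hb).1
        · exact (testBit_outside hb).1
      have hmod : n % 64 = n - (256 + 64 * t) := by omega
      rw [← hmod] at hb
      rcases hb with hb | hb
      · rw [if_neg (by omega), show n / 64 % 4 = t by omega, ← pt_mod n] at hr
        exact h.far (h.excluded_sound hr h.left hb).symm
      · exact hout _ (pt_mod n) hb
  · rw [Fact, show u / 64 % 4 = 0 by omega, if_pos (by omega)]
    exact ⟨h.left, .refl h.left⟩
  · have : pt (256 + v) = pt v := by
      rw [← pt_mod (256 + v), show (256 + v) % 64 = v by omega]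
    rw [Fact, if_neg (by omega), this]
    exact ⟨h.right, .refl h.right⟩

/-- A successful run on a stack containing the initial state refutes the situation. -/
theorem Ctx.false_of_run (h : Ctx V W b e u v) (hu : u < 64) (hv : v < 64) {n N : ℕ}
    {st : List State} (hrun : run n N st = true) (hmem : start W b e u v ∈ st) : False :=
  run_sound hrun _ hmem (h.holds_start hu hv)

theorem Ctx.admissible (h : Ctx V W b e u v) (he : e = 4) : admissible W b u v = true := by
  subst he
  simp only [Search.admissible, List.all_eq_true, List.mem_range, Bool.and_eq_true, Nat.ble_eq]
  intro i hi
  have h1 := h.box _ h.left ⟨i, hi⟩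
  have h2 := h.box _ h.right ⟨i, hi⟩
  have h3 := h.reach_via_facet ⟨i, hi⟩ (.inl rfl) h.left h.right
  have h4 := h.reach_via_facet ⟨i, hi⟩ (.inr rfl) h.left h.right
  simp only [pt] at h1 h2 h3 h4
  have h5 : ¬_ := fun hle => h.far (h3.mono hle)
  have h6 : ¬_ := fun hle => h.far (h4.mono hle)
  omega

theorem Ctx.mem_pairs (h : Ctx V W (bound W u v) 4 u v) (hu : u < 64) (hv : v < 64)
    (hlow : ∀ i : Fin 3, 2 * dig u i ≤ dig W i) (h01 : key W u v 0 ≤ key W u v 1)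
    (h12 : key W u v 1 ≤ key W u v 2) (huv : ¬(u = 21 ∧ v = 42 ∧ W = 63)) :
    start W (bound W u v) 4 u v ∈ pairs W := by
  refine List.mem_flatMap.2 ⟨u, List.mem_filter.2 ⟨List.mem_range.2 hu, ?_⟩,
    List.mem_map.2 ⟨v, List.mem_filter.2 ⟨List.mem_range.2 hv, ?_⟩, rfl⟩⟩
  · simp only [low, Bool.and_eq_true, Nat.ble_eq]
    exact ⟨⟨hlow 0, hlow 1⟩, hlow 2⟩
  · simp only [Bool.and_eq_true, Nat.ble_eq, h.admissible rfl, Bool.or_eq_true, bne_iff_ne]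
    exact ⟨⟨⟨h01, h12⟩, trivial⟩, by tauto⟩

end Search

/-! ### The search: a successful run -/

namespace Search

/-- The moves of the search, 28 bits each, packed in blocks of 14. -/
def moves : ℕ :=
  List.foldr (fun block rest => block + rest <<< 392) 0 [
    0xe100000e200000c003000d003000d0030010c0300110ff001140300140030015003001500300150020000000050000005,
    0x20c20002141040150004090800e0c104000d004000d13f000d13f000c104000d13f000d200000d004000d13f00050010a,
    0x50400a050010e0d13f000e00108020c2000214104050010e120c300210c30011400000d00300050010e0d13f001140500,
    0x140000120c200014000800c0008010c1080d13f0000000050160104050010e1117f00020c10c0160000090400a0214104,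
    0x10c1080150400050011601403000140300014020c0114000010c10800c0008014030000c0500014010401503000500112,
    0x1504000150400020c300014000c010c10800c00080d13f00010c1080e20000010c108010c108010c108010c108010c108,
    0x90011a0d00104014040001403100d004040d20008010c10800c0008014010400c03000140108015040005001160140000,
    0x10c10800d010400c030000d02080114400050011600140000114400011440000e0300001400c010c108000c008050011a,
    0x120c0000000005010c108010c108050011a090011a0c10104001440000143100c104040e10008010c108000c008010c108,
    0x1140300060400a090400a050401220c010c21403002140200050400a21403002140200114020020c010c15003002140000,
    0x114011011401040500112140000000c0200010c20001402000140108120c30000c000c05004060c0000c1400008050010a,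
    0x50021e1500104050011a10c0108114020015002100e000001140300050011a090011a0d001041140200090400a060400a,
    0x140300014020c010c10800c000811403001140300050400a050011611402001140200150010c090801a060801a050400e,
    0xc000080e20000010c108010c10810c0300114030010c03001140300140030015003001140200015040005001160140300,
    0xc202000114300050011a00140000014010000c0100d13f040d13f040d13f08050010a0e20000050020616200040d13f04,
    0x2140000140200120c3001513f140e002000150300050011a0140000014001000c00100d13f0400d02001117f001513f14,
    0x1117f001513f140c202000114300050011a00140000014010000c0100d13f040e100040d13f040d13f080d13f040c00008,
    0x50010a0d13f00016000000e020000e0104050400e0160200015030001142080d20000016010c00c00100d13f0400d0200,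
    0x114020020c010c060400a090400a2140200140000c150030021400000000005050010a0d13f000d13f00010c10c010c10c,
    0x1117f04210c1041400300050400a2140200114020020c010c1500300050010e210c10420c01041400008050400a2140200,
    0x1513f001513f00210c2001513f001513f00210c104210c20020d020020d0200210c2001513f001117f0421402001513f00,
    0xc2000010d3f0410d3f0410d3f0410d3f0410d3f0410d3f0410d3f0410d3f0410d3f04210c20020d020020d0200210c200,
    0x50400a060011205040120c10110000c2000c00200090010e050010e0c1010c000c1040c100040d13f0c0d13f0c000c10c,
    0x10c200020c104020c1040150104050050610d3f10020c1040160004010c10c0014104000c00010d3f0410d3f0400c0200,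
    0x10d3f0010d3f0410d3f0410d3f0410d3f0410d3f04010c10c010c10c010c2000600112050401200d0108050400a050010e,
    0x5003060c00008050040a142000c090800e060800e05040121400400050010e100c10c101420014103040c20004100c108,
    0x1430c200c10c100c114050031614000080c101081014300090800e060800e06040120904012101420805002120c20004,
    0x15200300d2092c0140300015030001503000e003000e10300060012a02142000500c2e0500c26116002c0d0002c200c208,
    0x50401a20e070020d030015008300500c1e00c0300050400e015030001403000d13f000500136015030001600000500d06,
    0x160000c0600136090103e11600000e102000d20c3801400080500e2e220c10821600000500d2a15200300900d060900e0a,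
    0x50c01a050c02205040220600212220c120120c600220c11c162000c021410c0150300090111200e00000d20000060040a,
    0x504012050801e051001e0510026060403a050402621501201214120220c1201610800120c600220c11c1153f0c050134a,
    0x50012a050800e2214124050400a220c200215011815000180500112021410c060402e050401a21501142114600220c014,
    0x160000090100e050401e0500236215011c21147002114700050403a211410421501182114700210c6180901422220c200,
    0x50011a12144000500122161010c0e2040012141180604032050401e21501182114700220c018021410c0e103000214200,
    0x51804a05015521117f00050402206040360504022215011c1620104121411c220c11c162000c021410c0150300120c300,
    0x500f2a01502000500f0a010c300120c600121420012142001214200121411c120c600220c11c1153f0c050134a050401a,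
    0x90403215003000604032110ff48215040820c0108210c200050010e06001262150200215010416000040900f320e00004,
    0x162030009015220600216060023a0500156060024e0160000060014a0d2114c110ff00091c04a05040520604036050c032,
    0x9180220904036110ff000600112050141e0501552050035a050045e05002160e10128050402a060073a120c8000901552,
    0x50800e2214110050400a220c20021501041500004060401e050400a21501042114200220c0040901116090121a060032a,
    0x2160030050400a05002222150108211420021142000504026211410421501042114200210c1040900f0e220c2000500116,
    0x50400a21501042114200220c00415002001513f300500d32120c300050010a220c300220c200220c108060011e2150000,
    0x60022a050023e11400040900f0e20c0000050013a150000020c04000900f0e2114200220c20021501042150104210c104,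
    0x220c110152014011600000e102000500f3a0900f3a0500f32220c10811600380901036060032e050034216000000900f32,
    0x51c036090403615007000604036110ff4c220c314090130a00e00000160008050034a060033e09012460e20004050113a,
    0x50400e110ff4c052003a090403a110ff00060801e091001a0e10700110ff0005140320504056060403a1140700061001a,
    0x644052050404606080420500156052003a0608036110ff001140700061001a051c036052003a0608036210c2000604032,
    0x60801e091001a0e10700110ff000514032060403e00c0800010c800094804e090804205017520524052110ff00091401e,
    0x94804e050405a050014a091401e06440520501752060015a110ff000608042120c800052003a0608036110ff00110ff00,
    0x5140320600142050015a220c51c1117f001610500061001a1117f500e1050002144080901206090403e05001560500152,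
    0x61001a1117f5001505000908012090403e1117f00060403e1117f00052003a1117f0005080560504052091001a0904032,
    0x60403e05080421117f0006040320504052091001a1117f00090403205140320600142050015a220c51c1117f001610500,
    0x60c036110ff4c220c10405013422160008220c11021504000501036152003c0600136090103e010c500090403e050803a,
    0x21401811407000e10700110ff000514032050c056060c03a1140700050401e120c800120c200051c036090c0360608032,
    0x2214000050113a2140500090803e090c03a110ff000140800015080006001220e008000e1080002147140500156060013a,
    0x1117f58015070405015521620114050c01e2214218090141200e0000016000c0504016220c500050123e050010a060012e,
    0x1117f00120ca00050016205001321153f1c060403e050012616103001117f000514052090403e090c026051005a1117f00,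
    0x1117f000514052051c03a090c026051005a1117f001117f58051004a06080460114200050c046050402e06040420528042,
    0x1117f001117f540e10600021450c090130e0904046050c0460604046011440005280421117f00060403a050405a0504012,
    0x50805a0504056050400e051004e051803609480560504056051005a0e20400052403e051403e05140262160300050c056,
    0x51403e05140261620200050c0561117f001117f540150600120c60009040421117f0006040421117f00052403e1117f00,
    0x6040360504056050400e1117f00051004e0518036050805a05080120520052050175a1117f00051005a050175a162011c,
    0x51002a05040122140500210c400220c10c220c10c1513f3c210c500010c6000904042050803e060404205080461117f00,
    0x2140500210c400220c10c216003c0501006152003c0d20c380150200050c026051002a210c5002140500210c4001500300,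
    0x500e2e220c10415200340500f2a0140008050c026210c500220c11021504001500300220c10c1513f3c051002a0504012,
    0x21420001501200d20008220c108014080005040220604036015011c0e10004220c20c060010a0e200000d20d3c2160000,
    0x50023e0150124010c90001409000504042010c10401501200d13f080901316050400a050800e050011a020c1140214200,
    0xe1010c050144606002120e1011005040120504016050c01612144000e00018050400e220c108050010e00c09000504026,
    0x50014600e00340e1010c12144000e10110050402e060404201501280510016051001a120c1100e10400050800e120c118,
    0x1117f00161070016107001117f5401501040114200015011c090131600e00000d20104050024a060023e09012460e20008,
    0x5100420608042060403e052403e1117f0006080360508056050010e050401e16107001117f000908036090403a0910022,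
    0x50400e052804209040421500b000604042110ff58220c720020c1080214200060013e0500126015000401142000908042,
    0x210c200060403e0504026110ff58052c046051005a050c062061802a1140b00110ff00051c03e050406206040461140b00,
    0x1140b00110ff00051c03e060404a050012a05001621214a00120c22c1140b0005001260e103000528042052c0460608042,
    0x6040320150118060013a0160000090110e0901212050400e050801205017520e00124090404a051005a050c062061802a,
    0x15011c060403a0500236015011c010c700010c700050403a060013a010c1040150104015011801407000d13f00050401e,
    0x1620004220c20c0d20d3c21502000500f3200c07000504032090110e00d0600050100a00c0700050401e0500236060013a,
    0x1140700120c200110ff00061001e050c04e060c0321140600050400a051402e090c02e060402a060c02e110ff440901246,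
    0x50024a060023e09012461214008220c20c0908042090c032110ff00060804211406000140900050010e050154a051c04a,
    0x140a000600112050164e0e00120050164e052004e1140800120c30005180320910032060802e0610032110ff480d20004,
    0x60401a1140700050400e0214200021430001502200140a0006001160e10000110ff00050c02e051005206100361140700,
    0x10c1040150104015012001409000d13f080504026060403a01501200160008220c1080901212090803a0910036110ff00,
    0xd0600050100a00c09000504026050023e060014201501240604042050023e0150124010c900010c90005040420600142,
    0x1214400120c11816101040508012220c4040d20d3c090103e050010a06001262214000214030000c07000504032090110e,
    0x50124616201040508012221420c16006000e1010c0e1010c050402a060403e05002120e10114015012405040121214200,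
    0x120c11c090141a00e0004051001a220c20c05040220604036015011c0e20004050024a060023e1160004050024a060023e,
    0x51c026052002a220c400110ff540114400015010c015032405001120e00000050c05205015521117f0005015521620110,
    0x15010801143000528042050405611403000610026120c300051c052051803a0910026051405a120c300052403e051c03e,
    0x608046060404205280421117f00060803a050805a05080161117f00051c052090403e0910026051405a1117f001117f58,
    0x10c90005040420600142010c1040150104015012001409000d13f08050c016220c108090121200e003809080460510046,
    0xc07000504032090110e00d0600050100a00c09000504026050023e060014201501240604042050023e0150124010c900,
    0x50401e0508022210c3002140300210c20015002000508022050400a2140300210c200220c104220c1041513f34210c300,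
    0x2114104060401a1513f340500e360900e36060801e050400a0500f32215020021502000500e2e216003421400000900e0a,
    0x16000040e102000500e360900e360500e2e220c200060400a220c2002150200220c108116003401400040600126090401a,
    0x9080320608032110ff48050123e1520344220c2002114200220c10c05002420600236090103e0e2000011600000901036,
    0xe108000214714050015206001360214018091001a0e10700110ff00050c042050805206080361140700061001a050c02e,
    0x15007000608032110ff48050123e1520344220c200060400e051c0360908036110ff00014080001508000150800091401e,
    0xe108000214714050015206001360214018091001a0e10700110ff00051402e0508052050c04e061001a20c0a000908032,
    0x2114200210c1100501036152003c0e2000006001320900f3a051c0360908036110ff00014080001508000150800091401e,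
    0x2150108050022e06040320501342215010821142002114200050403206001322114104050123e220c10421501042114200,
    0x50012a21406000501342051803a1500500210c700120c50016005001600400216003c050400a050022e05013420600132,
    0x90130600e003c050123e1520044021410c0e10300021420020c070021142002150104210c11015004001513f3c050103e,
    0x12141040501446220c10416200140e20500050403a060013a21141040501446220c104215010421142002114200220c018,
    0x210c1040600132210c118120c700160070016002002160044050400a21142002114200210c1181610110050144e050011a,
    0xe00340150300120c30020c090021142002150104210c11815006001513f4405012460500132210c10405040320504032,
    0x50403a060013a2114104220c104215010421142002114200210c11805013422160000050123e1520044021410c0500206,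
    0x210c900120c700160070016002002160044050400a0500236060013a21501080500236060403a215010821142002114200,
    0x150200010c30020c090021142002150104210c11815006001513f44050124605001322140800050154a05200421500700,
    0x508026210c200220c104216003c1117f001117f00210c508050013e00e002c0500f0615200380d20b340900f321600000,
    0x11400000500e26211410405001221513f3c0500226210c20005002262140200216003c1117f00050402221141041513f3c,
    0x50801e210c2000500e2e220c104220c1041513f34050401e20e07000500e36090401e060401e20e0700210c3000900e2e,
    0x150124050400a050164e052404611409000504016120c1040e0001806001120e200000d20f44220c104220c1082150200,
    0xe2000c0e1010412142000e00200120c200120c200120c1041214200120c1180e1010405014460e00104050402a060403e,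
    0x90401a052403a091803e061803e110ff54015010401142000150120090141a00e00000d20000050014e0600142090134a,
    0x50012a0150004011420005280420918042060803a050805a1140b00060401a090803a052404e051805e06180421140b00,
    0xe002001140b00110ff00052404e051805e06180421140b00050401a052403a091803e061803e110ff5402142000600142,
    0x50400a05280420508056050405e050c04a050c0120508062050195a0e0012c051c062050195a05300521140c00050801e,
    0x10c900010c90005040420600142010c1040150104015012001409000d13f000504026060403a015012001600000901316,
    0x220c10800c0900050403a090131600d0800050121200c09000504026050023e060014201501240604042050023e0150124,
    0x110ff3c050021e06040220500f321513f38215000020e0700050401a050801e210c2000504026060012621141080500f32,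
    0x6040160508046060802a11405000140900050030a120c108050052a061002e220c1141610300090802605003220608026,
    0xe2000406002420d20f442150304114050001408001600200120c104050400e0500426060c02a2114300220c310110ff00,
    0x64004e050164e0600156110ff0005180560500732110ff0c1214300050062e0614032220c218050014e0600346090134a,
    0x60c02a050113a00c0900050403a090131200d0800050120e00c0a00010ca000500452094404a051004a050040a1600200,
    0x5010360600226050020e2150200050021e0500f320600122050010a1513f380904022051002a090802a110ff000500426,
    0x2142000500c2e0500c26116002c0500c260900c26014002c0500d06050010a1513f382114700050011a05040220500322,
    0x1500040d2092c1117f0001144040500136015030001600000d2092c0608022015030001503000e103000e10300060012a,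
    0x60042a050033e0150104011410801501080500136060012a0160000050010e02142001214200021410406002220e10104,
    0x50011201501040114108060032601141040e20108050033e06003320900f3a12140000900f32020c0080504026050400e,
    0x20c1080d13f0006002220900e2e01400040508022050012201141080504022011410806002220d13f00050012a0114200,
    0x220c30021503002150300220c2000e0003015200280508022050c026010c3000500136050c026010c3000500132020c108,
    0x21504002114400220c400210c300050013e220c400214000015009341117f001117f00010c330060012616103001610300,
    0x21420001501080d13f000140300050400e01501080e100000d20a301117f001117f001117f00010c3300500b220504012,
    0x900e0e010c3000901016011420001501040150108050023e01600000140300050013a0d13f00010c3000900e0e0150108,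
    0x214200060012201500000e1010401500040500c2e0900c2e116002c1117f001117f001117f00010c22c0500d0a010c300,
    0xe10104050401e16101181214700120c2000e102001513f440e000440500116020c00c09011421620010020c30c0d20108,
    0x61403e0e10300050014e120c2001117f001513f441513f44120c144060013a0e103000e10300050014e06003420508022,
    0x150104015010801403000e200000500136060012a0900d321160000050010e0d13f040114404020c10c0114300050404a,
    0x10c3000500136010c30001403000d13f000d2092c010c300050400e0150104011410801501080d13f0006001260214200,
    0x141011405002121410104100c10406001121400008101440010141040c101040910016050801a060c01a090c01a1400400,
    0x50400a060801a0150200020c2000d003340900c160e100000d200280500726000c11c0c10114051001e050041a101410c,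
    0x50012a050400e2150200220c20020c082c0500142050013620c09000500f1215000381520130162000001403000500112,
    0x10c2000900f32020c200050010e050021202141080900f32050010e020c200020c1040d002300900c2e090401a060401a,
    0x220c004211480020d07000900f1221400000900f0a20c0000050021201400041140034010c2000500b36050801a050400a,
    0x20c10c12144000e10300221420c05002060500332220c20016101101214500050012a21149002214004090012a2114900,
    0x1513f3421407340500e060900e061500034050010e0500e2e0500e0e0900f320140400050041a020c104015010c0504012,
    0x20c104015010c0504012020c10c1214400060012a1214400060022e0504012161010c050013e120c3001513f341513f34,
    0x1501080150200050010e090010e01400000d002300900c1601600000500132050012e0900c1600e03000500b120d00400,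
    0xd0023000e022400d0200010c3000500c3a050400e010c200050400e010c1080140300050010a015000801143000150108,
    0x50403601405000e102000500d320900d320160130015000006001120160000050010e050400a06080160150200020c200,
    0xd00230050011209001120160000050092e050400a05001120150200050010a0d00334010c20005080160d004380d00438,
    0x1602300500a32050401601501080114200060010e050403a0e102000500e360900e360160134020c000050400a0150104,
    0x500b36050800e050023e015010c050013a01143040500b36050800e015010c011430401403000e100000500d320900d32,
    0x1410104200c0000c10004100c108100c108100c108100c200050010e1014400050400a0500212050800e05003160500622,
    0x100c108100c200050800e100c1041014400050400a10141040c00300090011205001120c10108090400a060400a100c208,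
    0x10c108100c108110ff00110ff001140300100c108110ff00110ff001140300150030015003001500300110ff00100c108,
    0x90010e050010e0e1010c020c0040e20004220c008210c4081153f0c1153f0c1153f0c220c20015000081520000010c108,
    0x20d010c20140001117f002014000200c0000500112210c200020c208010c11c010c11c11402000e1010c0e1010c0e1010c,
    0x10d3f04116000420e0000210c200210c200210c200210c108201410420c03002014108050010a20c04000900206210c10c,
    0x100c110100c11020c0200090011a050011a20d0104200c210210c4000c1000420d000c100c110100c110100c1100900306,
    0x120c2000504012120c2001153f00120c10c120c2001153f00120c2001153f00120c2001153f00120c10c1153f040500206,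
    0x50400e210c2001513f00210c108210c20020d0200210c2001513f00210c2001513f00210c1081513f00120c2000d13f04,
    0x200c008100c10810d3f0020e000014101041410104141010414101041410104141010410d3f04210c2001410104210c200,
    0xc1000420d0008100c108100c108100c108200c20015002001014400200c104100c30020d011020d01100500112200c000,
    0x210c2001513f001513f001117f041153f041153f04210c104100c108100c10820c0200100c3000500112200c200200c108,
    0x120c4000500112220c300220c20821500081153f041500004210c20020d020020d0200210c2001513f001513f001117f04,
    0x210c10c210c104050010e20e00001500300220c20016102001610200220c10821500080500306216000820e00041500300,
    0x20d0104050400e06080160908016211410820d020c2140000210c200060400a090400a1500200090011605001162150104,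
    0x210c200200c000050010e210c20015002000500112050400a210c3002140300210c20020d010815002000500116050021a,
    0x1153f041153f04210c10420c02001400300050400a200c20014003000504012201410c090400a060400a200c20020d0108,
    0x110ff04110ff04110ff04110ff04110ff04000000100000010000001210c20020d0200210c2001513f00210c2001513f00,
    0x110ff08110ff08110ff08110ff00110ff08110ff08110ff08110ff08110ff00110ff04110ff04110ff04110ff04110ff04,
    0x20d020020d0200210c2001513f001513f001117f04210c2001513f001513f001117f041153f041153f041513f04110ff08,
    0x20d0200210c2001513f001513f00210c2001513f001513f00210c10400000050000005000000100000010000001210c200,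
    0xc100000c200001420004050020620e00042160000000000514101041410104141010410d3f040000005210c20020d0200,
    0xc00500050400a10142001014200100c1100c100000014400060400a090400a1014200050400a10142000014200100c110,
    0x1160000100c10c0d004000c0050005002060d13f040c1040015004000c00500050010e10d3f001410304100c10c100c10c,
    0x2142000114200020c10c060400a090400a05001160e1010c0e1010c0504012020c10c12144000214200014000c0d13f00,
    0x20c10c120c2000e001100e1010c0e1010c050010e020c000020c0040d13f000e20000050400a0e1010c05001161214400,
    0x1100c108100c108100c1080d003000d13f000d13f000d003000d13f000d003000d13f00050010a0d13f001153f00,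
    0x1513f001513f00210c2001513f00050400e1513f081117f0015001041500104110ff0415001041500104110ff040000001,
    0x20d0200210c2001513f001513f00210c200050401605080161513f1015004082160000210c20020d020020d0200210c200,
    0x1513f001513f001513f0c1153f040c101100d001100d13f000d001100d13f000d13f000500306050030a210c20020d0200,
    0x210c2001513f001513f00210c20005040121513f001513f0c210c20020d020020d0200210c2001513f001513f00210c200,
    0x210c2001513f000508012210c2001513f0005040121513f0c1153f040d13f000d13f000d13f00210c20020d020020d0200,
    0x500206210c20020d020020d0200210c2001513f000508012210c2001513f001513f001513f0c210c20020d020020d0200,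
    0x210c108210c1081500300114020000000050000001000000100000010d13f000d13f000d13f000d13f000d13f000d13f00,
    0xc00c0d13f040d13f040d13f04120c2000d13f040d13f040d13f04010c108010c1080d0030010c0300110ff001140300,
    0x1117f0000d020000c040000d03040114300050011600140001117f00001400c210c11016200081513f0c140000c0e20008,
    0xc04000140104015030005001160140000120c200014000c210c11016200081513f0c140000c0e2000800c000c0d13f04,
    0xd13f040d13f040d13f040d13f040d13f0410d3f0410d3f0410d3f0410d3f0410d3f0410d3f0410d3f040d13f040140200,
    0x5080162114104210c10c211440020d030020e0008220c000210c210010c20c210c10c210c10c05002061513f040d13f00,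
    0xc2000400d0004010c108010c108010c108210c10c210c10c20d010c20d010c20d010c050060a0504012210c300050020e,
    0x145000014200000c11010d3f041140300010c400020c10c050010a120c10c020c3001153f0c014000406004060e2000c,
    0xd13f040d13f040d13f040d13f04010c108010c1080c001040014400000c1100600116050401600d010c050400a000c104,
    0x1120c2000d13f040d13f04120c2001153f001153f00120c2001513f041513f04120c1040d13f040d13f040d13f04,
    0xd13f080d13f080d13f00110ff08110ff08110ff000d13f040d13f040d13f040d13f040d13f04110ff04110ff04110ff04,
    0x110ff040d13f040d13f040d13f040d13f0400000050000001000000100000010000001000000100000010d13f080d13f08,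
    0x110ff04000000110d3f0410d3f0410d3f0410d3f0410d3f0410d3f0410d3f0400000010d13f040d13f040d13f041140104,
    0x110d3f0410d3f040000001000000110d3f0810d3f0810d3f000500206]

set_option maxRecDepth 10000 in
theorem run_space :
    run 3000 moves (pairs 63 ++ (pairs 47 ++ (pairs 43 ++ pairs 42))) = true := by
  decide +kernel

/-- The run refutes every situation in which the coordinates are normalized by reflections and
permutations. -/
theorem Ctx.false_of_sorted {V : Finset (Fin 3 → ℤ)} {W u v : ℕ}
    (h : Ctx V W (bound W u v) 4 u v) (hu : u < 64) (hv : v < 64)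
    (hW : W = 63 ∨ W = 47 ∨ W = 43 ∨ W = 42) (hlow : ∀ i : Fin 3, 2 * dig u i ≤ dig W i)
    (h01 : key W u v 0 ≤ key W u v 1) (h12 : key W u v 1 ≤ key W u v 2)
    (huv : ¬(u = 21 ∧ v = 42 ∧ W = 63)) : False := by
  have hmem := h.mem_pairs hu hv hlow h01 h12 huv
  have hW' : pairs W = pairs 63 ∨ pairs W = pairs 47 ∨ pairs W = pairs 43 ∨ pairs W = pairs 42 :=
    hW.imp (congrArg _) (Or.imp (congrArg _) (Or.imp (congrArg _) (congrArg _)))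
  refine h.false_of_run hu hv run_space ?_
  rw [List.mem_append, List.mem_append, List.mem_append]
  rcases hW' with h' | h' | h' | h' <;> rw [h'] at hmem
  · exact .inl hmem
  · exact .inr (.inl hmem)
  · exact .inr (.inr (.inl hmem))
  · exact .inr (.inr (.inr hmem))

end Search

/-! ### The plane -/

open Search

/-- Reflections of the plane, followed by the embedding in the plane `x 2 = 0` of space. -/
theorem affineOn_embed (V : Finset (Fin 2 → ℤ)) {s : Fin 2 → ℤ} (hs : ∀ i, s i * s i = 1)
    (t : Fin 2 → ℤ) :
    AffineOn V fun x => (![s 0 * x 0 + t 0, s 1 * x 1 + t 1, 0] : Fin 3 → ℤ) := by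
  have hs' : ∀ i, (s i : ℝ) * s i = 1 := fun i => by exact_mod_cast hs i
  constructor
  · intro c
    refine ⟨![c 0 * s 0, c 1 * s 1], c 0 * t 0 + c 1 * t 1, fun x _ => ?_⟩
    simp [ev, Fin.sum_univ_three]
    ring
  · intro c
    refine ⟨![c 0 * s 0, c 1 * s 1, 0], c 0 * s 0 * t 0 + c 1 * s 1 * t 1, fun x _ => ?_⟩
    simp [ev, Fin.sum_univ_three]
    linear_combination c 0 * x 0 * hs' 0 + c 1 * x 1 * hs' 1

/-- Opposite points of the square of side three, both corners or both inner points. The square is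
embedded in space, with `100` for the diameter of facets, as one of them is the whole square. -/
theorem run_plane : run 20 0x50010e0c10104050010e0d001040e20104050010a0e00108060800e020c200050010e0e00000090400a0114200020c2000150200060400a020c104
    [start 15 4 100 0 15, start 15 4 100 5 10] = true := by decide +kernel

/-- At distance four in the plane, the two points are opposite in the octagon with vertices
`(0, 1), (0, 2), (1, 3), (2, 3), (3, 2), (3, 1), (2, 0), (1, 0)`. -/
theorem plane_far {V : Finset (Fin 2 → ℤ)} (hV : ConvPos V) (hB : Boxed V) {u v : Fin 2 → ℤ}
    (hu : u ∈ V) (hv : v ∈ V) (hfar : ¬Reach V 3 u v) :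
    (∀ i, u i + v i = 3 ∧ Extreme V i 0 ∧ Extreme V i 3) ∧
      ((u 0 = 0 ∨ u 0 = 3) ↔ ¬(u 1 = 0 ∨ u 1 = 3)) := by
  have hopp := opposite_of_far hV hB diamLE_one hu hv hfar
  refine ⟨hopp, ?_⟩
  by_contra hcon
  have hu' := hB u hu
  set s : Fin 2 → ℤ := fun i => if u i ≤ 1 then 1 else -1 with hs
  set t : Fin 2 → ℤ := fun i => if u i ≤ 1 then 0 else 3 with ht
  have hst : ∀ i, (s i = 1 ∧ t i = 0 ∧ u i ≤ 1) ∨ (s i = -1 ∧ t i = 3 ∧ 2 ≤ u i) := fun i => by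
    simp only [hs, ht]
    split_ifs with h
    · exact .inl ⟨rfl, rfl, h⟩
    · exact .inr ⟨rfl, rfl, by omega⟩
  have hA := affineOn_embed V (s := s) (fun i => by rcases hst i with h | h <;> simp [h.1]) t
  set f : (Fin 2 → ℤ) → Fin 3 → ℤ := fun x => ![s 0 * x 0 + t 0, s 1 * x 1 + t 1, 0] with hf
  have hf0 : ∀ x, f x 0 = s 0 * x 0 + t 0 := fun _ => rfl
  have hf1 : ∀ x, f x 1 = s 1 * x 1 + t 1 := fun _ => rfl
  have hf2 : ∀ x, f x 2 = 0 := fun _ => rfl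
  have hs0 := hst 0
  have hs1 := hst 1
  obtain ⟨hu0, ⟨⟨p0, hp0, hp0'⟩, -⟩, ⟨⟨q0, hq0, hq0'⟩, -⟩⟩ := hopp 0
  obtain ⟨hu1, ⟨⟨p1, hp1, hp1'⟩, -⟩, ⟨⟨q1, hq1, hq1'⟩, -⟩⟩ := hopp 1
  have hV' := hA.convPos hV
  have hbox : ∀ x ∈ V.image f, (0 ≤ x 0 ∧ x 0 ≤ 3) ∧ (0 ≤ x 1 ∧ x 1 ≤ 3) ∧ x 2 = 0 := by
    intro x' hx'
    obtain ⟨x, hx, rfl⟩ := Finset.mem_image.1 hx'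
    have h0 := hB x hx 0
    have h1 := hB x hx 1
    rw [hf0, hf1, hf2]
    rcases hs0 with ⟨a, b, -⟩ | ⟨a, b, -⟩ <;> rcases hs1 with ⟨c, d, -⟩ | ⟨c, d, -⟩ <;>
      rw [a, b, c, d] <;> omega
  have hfour : ∀ x ∈ V.image f, ∀ y ∈ V.image f, Reach (V.image f) 4 x y := by
    intro x hx y hy
    have hA' : AffineOn (V.image f) (fun x i => x (Fin.castSucc i) : _ → Fin 2 → ℤ) :=
      affineOn_comp (y := 0) (Fin.castSucc_injective 2) fun x hx i hi => by
        obtain rfl : i = 2 := by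
          fin_cases i
          · exact absurd ⟨0, rfl⟩ hi
          · exact absurd ⟨1, rfl⟩ hi
          · rfl
        exact (hbox x hx).2.2
    refine hA'.reach hV' hx hy (diamLE_two _ (hA'.convPos hV') ?_ _
      (Finset.mem_image_of_mem _ hx) _ (Finset.mem_image_of_mem _ hy))
    intro z' hz' i
    obtain ⟨z, hz, rfl⟩ := Finset.mem_image.1 hz'
    have := hbox z hz
    fin_cases i
    · exact this.1
    · exact this.2.1
  have hctx : ∀ c d : ℕ, pt c = f u → pt d = f v → Ctx (V.image f) 15 4 100 c d := by
    intro c d hc hd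
    refine ⟨hV', fun x hx i => ?_, fun i => ?_, fun i => ?_, hc ▸ Finset.mem_image_of_mem f hu,
      hd ▸ Finset.mem_image_of_mem f hv, ?_, fun x hx y hy _ _ _ => ?_,
      fun x hx y hy _ _ _ m hm => .inl ((hfour x hx y hy).mono (by omega))⟩
    · have := hbox x hx
      fin_cases i <;> simp [dig] <;> omega
    · fin_cases i
      · rcases hs0 with ⟨a, b, -⟩ | ⟨a, b, -⟩
        · exact ⟨f p0, Finset.mem_image_of_mem f hp0, by simp [hf, a, b, hp0']⟩
        · exact ⟨f q0, Finset.mem_image_of_mem f hq0, by simp [hf, a, b, hq0']⟩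
      · rcases hs1 with ⟨a, b, -⟩ | ⟨a, b, -⟩
        · exact ⟨f p1, Finset.mem_image_of_mem f hp1, by simp [hf, a, b, hp1']⟩
        · exact ⟨f q1, Finset.mem_image_of_mem f hq1, by simp [hf, a, b, hq1']⟩
      · exact ⟨f u, Finset.mem_image_of_mem f hu, rfl⟩
    · fin_cases i
      · rcases hs0 with ⟨a, b, -⟩ | ⟨a, b, -⟩
        · exact ⟨f q0, Finset.mem_image_of_mem f hq0, by simp [hf, a, b, hq0', dig]⟩
        · exact ⟨f p0, Finset.mem_image_of_mem f hp0, by simp [hf, a, b, hp0', dig]⟩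
      · rcases hs1 with ⟨a, b, -⟩ | ⟨a, b, -⟩
        · exact ⟨f q1, Finset.mem_image_of_mem f hq1, by simp [hf, a, b, hq1', dig]⟩
        · exact ⟨f p1, Finset.mem_image_of_mem f hp1, by simp [hf, a, b, hp1', dig]⟩
      · exact ⟨f u, Finset.mem_image_of_mem f hu, by simp [hf, dig]⟩
    · rw [hc, hd]
      exact fun h => hfar (hA.reach hV hu hv h)
    · exact (hfour x hx y hy).mono (by norm_num)
  have hfu : (f u 0 = 0 ∧ f u 1 = 0) ∨ (f u 0 = 1 ∧ f u 1 = 1) := by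
    have h0 := hu' 0
    have h1 := hu' 1
    simp only [hf0, hf1]
    rcases hs0 with ⟨a, b, p⟩ | ⟨a, b, p⟩ <;> rcases hs1 with ⟨c, d, q⟩ | ⟨c, d, q⟩ <;>
      rw [a, b, c, d] <;> clear_value s t f <;> omega
  have hfv : f u 0 + f v 0 = 3 ∧ f u 1 + f v 1 = 3 := by
    simp only [hf0, hf1]
    rcases hs0 with ⟨a, b, -⟩ | ⟨a, b, -⟩ <;> rcases hs1 with ⟨c, d, -⟩ | ⟨c, d, -⟩ <;>
      rw [a, b, c, d] <;> omega
  have hpt : ∀ (c : ℕ) (x : Fin 2 → ℤ), (dig c 0 : ℤ) = f x 0 → (dig c 1 : ℤ) = f x 1 →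
      dig c 2 = 0 → pt c = f x := by
    intro c x h0 h1 h2
    funext i
    fin_cases i
    · exact h0
    · exact h1
    · simp [pt, h2, hf]
  rcases hfu with ⟨h0, h1⟩ | ⟨h0, h1⟩
  · exact (hctx 0 15 (hpt 0 u (by simp [dig, h0]) (by simp [dig, h1]) (by simp [dig]))
      (hpt 15 v (by simp [dig]; omega) (by simp [dig]; omega) (by simp [dig]))).false_of_run
      (by norm_num) (by norm_num) run_plane (by simp)
  · exact (hctx 5 10 (hpt 5 u (by simp [dig, h0]) (by simp [dig, h1]) (by simp [dig]))
      (hpt 10 v (by simp [dig]; omega) (by simp [dig]; omega) (by simp [dig]))).false_of_run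
      (by norm_num) (by norm_num) run_plane (by simp)

/-! ### Space -/

/-- If two vertices of a polygon are not within distance two, their neighbours on either side of
the line through them are distinct. -/
theorem six_le_card {V : Finset (Fin 2 → ℤ)} (hV : ConvPos V) {u v : Fin 2 → ℤ} (hu : u ∈ V)
    (hv : v ∈ V) (hfar : ¬Reach V 2 u v) : 6 ≤ V.card := by
  have huv : u ≠ v := fun h => hfar (h ▸ .refl hu)
  set n : Fin 2 → ℤ := ![-(v 1 - u 1), v 0 - u 0] with hn
  set g : (Fin 2 → ℤ) → ℤ := fun x => ∑ i, n i * x i with hg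
  have hg' : ∀ x, g x = -(v 1 - u 1) * x 0 + (v 0 - u 0) * x 1 := fun x => by
    simp [hg, hn, Fin.sum_univ_two]
  have hguv : g v = g u := by rw [hg', hg']; ring
  -- on the line through `u` and `v` there are no other points
  have hline : ∀ x ∈ V, x ≠ u → x ≠ v → g x ≠ g u := by
    intro x hx hxu hxv hgx
    rw [hg', hg'] at hgx
    obtain ⟨k, hk⟩ : ∃ k, u k ≠ v k := Function.ne_iff.1 huv
    refine hV.not_collinear hu hv hx hk hxu.symm hxv.symm fun i => ?_
    fin_cases k <;> fin_cases i <;> simp only [Fin.zero_eta, Fin.mk_one, Fin.isValue] <;>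
      first | linear_combination hgx | linear_combination -hgx | ring1
  have side : ∀ s : ℤ, s = 1 ∨ s = -1 → ∃ a b, VAdj V u a ∧ VAdj V v b ∧
      s * g u < s * g a ∧ s * g u < s * g b := by
    intro s hs
    have hsum : ∀ x, ∑ i, (fun i => s * n i) i * x i = s * g x := fun x => by
      simp only [hg, Finset.mul_sum, mul_assoc]
    obtain ⟨x, hx, hxs⟩ : ∃ x ∈ V, s * g u < s * g x := by
      by_contra! hcon
      refine hfar (Reach.mono (n := 1) (.single ⟨hu, hv, huv, fun i => ((s * n i : ℤ) : ℝ), ?_,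
        fun x hx hxu hxv => ?_⟩) (by norm_num))
      · have : ∀ x, ev (fun i => ((s * n i : ℤ) : ℝ)) x = ((s * g x : ℤ) : ℝ) := fun x => by
          rw [← hsum]; simp [ev]
        rw [this, this, hguv]
      · have : ∀ x, ev (fun i => ((s * n i : ℤ) : ℝ)) x = ((s * g x : ℤ) : ℝ) := fun x => by
          rw [← hsum]; simp [ev]
        rw [this, this]
        refine Int.cast_lt.2 (lt_of_le_of_ne (hcon x hx) fun h => hline x hx hxu hxv ?_)
        rcases hs with rfl | rfl <;> omega
    obtain ⟨a, ha, hlt⟩ := exists_improving_int hV (fun i => s * n i) hu hx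
      (by rw [hsum, hsum]; exact hxs)
    obtain ⟨b, hb, hlt'⟩ := exists_improving_int hV (fun i => s * n i) hv hx
      (by rw [hsum, hsum, hguv]; exact hxs)
    rw [hsum, hsum] at hlt hlt'
    exact ⟨a, b, ha, hb, hlt, hguv ▸ hlt'⟩
  have hne : ∀ {a b}, VAdj V u a → VAdj V v b → a ≠ b := fun ha hb hab =>
    hfar ((Reach.single ha).trans (.single (hab ▸ hb.symm)))
  obtain ⟨a, b, ha, hb, hga, hgb⟩ := side 1 (.inl rfl)
  obtain ⟨a', b', ha', hb', hga', hgb'⟩ := side (-1) (.inr rfl)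
  have h1 := hne ha hb
  have h2 := hne ha' hb'
  have hnd : [u, v, a, b, a', b'].Nodup := by
    have : ∀ {x y}, g x ≠ g y → x ≠ y := fun h h' => h (by rw [h'])
    simp only [List.nodup_cons, List.mem_cons, List.not_mem_nil, or_false, not_or, not_false_eq_true,
      List.nodup_nil, and_true]
    refine ⟨⟨huv, ?_, ?_, ?_, ?_⟩, ⟨?_, ?_, ?_, ?_⟩, ⟨h1, ?_, ?_⟩, ⟨?_, ?_⟩, h2⟩ <;>
      exact this (by omega)
  calc 6 = [u, v, a, b, a', b'].toFinset.card := by rw [List.toFinset_card_of_nodup hnd]; rfl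
    _ ≤ V.card := Finset.card_le_card fun x hx => by
      simp only [List.mem_toFinset, List.mem_cons, List.not_mem_nil, or_false] at hx
      rcases hx with rfl | rfl | rfl | rfl | rfl | rfl
      exacts [hu, hv, ha.2.1, hb.2.1, ha'.2.1, hb'.2.1]

theorem card_line_le_two {V : Finset (Fin 2 → ℤ)} (hV : ConvPos V) (i : Fin 2) (m : ℤ) :
    (V.filter fun x => x i = m).card ≤ 2 := by
  by_contra! h
  obtain ⟨a, b, c, ha, hb, hc, hab, hac, hbc⟩ := Finset.two_lt_card_iff.1 h
  simp only [Finset.mem_filter] at ha hb hc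
  have hk : ∀ j, j ≠ 1 - i → j = i := by fin_cases i <;> decide
  rcases hV.eq_or_eq_of_line (k := 1 - i) ha.1 hb.1 hc.1 hab
    (fun j hj => by rw [hk j hj, ha.2, hb.2]) (fun j hj => by rw [hk j hj, ha.2, hc.2]) with h | h
  · exact hac h.symm
  · exact hbc h.symm

/-- If `c` is least over `V` at `(1, 1, 1)`, and its largest coefficient is the `i`-th one, then
the facet on which the `i`-th coordinate vanishes has so few vertices that its diameter is at most
two. -/
theorem center_close {V : Finset (Fin 3 → ℤ)} (hV : ConvPos V) (hB : Boxed V)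
    (hu : (fun _ => 1) ∈ V) (hv : (fun _ => 2) ∈ V) : Reach V 5 (fun _ => 1) (fun _ => 2) := by
  obtain ⟨c', hc'⟩ := hV _ hu
  obtain ⟨c, hc⟩ : ∃ c : Fin 3 → ℝ, ∀ x ∈ V, x ≠ (fun _ => 1) → ∑ i, c i < ∑ i, c i * x i := by
    refine ⟨-c', fun x hx hne => ?_⟩
    have := hc' x hx hne
    simp only [ev] at this
    simpa using this
  obtain ⟨i, hi⟩ := Finite.exists_max c
  have hsum := hc _ hv fun h => by simpa using congrFun h 0
  rw [← Finset.sum_mul, Int.cast_ofNat, Fin.sum_univ_succAbove _ i, Fin.sum_univ_two] at hsum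
  have hA := hi (i.succAbove 0)
  have hB' := hi (i.succAbove 1)
  obtain ⟨m, hm, hm'⟩ := exists_extreme_bot i ⟨_, hu⟩
  have hm1 := hm' _ hu
  obtain ⟨p, hp, hpm⟩ := hm.1
  have hp0 := hB p hp i
  rcases (by omega : m = 1 ∨ m = 0) with rfl | rfl
  · exact (hm.reach_via hV hB diamLE_two hu hv).mono (by norm_num)
  obtain ⟨x, hx, hxm, h1⟩ := hm.exists_reach hV hu
  obtain ⟨y, hy, hym, h2⟩ := hm.exists_reach hV hv
  refine ((h1.trans (hm.reach hV hx hy hxm hym (n := 2) ?_)).trans h2.symm).mono (by norm_num)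
  by_contra hfar
  have hS := hV.slice i 0
  have hcard := six_le_card hS (drop_mem_slice hx hxm) (drop_mem_slice hy hym) hfar
  have hmem : ∀ z ∈ slice V i 0, (0 ≤ z 0 ∧ z 0 ≤ 3) ∧ (0 ≤ z 1 ∧ z 1 ≤ 3) ∧
      c i < c (i.succAbove 0) * ((z 0 : ℝ) - 1) + c (i.succAbove 1) * ((z 1 : ℝ) - 1) := by
    intro z hz
    refine ⟨hB.slice i 0 z hz 0, hB.slice i 0 z hz 1, ?_⟩
    obtain ⟨w, hw, hwi, rfl⟩ := mem_slice.1 hz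
    have := hc w hw fun h => by simp [h] at hwi
    rw [Fin.sum_univ_succAbove _ i, Fin.sum_univ_two, Fin.sum_univ_succAbove _ i,
      Fin.sum_univ_two, hwi] at this
    simp only [drop]
    push_cast at this
    linarith
  obtain ⟨α, β, hcover⟩ : ∃ α β : ℤ, ∀ z ∈ slice V i 0, z 0 = α ∨ z 1 = β ∨ z = ![2, 2] := by
    generalize c i = C at *
    generalize c (i.succAbove 0) = A at *
    generalize c (i.succAbove 1) = B at *
    have key : ∀ α β : ℤ, (∀ p q : ℤ, 0 ≤ p → p ≤ 3 → 0 ≤ q → q ≤ 3 →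
        C < A * ((p : ℝ) - 1) + B * ((q : ℝ) - 1) → p = α ∨ q = β ∨ (p = 2 ∧ q = 2)) →
        ∃ α β : ℤ, ∀ z ∈ slice V i 0, z 0 = α ∨ z 1 = β ∨ z = ![2, 2] := by
      intro α β h
      refine ⟨α, β, fun z hz => ?_⟩
      obtain ⟨⟨a1, a2⟩, ⟨a3, a4⟩, a5⟩ := hmem z hz
      refine (h _ _ a1 a2 a3 a4 a5).imp_right (Or.imp_right fun h => ?_)
      funext j
      fin_cases j
      exacts [h.1, h.2]
    rcases lt_or_ge 0 A with hA0 | hA0 <;> rcases lt_or_ge 0 B with hB0 | hB0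
    · refine key 3 3 fun p q h1 h2 h3 h4 h => ?_
      interval_cases p <;> interval_cases q <;> norm_num at h ⊢ <;> linarith
    · refine key 3 0 fun p q h1 h2 h3 h4 h => ?_
      interval_cases p <;> interval_cases q <;> norm_num at h ⊢ <;> linarith
    · refine key 0 3 fun p q h1 h2 h3 h4 h => ?_
      interval_cases p <;> interval_cases q <;> norm_num at h ⊢ <;> linarith
    · refine key 0 0 fun p q h1 h2 h3 h4 h => ?_
      interval_cases p <;> interval_cases q <;> norm_num at h ⊢ <;> linarith
  have hle : (slice V i 0).card ≤ ((slice V i 0).filter (fun z => z 0 = α) ∪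
      ((slice V i 0).filter (fun z => z 1 = β) ∪ {![2, 2]})).card :=
    Finset.card_le_card fun z hz => by
      have := hcover z hz
      simp only [Finset.mem_union, Finset.mem_filter, Finset.mem_singleton]
      tauto
  have h3 := Finset.card_union_le ((slice V i 0).filter (fun z => z 0 = α))
    ((slice V i 0).filter (fun z => z 1 = β) ∪ {![2, 2]})
  have h4 := Finset.card_union_le ((slice V i 0).filter (fun z => z 1 = β)) {![2, 2]}
  have h5 := card_line_le_two hS 0 α
  have h6 := card_line_le_two hS 1 β
  rw [Finset.card_singleton] at h4
  omega

/-- At distance six or more in space, the two points are opposite in the cube and extreme in some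
coordinate; the distance is never larger than six. The search applies after translations,
reflections and a permutation of the coordinates; the case of the two points on the diagonal that
are inside the cube is `center_close`. -/
theorem space_far {V : Finset (Fin 3 → ℤ)} (hV : ConvPos V) (hB : Boxed V) {u v : Fin 3 → ℤ}
    (hu : u ∈ V) (hv : v ∈ V) (hfar : ¬Reach V 5 u v) :
    (∀ i, u i + v i = 3 ∧ Extreme V i 0 ∧ Extreme V i 3) ∧ (∃ i, u i = 0 ∨ u i = 3) ∧
      Reach V 6 u v := by
  choose lo hlo hlo' using fun i => exists_extreme_bot i ⟨u, hu⟩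
  choose hi hhi hhi' using fun i => exists_extreme_top i ⟨u, hu⟩
  have hgap : ∀ i, 0 ≤ lo i ∧ hi i ≤ 3 ∧ lo i ≤ u i ∧ lo i ≤ v i ∧ u i ≤ hi i ∧ v i ≤ hi i ∧
      2 ≤ hi i - lo i := by
    intro i
    have h1 : ¬_ := fun hle => hfar (((hlo i).reach_via hV hB diamLE_two hu hv).mono hle)
    have h2 : ¬_ := fun hle => hfar (((hhi i).reach_via hV hB diamLE_two hu hv).mono hle)
    obtain ⟨p, hp, hp'⟩ := (hlo i).1
    obtain ⟨q, hq, hq'⟩ := (hhi i).1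
    have h3 := hB p hp i
    have h4 := hB q hq i
    have := hlo' i u hu
    have := hlo' i v hv
    have := hhi' i u hu
    have := hhi' i v hv
    omega
  -- translate and reflect, so that `u` is in the lower half of the box
  set s : Fin 3 → ℤ := fun i => if 2 * (u i - lo i) ≤ hi i - lo i then 1 else -1 with hs
  set t : Fin 3 → ℤ := fun i => if 2 * (u i - lo i) ≤ hi i - lo i then -lo i else hi i with ht
  have hst : ∀ i, (s i = 1 ∧ t i = -lo i ∧ 2 * (u i - lo i) ≤ hi i - lo i) ∨
      (s i = -1 ∧ t i = hi i ∧ 2 * (hi i - u i) ≤ hi i - lo i) := fun i => by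
    simp only [hs, ht]
    split_ifs with h
    · exact .inl ⟨rfl, rfl, h⟩
    · exact .inr ⟨rfl, rfl, by omega⟩
  clear_value s t
  -- sort the coordinates
  set k : Fin 3 → ℕ := fun i => 16 * (3 - (hi i - lo i)).toNat + 4 * (s i * u i + t i).toNat +
    (s i * v i + t i).toNat with hk
  set σ := Tuple.sort k
  have hσ : Monotone (k ∘ σ) := Tuple.monotone_sort k
  have hk01 := hσ (show (0 : Fin 3) ≤ 1 by decide)
  have hk12 := hσ (show (1 : Fin 3) ≤ 2 by decide)
  simp only [Function.comp, hk] at hk01 hk12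
  set f : (Fin 3 → ℤ) → Fin 3 → ℤ := fun x j => s (σ j) * x (σ j) + t (σ j) with hf
  have hA : AffineOn V f := (affineOn_comp (y := 0) σ.injective fun x _ i hi =>
    absurd (σ.surjective i) hi).comp (affineOn_reflect V (s := s)
      (fun i => by rcases hst i with h | h <;> simp [h.1]) t)
  have hfx : ∀ x ∈ V, ∀ j, 0 ≤ f x j ∧ f x j ≤ hi (σ j) - lo (σ j) := by
    intro x hx j
    have := hlo' (σ j) x hx
    have := hhi' (σ j) x hx
    simp only [hf]
    rcases hst (σ j) with ⟨a, b, -⟩ | ⟨a, b, -⟩ <;> rw [a, b] <;> omega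
  obtain ⟨W, hW, hWpt⟩ := exists_pt (x := fun j => hi (σ j) - lo (σ j)) fun j => by
    have := hgap (σ j)
    constructor <;> linarith
  have hWj : ∀ j : Fin 3, (dig W j : ℤ) = hi (σ j) - lo (σ j) := congrFun hWpt
  have hB' : Boxed (V.image f) := by
    intro x' hx' j
    obtain ⟨x, hx, rfl⟩ := Finset.mem_image.1 hx'
    have := hfx x hx j
    have := hgap (σ j)
    constructor <;> linarith
  have hV' := hA.convPos hV
  have hfu := Finset.mem_image_of_mem f hu
  have hfv := Finset.mem_image_of_mem f hv
  obtain ⟨a, ha, hapt⟩ := exists_pt (hB' _ hfu)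
  obtain ⟨b, hb, hbpt⟩ := exists_pt (hB' _ hfv)
  have haj : ∀ j : Fin 3, (dig a j : ℤ) = s (σ j) * u (σ j) + t (σ j) := congrFun hapt
  have hbj : ∀ j : Fin 3, (dig b j : ℤ) = s (σ j) * v (σ j) + t (σ j) := congrFun hbpt
  have hbox : ∀ x ∈ V.image f, ∀ i, 0 ≤ x i ∧ x i ≤ dig W i := by
    intro x' hx' i
    obtain ⟨x, hx, rfl⟩ := Finset.mem_image.1 hx'
    rw [hWj]
    exact hfx x hx i
  have hbot : ∀ i, ∃ x ∈ V.image f, x i = 0 := by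
    intro i
    obtain ⟨p, hp, hp'⟩ := (hlo (σ i)).1
    obtain ⟨q, hq, hq'⟩ := (hhi (σ i)).1
    rcases hst (σ i) with ⟨a, b, -⟩ | ⟨a, b, -⟩
    · exact ⟨f p, Finset.mem_image_of_mem f hp, by simp only [hf, a, b]; omega⟩
    · exact ⟨f q, Finset.mem_image_of_mem f hq, by simp only [hf, a, b]; omega⟩
  have htop : ∀ i : Fin 3, ∃ x ∈ V.image f, x i = dig W i := by
    intro i
    obtain ⟨p, hp, hp'⟩ := (hlo (σ i)).1
    obtain ⟨q, hq, hq'⟩ := (hhi (σ i)).1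
    rcases hst (σ i) with ⟨a, b, -⟩ | ⟨a, b, -⟩
    · exact ⟨f q, Finset.mem_image_of_mem f hq, by rw [hWj]; simp only [hf, a, b]; omega⟩
    · exact ⟨f p, Finset.mem_image_of_mem f hp, by rw [hWj]; simp only [hf, a, b]; omega⟩
  have hext : ∀ (i : Fin 3) (m : ℤ), m = 0 ∨ m = dig W i → Extreme (V.image f) i m := by
    rintro i m (rfl | rfl)
    · exact ⟨hbot i, .inl fun x hx => (hbox x hx i).1⟩
    · exact ⟨htop i, .inr fun x hx => (hbox x hx i).2⟩
  have hctx : ∀ B, ¬Reach V (B - 1) u v → Ctx (V.image f) W B 4 a b := by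
    intro B hB6
    refine ⟨hV', hbox, hbot, htop, hapt ▸ hfu, hbpt ▸ hfv, ?_, ?_, ?_⟩
    · rw [hapt, hbpt]
      exact fun h => hB6 (hA.reach hV hu hv h)
    · intro x hx y hy i hxy hxi
      exact (hext i _ hxi).reach hV' hx hy rfl hxy.symm (diamLE_two _ (hV'.slice i _)
        (hB'.slice i _) _ (drop_mem_slice hx rfl) _ (drop_mem_slice hy hxy.symm))
    · intro x hx y hy i hxy hxi m hm
      obtain rfl : m = 3 := by omega
      by_cases hr : Reach (slice (V.image f) i (x i)) 3 (drop i x) (drop i y)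
      · exact .inl ((hext i _ hxi).reach hV' hx hy rfl hxy.symm hr)
      right
      obtain ⟨h1, h2⟩ := plane_far (hV'.slice i _) (hB'.slice i _) (drop_mem_slice hx rfl)
        (drop_mem_slice hy hxy.symm) hr
      have hdig : ∀ l, dig W (i.succAbove l) = 3 := by
        intro l
        obtain ⟨z, hz, hz3⟩ := (h1 l).2.2.1
        obtain ⟨w, hw, -, rfl⟩ := mem_slice.1 hz
        have h3 := (hbox w hw (i.succAbove l)).2
        have h4 := dig_lt W (i.succAbove l)
        simp only [drop] at hz3
        omega
      intro j k hj hk hjk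
      obtain ⟨j, rfl⟩ := Fin.exists_succAbove_eq hj
      obtain ⟨k, rfl⟩ := Fin.exists_succAbove_eq hk
      refine ⟨hdig j, hdig k, (h1 j).1, (h1 k).1, ?_⟩
      rw [hdig j, hdig k]
      have hjk' : j ≠ k := fun h => hjk (by rw [h])
      obtain ⟨rfl, rfl⟩ | ⟨rfl, rfl⟩ : (j = 0 ∧ k = 1) ∨ (j = 1 ∧ k = 0) := by omega
      · exact h2
      · simp only [drop] at h2
        push_cast
        tauto
  -- the four shapes of the box
  have hW0 : (dig W 0 : ℤ) = hi (σ 0) - lo (σ 0) := hWj 0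
  have hW1 : (dig W 1 : ℤ) = hi (σ 1) - lo (σ 1) := hWj 1
  have hW2 : (dig W 2 : ℤ) = hi (σ 2) - lo (σ 2) := hWj 2
  have g0 := hgap (σ 0)
  have g1 := hgap (σ 1)
  have g2 := hgap (σ 2)
  have hkey : ∀ j, key W a b j.1 = k (σ j) := fun j => by
    have h1 := hWj j
    have h2 := haj j
    have h3 := hbj j
    simp only [Search.key, hk]
    rw [← h1, ← h2, ← h3]
    have := dig_lt W j
    omega
  have hWmem : W = 63 ∨ W = 47 ∨ W = 43 ∨ W = 42 := by
    have h01 : key W a b 0 ≤ key W a b 1 := (hkey 0).trans_le (hk01.trans_eq (hkey 1).symm)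
    have h12 : key W a b 1 ≤ key W a b 2 := (hkey 1).trans_le (hk12.trans_eq (hkey 2).symm)
    have hd : W = dig W 0 + 4 * dig W 1 + 16 * dig W 2 := by
      clear * - hW
      simp only [dig]
      norm_num
      omega
    have d0 : 2 ≤ dig W 0 ∧ dig W 0 ≤ 3 := by clear * - hW0 g0; omega
    have d1 : 2 ≤ dig W 1 ∧ dig W 1 ≤ 3 := by clear * - hW1 g1; omega
    have d2 : 2 ≤ dig W 2 ∧ dig W 2 ≤ 3 := by clear * - hW2 g2; omega
    have a0 := dig_lt a 0
    have a1 := dig_lt a 1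
    have a2 := dig_lt a 2
    have b0 := dig_lt b 0
    have b1 := dig_lt b 1
    have b2 := dig_lt b 2
    simp only [Search.key] at h01 h12
    have e1 : dig W 1 ≤ dig W 0 := by clear * - h01 a0 a1 b0 b1 d0 d1; omega
    have e2 : dig W 2 ≤ dig W 1 := by clear * - h12 a1 a2 b1 b2 d1 d2; omega
    clear * - hd d0 d1 d2 e1 e2
    omega
  have hlow : ∀ i : Fin 3, 2 * dig a i ≤ dig W i := by
    intro i
    have h1 := haj i
    have h2 := hWj i
    rcases hst (σ i) with ⟨p, q, r⟩ | ⟨p, q, r⟩ <;> rw [p, q] at h1 <;> omega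
  have hrun : Ctx (V.image f) W (bound W a b) 4 a b → a = 21 ∧ b = 42 ∧ W = 63 := fun h => by
    by_contra hcon
    exact h.false_of_sorted ha hb hWmem hlow ((hkey 0).trans_le (hk01.trans_eq (hkey 1).symm))
      ((hkey 1).trans_le (hk12.trans_eq (hkey 2).symm)) hcon
  have hgood : W = 63 ∧ a + b = 63 := by
    by_contra hcon
    have hb6 : bound W a b = 6 := if_neg hcon
    have := hrun (hb6 ▸ hctx 6 hfar)
    omega
  have hopp : ∀ j, s (σ j) * u (σ j) + t (σ j) + (s (σ j) * v (σ j) + t (σ j)) = 3 ∧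
      hi (σ j) - lo (σ j) = 3 := by
    intro j
    rw [← haj, ← hbj, ← hWj]
    obtain ⟨rfl, hab⟩ := hgood
    have : dig a j + dig b j = 3 ∧ dig 63 j = 3 := by
      fin_cases j <;> simp [dig] <;> omega
    omega
  have h63 : ∀ i, hi i = 3 ∧ lo i = 0 ∧ u i + v i = 3 := by
    intro i
    obtain ⟨j, rfl⟩ := σ.surjective i
    obtain ⟨h1, h2⟩ := hopp j
    have h3 := hgap (σ j)
    rcases hst (σ j) with ⟨p, q, -⟩ | ⟨p, q, -⟩ <;> rw [p, q] at h1 <;> omega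
  have hcenter : ¬(a = 21 ∧ b = 42) := by
    rintro ⟨rfl, rfl⟩
    have e1 : pt 21 = fun _ => 1 := funext fun i => by fin_cases i <;> rfl
    have e2 : pt 42 = fun _ => 2 := funext fun i => by fin_cases i <;> rfl
    refine hfar (hA.reach hV hu hv ?_)
    rw [← hapt, ← hbpt, e1, e2]
    exact center_close hV' hB' (e1 ▸ hapt ▸ hfu) (e2 ▸ hbpt ▸ hfv)
  refine ⟨fun i => ⟨(h63 i).2.2, (h63 i).2.1 ▸ hlo i, (h63 i).1 ▸ hhi i⟩, ?_, ?_⟩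
  · by_contra! hcon
    have hone : ∀ j : Fin 3, dig a j = 1 := by
      intro j
      have h1 := haj j
      have h2 := h63 (σ j)
      have h3 := hgap (σ j)
      have h4 := hcon (σ j)
      rcases hst (σ j) with ⟨p, q, r⟩ | ⟨p, q, r⟩ <;> rw [p, q] at h1 <;> omega
    have h0 := hone 0
    have h1 := hone 1
    have h2 := hone 2
    simp only [dig] at h0 h1 h2
    norm_num at h0 h1 h2
    omega
  · by_contra h6
    have hb7 : bound W a b = 7 := if_pos hgood
    have h := hrun (hb7 ▸ hctx 7 h6)
    exact hcenter ⟨h.1, h.2.1⟩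

theorem diamLE_three : DiamLE 3 6 := fun V hV hB u hu v hv => by
  by_cases h : Reach V 5 u v
  · exact h.mono (by norm_num)
  · exact (space_far hV hB hu hv h).2.2

/-! ### Dimension four -/

/-- The two points of `V` are at distance at least nine, and `u` is next to the corner
`(m, m, m, m)` of the box, where `m` is `0` or `3`. -/
structure Far (V : Finset (Fin 4 → ℤ)) (u v : Fin 4 → ℤ) (m : ℤ) : Prop where
  conv : ConvPos V
  boxed : Boxed V
  left : u ∈ V
  right : v ∈ V
  far : ¬Reach V 8 u v
  corner : m = 0 ∨ m = 3
  near : ∀ i, (u i - m).natAbs ≤ 1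

/-- In a two-dimensional face, points at distance four have an extreme coordinate. -/
theorem reach_three_of_inner {V : Finset (Fin 4 → ℤ)} (hV : ConvPos V) (hB : Boxed V)
    {i j : Fin 4} (hij : j ≠ i) {x y : Fin 4 → ℤ} (hx : x ∈ V) (hy : y ∈ V)
    (hi : Extreme V i (x i)) (hj : Extreme V j (x j)) (hyi : y i = x i) (hyj : y j = x j)
    (hinner : ∀ k, k ≠ i → k ≠ j → x k ≠ 0 ∧ x k ≠ 3) : Reach V 3 x y := by
  obtain ⟨j, rfl⟩ := Fin.exists_succAbove_eq hij
  have hj' : Extreme (slice V i (x i)) j (drop i x j) := by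
    refine ⟨⟨_, drop_mem_slice hx rfl, rfl⟩, hj.2.imp (fun h z hz => ?_) fun h z hz => ?_⟩ <;>
    · obtain ⟨w, hw, -, rfl⟩ := mem_slice.1 hz
      exact h w hw
  refine hi.reach hV hx hy rfl hyi (hj'.reach (hV.slice i _) (drop_mem_slice hx rfl)
    (drop_mem_slice hy hyi) rfl hyj ?_)
  by_contra hfar
  have h := (plane_far ((hV.slice i _).slice j _) ((hB.slice i _).slice j _)
    (drop_mem_slice (drop_mem_slice hx rfl) rfl) (drop_mem_slice (drop_mem_slice hy hyi) hyj)
    hfar).2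
  have hk : ∀ l, drop j (drop i x) l ≠ 0 ∧ drop j (drop i x) l ≠ 3 := fun l =>
    hinner _ (Fin.succAbove_ne _ _) fun h =>
      Fin.succAbove_ne j l (Fin.succAbove_right_injective h)
  have h0 := hk 0
  have h1 := hk 1
  tauto

namespace Far

variable {V : Finset (Fin 4 → ℤ)} {u v : Fin 4 → ℤ} {m : ℤ}

theorem opposite (h : Far V u v m) (i : Fin 4) : u i + v i = 3 ∧ Extreme V i 0 ∧ Extreme V i 3 :=
  opposite_of_far h.conv h.boxed diamLE_three h.left h.right h.far i

theorem extreme (h : Far V u v m) (i : Fin 4) {e : ℤ} (he : e = 0 ∨ e = 3) : Extreme V i e := by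
  rcases he with rfl | rfl
  · exact (h.opposite i).2.1
  · exact (h.opposite i).2.2

protected theorem symm (h : Far V u v m) : Far V v u (3 - m) where
  conv := h.conv
  boxed := h.boxed
  left := h.right
  right := h.left
  far := fun hr => h.far hr.symm
  corner := by have := h.corner; omega
  near := fun i => by
    have := (h.opposite i).1
    have := h.near i
    omega

theorem corner_symm (h : Far V u v m) : 3 - m = 0 ∨ 3 - m = 3 := h.symm.corner

/-- In a facet of the box, a point near `u` and a point near `v` are opposite. -/
theorem facet (h : Far V u v m) {i : Fin 4} {e : ℤ} (he : e = 0 ∨ e = 3) {y z : Fin 4 → ℤ}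
    {s t : ℕ} (hy : Reach V s u y) (hz : Reach V t v z) (hyi : y i = e) (hzi : z i = e)
    (hst : s + t ≤ 3) :
    (∀ j, j ≠ i → y j + z j = 3 ∧ ∀ f, f = 0 ∨ f = 3 → ∃ x ∈ V, x i = e ∧ x j = f) ∧
      ∃ j, j ≠ i ∧ (y j = 0 ∨ y j = 3) := by
  have hfar : ¬Reach (slice V i e) 5 (drop i y) (drop i z) := fun hr =>
    h.far (((hy.trans ((h.extreme i he).reach h.conv hy.mem_right hz.mem_right hyi hzi hr)).trans
      hz.symm).mono (by omega))
  obtain ⟨h1, ⟨j, hj⟩, -⟩ := space_far (h.conv.slice i e) (h.boxed.slice i e)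
    (drop_mem_slice hy.mem_right hyi) (drop_mem_slice hz.mem_right hzi) hfar
  refine ⟨fun j hj => ?_, i.succAbove j, Fin.succAbove_ne _ _, hj⟩
  obtain ⟨j, rfl⟩ := Fin.exists_succAbove_eq hj
  refine ⟨(h1 j).1, fun f hf => ?_⟩
  obtain ⟨x', hx', hxf⟩ : ∃ x ∈ slice V i e, x j = f := by
    rcases hf with rfl | rfl
    · exact (h1 j).2.1.1
    · exact (h1 j).2.2.1
  obtain ⟨x, hx, hxi, rfl⟩ := mem_slice.1 hx'
  exact ⟨x, hx, hxi, hxf⟩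

/-- No facet of the box contains a neighbour of `u` and a neighbour of `v`. -/
theorem not_facet (h : Far V u v m) {i : Fin 4} {e : ℤ} (he : e = 0 ∨ e = 3) {y z : Fin 4 → ℤ}
    (hy : Reach V 1 u y) (hz : Reach V 1 v z) (hyi : y i = e) (hzi : z i = e) : False :=
  h.far ((hy.trans ((h.extreme i he).reach h.conv hy.mem_right hz.mem_right hyi hzi
    (diamLE_three _ (h.conv.slice i e) (h.boxed.slice i e) _ (drop_mem_slice hy.mem_right hyi) _
      (drop_mem_slice hz.mem_right hzi)))).trans hz.symm)

/-- A neighbour of `u` is on none of the facets next to `v`, since these contain `v` or a neighbour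
of `v`. -/
theorem apply_ne (h : Far V u v m) {y : Fin 4 → ℤ} (hy : Reach V 1 u y) (i : Fin 4) :
    y i ≠ 3 - m := fun hyi => by
  obtain ⟨z, -, hzi, hr⟩ := (h.extreme i h.corner_symm).exists_reach h.conv h.right
  exact h.not_facet h.corner_symm hy (hr.mono (h.symm.near i)) hyi hzi

/-- If `u` is on the facet `x i = m`, then the point opposite to `v` in the facet `x i = 3 - m` is in
`V`. -/
theorem exists_opposite (h : Far V u v m) {i : Fin 4} (hi : u i = m) :
    (∃ w ∈ V, w i = 3 - m ∧ ∀ j, j ≠ i → w j = u j) ∧ ∃ j, j ≠ i ∧ u j = m := by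
  have hvi := (h.opposite i).1
  obtain ⟨w, hw, hwi, hr⟩ := (h.extreme i h.corner_symm).exists_reach h.conv h.left
  have hc := h.corner
  obtain ⟨h1, j, hj, hj'⟩ := h.facet h.corner_symm (hr.mono (m := 3) (by omega))
    (.refl (n := 0) h.right) hwi (by omega) le_rfl
  have hwj : ∀ j, j ≠ i → w j = u j := fun j hj => by
    have h1 := (h1 j hj).1
    have h2 := (h.opposite j).1
    omega
  refine ⟨⟨w, hw, hwi, hwj⟩, j, hj, ?_⟩
  rw [hwj j hj] at hj'
  have := h.near j
  omega

/-- If `u` is not on the facet `x i = m`, then it has a unique neighbour `y` there. The facet also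
contains a point `b` at distance two of `v`, which is opposite to `y`. -/
theorem exists_neighbour (h : Far V u v m) {i : Fin 4} (hi : u i ≠ m) :
    ∃ y b, y i = m ∧ Reach V 1 u y ∧ b i = m ∧ Reach V 2 v b ∧ (∀ j, j ≠ i → y j + b j = 3) ∧
      (∀ z, z i = m → Reach V 1 u z → z = y) ∧ (∃ j, j ≠ i ∧ y j = m) ∧
      ∀ j, u j = m → y j = m := by
  have hc := h.corner
  have hn := h.near i
  have ho := (h.opposite i).1
  obtain ⟨y, hy, hyi, hry⟩ := (h.extreme i hc).exists_reach h.conv h.left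
  obtain ⟨b, hb, hbi, hrb⟩ := (h.extreme i hc).exists_reach h.conv h.right
  have hry := hry.mono hn
  have hbox := h.boxed u h.left i
  have hrb := hrb.mono (m := 2) (by omega)
  obtain ⟨h1, j, hj, hj'⟩ := h.facet hc hry hrb hyi hbi le_rfl
  have huniq : ∀ z, z i = m → Reach V 1 u z → z = y := by
    intro z hzi hrz
    obtain ⟨h2, -⟩ := h.facet hc hrz hrb hzi hbi le_rfl
    funext k
    by_cases hk : k = i
    · rw [hk, hzi, hyi]
    · have := (h1 k hk).1
      have := (h2 k hk).1
      omega
  refine ⟨y, b, hyi, hry, hbi, hrb, fun k hk => (h1 k hk).1, huniq, ⟨j, hj, ?_⟩, fun k hk => ?_⟩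
  · have := h.apply_ne hry j
    omega
  · -- the facet `x k = m` contains `u` and meets the facet `x i = m`
    have hki : i ≠ k := fun h => hi (h ▸ hk)
    obtain ⟨z, hz, hzk, hrz⟩ := (h.extreme k hc).exists_reach h.conv h.right
    have hok := (h.opposite k).1
    obtain ⟨x, hx, hxk, hxi⟩ := ((h.facet hc (.refl (n := 0) h.left) (hrz.mono (m := 3) (by omega))
      hk hzk le_rfl).1 i hki).2 m hc
    obtain ⟨w, hw, hwi, hwk, hrw⟩ := (h.extreme i hc).exists_reach₂ (h.extreme k hc) hki h.conv hx
      hxi hxk h.left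
    rw [← huniq w hwi (hrw.mono (by omega)), hwk]

/-- The points `0`, the neighbour of `0` on a coordinate axis and the end of this axis would be
collinear. -/
theorem not_four (h : Far V u v 0) (hu : ∀ i, u i = 0) : False := by
  obtain ⟨⟨w, hw, hw0, hwj⟩, -⟩ := h.exists_opposite (hu 0)
  have h1 := hwj 1 (by decide)
  have h2 := hwj 2 (by decide)
  have h3 := hwj 3 (by decide)
  have u0 := hu 0
  have u1 := hu 1
  have u2 := hu 2
  have u3 := hu 3
  -- the neighbour of `u` on the first coordinate axis
  obtain ⟨z, hz, hlt⟩ := exists_improving_int h.conv ![1, -4, -4, -4] h.left hw (by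
    simp [Fin.sum_univ_four, h1, h2, h3, u0, u1, u2, u3, hw0])
  simp [Fin.sum_univ_four, u0, u1, u2, u3] at hlt
  have b0 := h.boxed z hz.2.1 0
  have b1 := h.boxed z hz.2.1 1
  have b2 := h.boxed z hz.2.1 2
  have b3 := h.boxed z hz.2.1 3
  have hne := h.apply_ne (.single hz) 0
  refine h.conv.not_between h.left hz.2.1 hw (p := 3 - z 0) (q := z 0) (by omega) (by omega) hz.2.2.1
    fun i => ?_
  fin_cases i
  · simp [u0, hw0]; ring
  · have : z 1 = 0 := by omega
    simp [u1, h1, this]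
  · have : z 2 = 0 := by omega
    simp [u2, h2, this]
  · have : z 3 = 0 := by omega
    simp [u3, h3, this]

/-- With `u` on three of the facets `x i = 0`, its neighbour on the fourth facet is the origin, and
the point opposite to the neighbour `(3, 3, 3, 3)` of `v` is on the line through these two. -/
theorem not_three (h : Far V u v 0) {l : Fin 4} (hl : u l = 1) (hu : ∀ i, i ≠ l → u i = 0) :
    False := by
  obtain ⟨y, -, hyl, hry, -, -, -, -, -, hy⟩ := h.exists_neighbour (i := l) (by omega)
  have hvl := (h.opposite l).1
  obtain ⟨z, a, hzl, -, hal, hra, haz, -, -, hz⟩ := h.symm.exists_neighbour (i := l) (by omega)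
  refine h.conv.not_between hry.mem_right h.left hra.mem_right (p := 2) (q := 1) (by norm_num)
    (by norm_num) (fun hyu => by rw [hyu] at hyl; omega) fun i => ?_
  by_cases hi : i = l
  · subst hi; omega
  · have := hu i hi
    have := hy i this
    have := haz i hi
    have := hz i (by have := (h.opposite i).1; omega)
    omega

/-- With `u` on two of the facets `x i = 0`, the neighbours of `u` on the other two, and the points
opposite to the corresponding neighbours of `v`, surround `u` in a plane. -/
theorem not_two (h : Far V u v 0) {i l : Fin 4} (hil : i ≠ l) (hi : u i = 1) (hl : u l = 1)
    (hu : ∀ j, j ≠ i → j ≠ l → u j = 0) : False := by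
  have hvi := (h.opposite i).1
  have hvl := (h.opposite l).1
  obtain ⟨y, -, hyi, hry, -, -, -, hyu, -, hy⟩ := h.exists_neighbour (i := i) (by omega)
  obtain ⟨z, -, hzl, hrz, -, -, -, hzu, -, hz⟩ := h.exists_neighbour (i := l) (by omega)
  obtain ⟨y', a, hyi', hry', hai, hra, hay, hyu', -, hy'⟩ :=
    h.symm.exists_neighbour (i := i) (by omega)
  obtain ⟨z', b, hzl', hrz', hbl, hrb, hbz, hzu', -, hz'⟩ :=
    h.symm.exists_neighbour (i := l) (by omega)
  obtain ⟨e, he⟩ := h.conv u h.left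
  -- the functional `e` restricted to the plane of the coordinates `i` and `l`
  have hev : ∀ x : Fin 4 → ℤ, (∀ j, j ≠ i → j ≠ l → x j = 0) → ev e x = e i * x i + e l * x l := by
    intro x hx
    rw [ev, ← Finset.sum_pair (f := fun j => e j * (x j : ℝ)) hil]
    refine (Finset.sum_subset (Finset.subset_univ _) fun j _ hj => ?_).symm
    simp only [Finset.mem_insert, Finset.mem_singleton, not_or] at hj
    simp [hx j hj.1 hj.2]
  have hlt : ∀ x ∈ V, (∀ j, j ≠ i → j ≠ l → x j = 0) → x i ≠ 1 ∨ x l ≠ 1 →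
      e i * x i + e l * x l < e i + e l := by
    intro x hx hx0 hne
    have := he x hx fun h => by rw [h] at hne; omega
    rwa [hev x hx0, hev u hu, hi, hl, Int.cast_one, mul_one, mul_one] at this
  have hv : ∀ j, j ≠ i → j ≠ l → v j = 3 := fun j hji hjl => by
    have := hu j hji hjl
    have := (h.opposite j).1
    omega
  have k1 := hlt y hry.mem_right (fun j hji hjl => hy j (hu j hji hjl)) (by omega)
  have k2 := hlt z hrz.mem_right (fun j hji hjl => hz j (hu j hji hjl)) (by omega)
  have k3 := hlt a hra.mem_right (fun j hji hjl => by
    have := hay j hji; have := hy' j (by have := hv j hji hjl; omega); omega) (by omega)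
  have k4 := hlt b hrb.mem_right (fun j hji hjl => by
    have := hbz j hjl; have := hz' j (by have := hv j hji hjl; omega); omega) (by omega)
  have c1 := h.boxed y hry.mem_right l
  have c2 := h.boxed z hrz.mem_right i
  have c3 := h.boxed a hra.mem_right l
  have c4 := h.boxed b hrb.mem_right i
  have d1 := h.apply_ne hry l
  have d2 := h.apply_ne hrz i
  have d3 := h.symm.apply_ne hry' l
  have d4 := h.symm.apply_ne hrz' i
  have f3 := hay l hil.symm
  have f4 := hbz i hil
  -- a corner of the box in this plane serves both facets through it
  have e1 : y l = 0 ↔ z i = 0 :=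
    ⟨fun h' => hzu y h' hry ▸ hyi, fun h' => hyu z h' hrz ▸ hzl⟩
  have e2 : a l = 0 ↔ b i = 0 := by
    constructor
    · intro h'
      have := hzu' y' (by omega) hry'
      rw [this] at hyi'
      omega
    · intro h'
      have := hyu' z' (by omega) hrz'
      rw [this] at hzl'
      omega
  rw [hyi] at k1
  rw [hzl] at k2
  rw [hai] at k3
  rw [hbl] at k4
  generalize y l = p at *
  generalize z i = q at *
  generalize a l = r at *
  generalize b i = t at *
  have hp : p = 0 ∨ p = 1 ∨ p = 2 := by omega
  have hq : q = 0 ∨ q = 1 ∨ q = 2 := by omega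
  have hr : r = 0 ∨ r = 1 ∨ r = 2 := by omega
  have ht : t = 0 ∨ t = 1 ∨ t = 2 := by omega
  clear * - k1 k2 k3 k4 e1 e2 hp hq hr ht
  rcases hp with rfl | rfl | rfl <;> rcases hq with rfl | rfl | rfl <;> norm_num at e1 <;>
  rcases hr with rfl | rfl | rfl <;> rcases ht with rfl | rfl | rfl <;> norm_num at e2 <;>
  norm_num at k1 k2 k3 k4 <;> linarith

/-- When `u` is on no facet `x i = m`, the neighbours `y i` of `u` on these facets are two points,
each of them on two of the facets, so that the facets are paired by an involution `σ`. The points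
`b i` are opposite to the `y i`, and within distance two of `v`. -/
theorem exists_pairing (h : Far V u v m) (hu : ∀ i, u i ≠ m) :
    ∃ (y b : Fin 4 → Fin 4 → ℤ) (σ : Fin 4 → Fin 4), (∀ i, y i i = m) ∧ (∀ i, b i i = m) ∧
      (∀ i, Reach V 2 v (b i)) ∧ (∀ i j, j ≠ i → y i j + b i j = 3) ∧ (∀ i, σ i ≠ i) ∧
      (∀ i, y (σ i) = y i) ∧ (∀ i, σ (σ i) = i) ∧
      ∀ i k, k ≠ i → k ≠ σ i → y i k ≠ m ∧ y i k ≠ 3 - m := by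
  choose y b hyi hry hbi hrb hyb huniq hex hz using fun i => h.exists_neighbour (hu i)
  choose σ hσ hyσ using hex
  have heq : ∀ i j, y i j = m → y j = y i := fun i j hij => (huniq j (y i) hij (hry i)).symm
  -- the four facets do not have a common point
  have hall : ∀ i, ∃ j, y i j ≠ m := by
    intro i
    by_contra! hcon
    have hc := h.corner
    refine h.conv.not_between (hry i).mem_right h.left h.right (p := 1) (q := 1) (by norm_num)
      (by norm_num) (fun h' => hu i (by rw [← h', hyi])) fun j => ?_
    have := hcon j
    have := h.near j
    have := hu j
    have := (h.opposite j).1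
    have := h.boxed u h.left j
    omega
  have honly : ∀ i k, k ≠ i → k ≠ σ i → y i k ≠ m := by
    intro i k hki hkσ hk
    obtain ⟨l, hl⟩ := hall i
    have hli : l ≠ i := fun h => hl (h ▸ hyi i)
    have hlσ : l ≠ σ i := fun h => hl (h ▸ hyσ i)
    have hlk : l ≠ k := fun h => hl (h ▸ hk)
    -- the facet of `l` has to be paired with one of the other three
    have key : ∀ a b c d e : Fin 4, a ≠ b → a ≠ c → b ≠ c → d ≠ a → d ≠ b → d ≠ c → e ≠ d →
        e = a ∨ e = b ∨ e = c := by decide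
    have hyl := hyσ l
    have hl' : y (σ l) l = m := by rw [heq l (σ l) hyl]; exact hyi l
    rcases key i (σ i) k l (σ l) (hσ i).symm hki.symm hkσ.symm hli hlσ hlk (hσ l) with h' | h' | h'
    · exact hl (h' ▸ hl')
    · rw [h', heq i (σ i) (hyσ i)] at hl'; exact hl hl'
    · rw [h', heq i k hk] at hl'; exact hl hl'
  refine ⟨y, b, σ, hyi, hbi, hrb, hyb, hσ, fun i => heq i _ (hyσ i), fun i => ?_,
    fun i k hki hkσ => ⟨honly i k hki hkσ, h.apply_ne (hry i) k⟩⟩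
  by_contra hne
  refine honly i (σ (σ i)) hne (hσ _) ?_
  rw [← heq i (σ i) (hyσ i)]
  exact hyσ (σ i)

/-- With `u` inside the box, the neighbours of `u` give a pairing `σ` of the coordinates, and those
of `v` a pairing `τ`. The points `a i` at distance two of `u`, opposite to the neighbours of `v`,
keep away from the two-dimensional faces that contain the points `b i`. This excludes that `σ` and
`τ` agree somewhere, and when they do not, it determines coordinates of the `a i` in two
contradictory ways. -/
theorem not_zero (h : Far V u v 0) (hu : ∀ i, u i = 1) : False := by
  obtain ⟨y, b, σ, hy, hb, hrb, hyb, hσ, hyσ, hσσ, hyk⟩ := h.exists_pairing fun i => by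
    rw [hu]; norm_num
  obtain ⟨z, a, τ, hz, ha, hra, hza, hτ, hzτ, hττ, hzk⟩ := h.symm.exists_pairing fun i => by
    have := (h.opposite i).1
    rw [hu] at this
    omega
  have hbσ : ∀ i, b i (σ i) = 3 := fun i => by
    have h1 := hyb i (σ i) (hσ i)
    have h2 := hy (σ i)
    rw [hyσ] at h2
    omega
  -- the points near `u` avoid the two-dimensional face that contains `b i`
  have key : ∀ i x, Reach V 2 u x → 2 ≤ x i + (3 - x (σ i)) := by
    intro i x hx
    by_contra hlt
    have hbox := h.boxed x hx.mem_right
    have h1 := hbox i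
    have h2 := hbox (σ i)
    have e1 := h.extreme i (.inl rfl)
    have e2 := h.extreme (σ i) (.inr rfl)
    obtain ⟨w, hw, hwi, hwσ, hr⟩ := e1.exists_reach₂ e2 (hσ i).symm
      h.conv (hrb i).mem_right (hb i) (hbσ i) hx.mem_right
    have h3 := reach_three_of_inner h.conv h.boxed (hσ i) (hrb i).mem_right hw
      (by rw [hb]; exact e1) (by rw [hbσ]; exact e2) (by rw [hb, hwi]) (by rw [hbσ, hwσ])
      fun k hki hkσ => by
        have h4 := hyk i k hki hkσ
        have h5 := hyb i k hki
        omega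
    exact h.far ((((hx.trans hr).trans h3.symm).trans (hrb i).symm).mono (by omega))
  have haτ : ∀ i, a (τ i) i = 0 := fun i => by
    have h1 := hza (τ i) i (hτ i).symm
    rw [hzτ, hz] at h1
    omega
  have h1 : ∀ i, a (τ i) (σ i) ≤ 1 := fun i => by
    have := key i _ (hra (τ i))
    rw [haτ] at this
    omega
  have h2 : ∀ i, 2 ≤ a (σ i) i := fun i => by
    have := key i _ (hra (σ i))
    rw [ha] at this
    omega
  have hne : ∀ i, σ i ≠ τ i := fun i h' => by
    have := h1 i
    rw [h', ha] at this
    omega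
  -- the two pairings are different, hence commute
  have hcomm : σ (τ (σ 0)) = τ 0 := by
    have key : ∀ a b c d e : Fin 4, a ≠ b → a ≠ c → b ≠ c → d ≠ a → d ≠ b → d ≠ c → e ≠ d →
        e ≠ a → e ≠ b → e = c := by decide
    refine key 0 (σ 0) (τ 0) (τ (σ 0)) _ (hσ 0).symm (hτ 0).symm (hne 0) ?_ (hτ _) ?_ (hσ _) ?_ ?_
    · intro h'
      apply hne 0
      rw [← hττ (σ 0), h']
    · intro h'
      apply hσ 0
      rw [← hττ (σ 0), h', hττ]
    · intro h'
      apply hτ (σ 0)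
      rw [← hσσ (τ (σ 0)), h']
    · intro h'
      apply hne 0
      have := congrArg σ h'
      rw [hσσ, hσσ] at this
      rw [← hττ (σ 0), this]
  have h3 := h1 (τ (σ 0))
  rw [hcomm, hττ] at h3
  have h4 := h2 (τ 0)
  rw [← hcomm, hσσ] at h4
  have h5 := hza (σ 0) (τ 0) (hne 0).symm
  have h6 := hza (τ (σ 0)) (τ 0) fun h' => by
    apply hσ 0
    rw [← hττ (σ 0), ← h', hττ]
  rw [hzτ] at h6
  rw [hcomm] at h4
  omega

end Far

theorem diamLE_four : DiamLE 4 8 := by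
  intro V hV hB u hu v hv
  by_contra hfar
  -- reflect, so that `u` is next to the origin
  set s : Fin 4 → ℤ := fun i => if u i ≤ 1 then 1 else -1 with hs
  set t : Fin 4 → ℤ := fun i => if u i ≤ 1 then 0 else 3 with ht
  have hst : ∀ i, (s i = 1 ∧ t i = 0 ∧ u i ≤ 1) ∨ (s i = -1 ∧ t i = 3 ∧ 2 ≤ u i) := fun i => by
    simp only [hs, ht]
    split_ifs with h
    · exact .inl ⟨rfl, rfl, h⟩
    · exact .inr ⟨rfl, rfl, by omega⟩
  clear_value s t
  have hA := affineOn_reflect V (s := s) (fun i => by rcases hst i with h | h <;> simp [h.1]) t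
  set f : (Fin 4 → ℤ) → Fin 4 → ℤ := fun x i => s i * x i + t i with hf
  have hF : Far (V.image f) (f u) (f v) 0 := by
    refine ⟨hA.convPos hV, fun x' hx' i => ?_, Finset.mem_image_of_mem f hu,
      Finset.mem_image_of_mem f hv, fun h => hfar (hA.reach hV hu hv h), .inl rfl, fun i => ?_⟩
    · obtain ⟨x, hx, rfl⟩ := Finset.mem_image.1 hx'
      have := hB x hx i
      simp only [hf]
      rcases hst i with ⟨a, b, -⟩ | ⟨a, b, -⟩ <;> rw [a, b] <;> omega
    · have := hB u hu i
      simp only [hf]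
      rcases hst i with ⟨a, b, c⟩ | ⟨a, b, c⟩ <;> rw [a, b] <;> clear * - c this <;> omega
  have h01 : ∀ i, f u i = 0 ∨ f u i = 1 := fun i => by
    have h1 := hF.near i
    have h2 := hF.boxed _ hF.left i
    omega
  by_cases hz : ∃ i, f u i = 0
  · obtain ⟨i, hi⟩ := hz
    obtain ⟨-, j, hji, hj⟩ := hF.exists_opposite hi
    obtain ⟨k, l, hkl, hall⟩ : ∃ k l : Fin 4, k ≠ l ∧ ∀ x, x = i ∨ x = j ∨ x = k ∨ x = l := by
      clear * - hji
      revert i j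
      decide
    rcases h01 k with hk | hk <;> rcases h01 l with hl | hl
    · exact hF.not_four fun x => by rcases hall x with rfl | rfl | rfl | rfl <;> assumption
    · exact hF.not_three hl fun x hx => by
        rcases hall x with rfl | rfl | rfl | rfl <;> first | assumption | exact absurd rfl hx
    · exact hF.not_three hk fun x hx => by
        rcases hall x with rfl | rfl | rfl | rfl <;> first | assumption | exact absurd rfl hx
    · exact hF.not_two hkl hk hl fun x hx hx' => by
        rcases hall x with rfl | rfl | rfl | rfl <;>
          first | assumption | exact absurd rfl hx | exact absurd rfl hx'
  · push Not at hz
    exact hF.not_zero fun i => (h01 i).resolve_left (hz i)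

/-! ### Vertex sets of lattice polytopes -/

section Polytope

variable {d : ℕ}

/-- The integer point `z` as a point of `ℝ^d`. -/
def toReal (z : Fin d → ℤ) : Fin d → ℝ := fun i => z i

theorem toReal_injective : Function.Injective (toReal : (Fin d → ℤ) → _) := fun _ _ h =>
  funext fun i => Int.cast_injective (α := ℝ) (congrFun h i)

/-- The linear functional with coefficient vector `c`. -/
noncomputable def functional (c : Fin d → ℝ) : StrongDual ℝ (Fin d → ℝ) :=
  ∑ i, c i • ContinuousLinearMap.proj i

theorem functional_toReal (c : Fin d → ℝ) (z : Fin d → ℤ) : functional c (toReal z) = ev c z := by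
  simp [functional, toReal, ev]

theorem exists_ev_eq (l : StrongDual ℝ (Fin d → ℝ)) :
    ∃ c : Fin d → ℝ, ∀ z, l (toReal z) = ev c z := by
  refine ⟨fun i => l fun j => if i = j then 1 else 0, fun z => ?_⟩
  have := LinearMap.pi_apply_eq_sum_univ l.toLinearMap (toReal z)
  simpa [ev, toReal, mul_comm] using this

theorem convexHull_extremePoints_of_finite {S : Set (Fin d → ℝ)} (hS : S.Finite) :
    convexHull ℝ ((convexHull ℝ S).extremePoints ℝ) = convexHull ℝ S := by
  have hfin := hS.subset (extremePoints_convexHull_subset (𝕜 := ℝ) (A := S))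
  rw [← (hfin.isClosed_convexHull ℝ).closure_eq]
  exact closure_convexHull_extremePoints (hS.isCompact_convexHull ℝ) (convex_convexHull ℝ S)

/-- The vertices of a lattice polytope form a finite set of integer points. -/
theorem IsLatticePolytope.exists_vertices {P : Set (Fin d → ℝ)} (hP : IsLatticePolytope P) :
    ∃ V : Finset (Fin d → ℤ), P.extremePoints ℝ = toReal '' (V : Set (Fin d → ℤ)) ∧
      P = convexHull ℝ (toReal '' (V : Set (Fin d → ℤ))) := by
  classical
  obtain ⟨S, -, rfl⟩ := hP
  set A := (fun (z : Fin d → ℤ) (i : Fin d) => (z i : ℝ)) '' (S : Set (Fin d → ℤ)) with hA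
  have hfin : A.Finite := S.finite_toSet.image _
  have hV : (convexHull ℝ A).extremePoints ℝ = toReal ''
      ((S.filter fun z => toReal z ∈ (convexHull ℝ A).extremePoints ℝ : Finset _) : Set _) := by
    ext x
    constructor
    · intro hx
      obtain ⟨z, hz, rfl⟩ := extremePoints_convexHull_subset hx
      exact ⟨z, by simpa using ⟨hz, hx⟩, rfl⟩
    · rintro ⟨z, hz, rfl⟩
      exact (Finset.mem_filter.1 hz).2
  exact ⟨_, hV, by rw [← hV, convexHull_extremePoints_of_finite hfin]⟩

variable {P : Set (Fin d → ℝ)} {V : Finset (Fin d → ℤ)}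

theorem convPos_of_extremePoints (hV : P.extremePoints ℝ = toReal '' (V : Set (Fin d → ℤ)))
    (hP : Convex ℝ P) : ConvPos V := by
  intro z hz
  have hzP : toReal z ∈ P.extremePoints ℝ := hV ▸ Set.mem_image_of_mem _ hz
  set A : Set (Fin d → ℝ) := toReal '' ((V.erase z : Finset _) : Set (Fin d → ℤ)) with hA
  have hAfin : A.Finite := (Finset.finite_toSet _).image _
  have hAP : convexHull ℝ A ⊆ P := by
    refine convexHull_min ?_ hP
    rintro _ ⟨x, hx, rfl⟩
    exact (hV ▸ Set.mem_image_of_mem toReal (Finset.mem_of_mem_erase hx) :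
      toReal x ∈ P.extremePoints ℝ).1
  have hzA : toReal z ∉ convexHull ℝ A := fun h => by
    obtain ⟨x, hx, hxz⟩ := extremePoints_convexHull_subset
      (inter_extremePoints_subset_extremePoints_of_subset hAP ⟨h, hzP⟩)
    exact (Finset.mem_erase.1 hx).1 (toReal_injective hxz)
  obtain ⟨l, r, hl, hr⟩ := geometric_hahn_banach_closed_point (convex_convexHull ℝ A)
    (hAfin.isClosed_convexHull ℝ) hzA
  obtain ⟨c, hc⟩ := exists_ev_eq l
  refine ⟨c, fun x hx hne => ?_⟩
  rw [← hc, ← hc]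
  exact (hl _ (subset_convexHull ℝ A ⟨x, Finset.mem_erase.2 ⟨hne, hx⟩, rfl⟩)).trans hr

theorem le_of_mem_convexHull {c : Fin d → ℝ} {M : ℝ} (h : ∀ x ∈ V, ev c x ≤ M) {p : Fin d → ℝ}
    (hp : p ∈ convexHull ℝ (toReal '' (V : Set (Fin d → ℤ)))) : functional c p ≤ M := by
  have hconv : Convex ℝ {p | functional c p ≤ M} :=
    convex_halfSpace_le (functional c).toLinearMap.isLinear M
  refine convexHull_min ?_ hconv hp
  rintro _ ⟨x, hx, rfl⟩
  exact (functional_toReal c x).trans_le (h x hx)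

theorem VAdj.isExposed (hP : P = convexHull ℝ (toReal '' (V : Set (Fin d → ℤ)))) {a b : Fin d → ℤ}
    (h : VAdj V a b) : IsExposed ℝ P (segment ℝ (toReal a) (toReal b)) := by
  classical
  obtain ⟨ha, hb, hne, c, hc, hlt⟩ := h
  intro _
  have hle : ∀ x ∈ V, ev c x ≤ ev c a := fun x hx => by
    by_cases hxa : x = a
    · rw [hxa]
    by_cases hxb : x = b
    · rw [hxb, hc]
    exact (hlt x hx hxa hxb).le
  have haP : toReal a ∈ P := hP ▸ subset_convexHull ℝ _ (Set.mem_image_of_mem _ ha)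
  have hbP : toReal b ∈ P := hP ▸ subset_convexHull ℝ _ (Set.mem_image_of_mem _ hb)
  have hmax : ∀ p ∈ P, functional c p ≤ ev c a := fun p hp => le_of_mem_convexHull hle (hP ▸ hp)
  have hPconv : Convex ℝ P := hP ▸ convex_convexHull ℝ _
  refine ⟨functional c, Set.Subset.antisymm (fun p hp => ⟨hPconv.segment_subset haP hbP hp, ?_⟩) ?_⟩
  · obtain ⟨s, t, -, -, hst, rfl⟩ := hp
    have : functional c (s • toReal a + t • toReal b) = ev c a := by
      simp only [map_add, map_smul, functional_toReal, smul_eq_mul, ← hc]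
      linear_combination ev c a * hst
    rw [this]
    exact hmax
  · rintro p ⟨hp, hpmax⟩
    have hpa : functional c p = ev c a :=
      le_antisymm (hmax p hp) (functional_toReal c a ▸ hpmax _ haP)
    rw [hP, ← Finset.coe_image, Finset.mem_convexHull'] at hp
    obtain ⟨w, hw0, hw1, hwp⟩ := hp
    rw [Finset.sum_image fun x _ y _ h => toReal_injective h] at hw1 hwp
    have hw0' : ∀ x ∈ V, 0 ≤ w (toReal x) := fun x hx => hw0 _ (Finset.mem_image_of_mem _ hx)
    have hzero : ∀ x ∈ V, w (toReal x) * (ev c a - ev c x) = 0 := by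
      refine (Finset.sum_eq_zero_iff_of_nonneg fun x hx =>
        mul_nonneg (hw0' x hx) (sub_nonneg.2 (hle x hx))).1 ?_
      have : functional c p = ∑ x ∈ V, w (toReal x) * ev c x := by
        rw [← hwp, map_sum]
        simp only [map_smul, functional_toReal, smul_eq_mul]
      simp only [mul_sub, Finset.sum_sub_distrib, ← Finset.sum_mul, hw1, ← this, hpa, one_mul,
        sub_self]
    have hsupp : ∀ x ∈ V, x ∉ ({a, b} : Finset (Fin d → ℤ)) → w (toReal x) = 0 := by
      intro x hx hxab
      simp only [Finset.mem_insert, Finset.mem_singleton, not_or] at hxab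
      exact (mul_eq_zero.1 (hzero x hx)).resolve_right
        (sub_pos.2 (hlt x hx hxab.1 hxab.2)).ne'
    have hsub : ({a, b} : Finset (Fin d → ℤ)) ⊆ V := by
      simp [Finset.insert_subset_iff, ha, hb]
    rw [← Finset.sum_subset hsub fun x hx hxab => hsupp x hx hxab, Finset.sum_pair hne] at hw1
    rw [← Finset.sum_subset hsub fun x hx hxab => by rw [hsupp x hx hxab, zero_smul],
      Finset.sum_pair hne] at hwp
    exact ⟨_, _, hw0' a ha, hw0' b hb, hw1, hwp⟩

theorem Reach.edist_le (hV : P.extremePoints ℝ = toReal '' (V : Set (Fin d → ℤ)))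
    (hP : P = convexHull ℝ (toReal '' (V : Set (Fin d → ℤ)))) {n : ℕ} {a b : Fin d → ℤ}
    (h : Reach V n a b) (ha : toReal a ∈ P.extremePoints ℝ) (hb : toReal b ∈ P.extremePoints ℝ) :
    (polytopeGraph P).edist ⟨toReal a, ha⟩ ⟨toReal b, hb⟩ ≤ n := by
  induction h with
  | refl _ => simp
  | @step n a b c hab _ ih =>
    have hb' : toReal b ∈ P.extremePoints ℝ := hV ▸ Set.mem_image_of_mem _ hab.2.1
    have hadj : (polytopeGraph P).Adj ⟨toReal a, ha⟩ ⟨toReal b, hb'⟩ :=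
      ⟨fun h => hab.2.2.1 (toReal_injective (congrArg Subtype.val h)), hab.isExposed hP⟩
    calc _ ≤ (polytopeGraph P).edist ⟨toReal a, ha⟩ ⟨toReal b, hb'⟩ +
          (polytopeGraph P).edist ⟨toReal b, hb'⟩ ⟨toReal c, hb⟩ := SimpleGraph.edist_triangle
      _ ≤ 1 + n := add_le_add (SimpleGraph.edist_eq_one_iff_adj.2 hadj).le (ih hb' hb)
      _ = ((n + 1 : ℕ) : ℕ∞) := by push_cast; ring

theorem DiamLE.polytopeDiam_le {D : ℕ} (hD : DiamLE d D) (hP : IsLatticeDKPolytope d 3 P) :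
    polytopeDiam P ≤ D := by
  obtain ⟨V, hV, hPV⟩ := hP.1.exists_vertices
  have hconv : ConvPos V := convPos_of_extremePoints hV (hPV ▸ convex_convexHull ℝ _)
  have hbox : Boxed V := by
    intro z hz i
    obtain ⟨w, hw, hzw⟩ := hP.2 (hV ▸ Set.mem_image_of_mem toReal hz)
    have : z = w := toReal_injective hzw
    exact this ▸ hw i
  refine SimpleGraph.ediam_le_of_edist_le fun x y => ?_
  obtain ⟨x, hx⟩ := x
  obtain ⟨y, hy⟩ := y
  obtain ⟨u, hu, rfl⟩ := hV.subset hx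
  obtain ⟨v, hv, rfl⟩ := hV.subset hy
  exact (hD V hconv hbox u hu v hv).edist_le hV hPV hx hy

end Polytope

/-! ### A polytope of diameter eight -/

namespace Zonotope

/-- The generators `e₀, …, e₃, e₀ + e₁, e₁ + e₂, e₂ + e₃, e₃ + e₀`, which add up to
`(3, 3, 3, 3)`. -/
def gen : Fin 8 → Fin 4 → ℤ :=
  ![![1, 0, 0, 0], ![0, 1, 0, 0], ![0, 0, 1, 0], ![0, 0, 0, 1],
    ![1, 1, 0, 0], ![0, 1, 1, 0], ![0, 0, 1, 1], ![1, 0, 0, 1]]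

/-- The sum of the generators with index in `S`. -/
def sub (S : Finset (Fin 8)) : Fin 4 → ℤ := ∑ k ∈ S, gen k

/-- The zonotope with these generators. -/
noncomputable def zonotope : Set (Fin 4 → ℝ) :=
  convexHull ℝ ((fun (z : Fin 4 → ℤ) (i : Fin 4) => (z i : ℝ)) ''
    ((Finset.univ.image sub : Finset (Fin 4 → ℤ)) : Set (Fin 4 → ℤ)))

theorem gen_nonneg (k : Fin 8) (i : Fin 4) : 0 ≤ gen k i := by
  revert k i; decide

theorem sub_apply (S : Finset (Fin 8)) (i : Fin 4) : sub S i = ∑ k ∈ S, gen k i :=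
  Finset.sum_apply _ _ _

theorem sub_univ : sub Finset.univ = fun _ => 3 := by
  decide +kernel

theorem sub_mem_box (S : Finset (Fin 8)) (i : Fin 4) : 0 ≤ sub S i ∧ sub S i ≤ 3 := by
  refine ⟨?_, ?_⟩
  · rw [sub_apply]
    exact Finset.sum_nonneg fun k _ => gen_nonneg k i
  · rw [← congrFun sub_univ i, sub_apply, sub_apply]
    exact Finset.sum_le_sum_of_subset_of_nonneg (Finset.subset_univ _) fun k _ _ => gen_nonneg k i

theorem toReal_sub_mem (S : Finset (Fin 8)) : toReal (sub S) ∈ zonotope :=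
  subset_convexHull ℝ _ ⟨sub S, by simp, rfl⟩

theorem exists_of_extreme {x : Fin 4 → ℝ} (hx : x ∈ zonotope.extremePoints ℝ) :
    ∃ S, x = toReal (sub S) := by
  obtain ⟨z, hz, rfl⟩ := extremePoints_convexHull_subset hx
  obtain ⟨S, -, rfl⟩ := Finset.mem_image.1 hz
  exact ⟨S, rfl⟩

theorem isLatticeDKPolytope : IsLatticeDKPolytope 4 3 zonotope := by
  refine ⟨⟨_, ⟨sub ∅, by simp⟩, rfl⟩, fun x hx => ?_⟩
  obtain ⟨S, rfl⟩ := exists_of_extreme hx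
  exact ⟨sub S, fun i => sub_mem_box S i, rfl⟩

theorem toReal_insert {S : Finset (Fin 8)} {k : Fin 8} (hk : k ∉ S) :
    toReal (sub (insert k S)) = toReal (sub S) + toReal (gen k) := by
  funext i
  simp [toReal, sub, Finset.sum_insert hk, add_comm]

theorem toReal_erase {S : Finset (Fin 8)} {k : Fin 8} (hk : k ∈ S) :
    toReal (sub (S.erase k)) = toReal (sub S) - toReal (gen k) := by
  rw [eq_sub_iff_add_eq, ← toReal_insert (Finset.notMem_erase k S), Finset.insert_erase hk]

/-- The direction of an edge between the vertices of `S` and `T` is a multiple of every generator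
in which `S` and `T` differ. -/
theorem exists_smul_eq {S T : Finset (Fin 8)}
    (h : IsExposed ℝ zonotope (segment ℝ (toReal (sub S)) (toReal (sub T)))) {k : Fin 8}
    (hS : k ∈ S) (hT : k ∉ T) :
    ∃ t : ℝ, toReal (gen k) = t • (toReal (sub S) - toReal (sub T)) := by
  obtain ⟨l, hl⟩ := h ⟨_, left_mem_segment ℝ _ _⟩
  have h1 := hl ▸ left_mem_segment ℝ (toReal (sub S)) (toReal (sub T))
  have h2 := hl ▸ right_mem_segment ℝ (toReal (sub S)) (toReal (sub T))
  have h3 := h1.2 _ (toReal_sub_mem (S.erase k))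
  have h4 := h2.2 _ (toReal_sub_mem (insert k T))
  rw [toReal_erase hS, map_sub] at h3
  rw [toReal_insert hT, map_add] at h4
  have hk : l (toReal (gen k)) = 0 := by linarith
  have h5 : toReal (sub (S.erase k)) ∈ segment ℝ (toReal (sub S)) (toReal (sub T)) := by
    rw [hl]
    refine ⟨toReal_sub_mem _, fun y hy => ?_⟩
    rw [toReal_erase hS, map_sub, hk, sub_zero]
    exact h1.2 y hy
  obtain ⟨a, b, -, -, hab, h6⟩ := h5
  refine ⟨b, ?_⟩
  rw [toReal_erase hS, eq_sub_iff_add_eq] at h6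
  rw [← add_right_inj (a • toReal (sub S) + b • toReal (sub T)), h6]
  obtain rfl : a = 1 - b := by linarith
  module

theorem not_parallel {k l : Fin 8} (h : k ≠ l) :
    ∃ i j, gen k i * gen l j ≠ gen k j * gen l i := by
  revert k l; decide

/-- Along an edge, at most one generator is added or removed. -/
theorem card_symmDiff_le {S T : Finset (Fin 8)}
    (h : IsExposed ℝ zonotope (segment ℝ (toReal (sub S)) (toReal (sub T)))) :
    (symmDiff S T).card ≤ 1 := by
  have key : ∀ k ∈ symmDiff S T,
      ∃ t : ℝ, toReal (gen k) = t • (toReal (sub S) - toReal (sub T)) := by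
    intro k hk
    rcases Finset.mem_symmDiff.1 hk with ⟨h1, h2⟩ | ⟨h1, h2⟩
    · exact exists_smul_eq h h1 h2
    · rw [segment_symm] at h
      obtain ⟨t, ht⟩ := exists_smul_eq h h1 h2
      exact ⟨-t, by rw [ht]; module⟩
  refine Finset.card_le_one.2 fun k hk l hl => ?_
  by_contra hkl
  obtain ⟨t, ht⟩ := key k hk
  obtain ⟨s, hs⟩ := key l hl
  obtain ⟨i, j, hij⟩ := not_parallel hkl
  refine hij (Int.cast_injective (α := ℝ) ?_)
  have e1 : ∀ m, (gen k m : ℝ) = t * (toReal (sub S) m - toReal (sub T) m) := congrFun ht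
  have e2 : ∀ m, (gen l m : ℝ) = s * (toReal (sub S) m - toReal (sub T) m) := congrFun hs
  push_cast
  rw [e1, e1, e2, e2]
  ring

theorem zonotope_subset_Icc : zonotope ⊆ Set.Icc (fun _ => 0) (fun _ => 3) := by
  refine convexHull_min ?_ (convex_Icc _ _)
  rintro _ ⟨z, hz, rfl⟩
  obtain ⟨S, -, rfl⟩ := Finset.mem_image.1 hz
  have := sub_mem_box S
  exact ⟨fun i => Int.cast_nonneg (this i).1, fun i => by
    simpa using (Int.cast_le (R := ℝ)).2 (this i).2⟩

theorem zero_mem_extremePoints : toReal (sub ∅) ∈ zonotope.extremePoints ℝ := by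
  have h0 : toReal (sub ∅) = fun _ => 0 := by funext i; simp [toReal, sub]
  refine mem_extremePoints.2 ⟨toReal_sub_mem ∅, fun x hx y hy hxy => ?_⟩
  obtain ⟨a, b, ha, hb, hab, h⟩ := hxy
  rw [h0] at h ⊢
  have key : ∀ i, x i = 0 ∧ y i = 0 := fun i => by
    have h1 : 0 ≤ x i := (zonotope_subset_Icc hx).1 i
    have h2 : 0 ≤ y i := (zonotope_subset_Icc hy).1 i
    have h3 : a * x i + b * y i = 0 := congrFun h i
    have h4 := mul_nonneg ha.le h1
    have h5 := mul_nonneg hb.le h2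
    exact ⟨(mul_eq_zero.1 (by linarith : a * x i = 0)).resolve_left ha.ne',
      (mul_eq_zero.1 (by linarith : b * y i = 0)).resolve_left hb.ne'⟩
  exact ⟨funext fun i => (key i).1, funext fun i => (key i).2⟩

theorem top_mem_extremePoints : toReal (sub Finset.univ) ∈ zonotope.extremePoints ℝ := by
  have h0 : toReal (sub Finset.univ) = fun _ => 3 := by funext i; simp [toReal, sub_univ]
  refine mem_extremePoints.2 ⟨toReal_sub_mem _, fun x hx y hy hxy => ?_⟩
  obtain ⟨a, b, ha, hb, hab, h⟩ := hxy
  rw [h0] at h ⊢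
  have key : ∀ i, 3 - x i = 0 ∧ 3 - y i = 0 := fun i => by
    have h1 : 0 ≤ 3 - x i := sub_nonneg.2 ((zonotope_subset_Icc hx).2 i)
    have h2 : 0 ≤ 3 - y i := sub_nonneg.2 ((zonotope_subset_Icc hy).2 i)
    have h3 : a * x i + b * y i = 3 := congrFun h i
    have h4 := mul_nonneg ha.le h1
    have h5 := mul_nonneg hb.le h2
    have h6 : a * (3 - x i) + b * (3 - y i) = 0 := by linear_combination 3 * hab - h3
    exact ⟨(mul_eq_zero.1 (by linarith : a * (3 - x i) = 0)).resolve_left ha.ne',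
      (mul_eq_zero.1 (by linarith : b * (3 - y i) = 0)).resolve_left hb.ne'⟩
  exact ⟨funext fun i => by linarith [(key i).1], funext fun i => by linarith [(key i).2]⟩

theorem eight_le_polytopeDiam : 8 ≤ polytopeDiam zonotope := by
  choose S hS using fun x : zonotope.extremePoints ℝ => exists_of_extreme x.2
  have hwalk : ∀ {x y} (p : (polytopeGraph zonotope).Walk x y),
      (symmDiff (S x) (S y)).card ≤ p.length := by
    intro x y p
    induction p with
    | nil => simp
    | @cons x z y hadj p ih =>
      have h1 := hadj.2
      rw [hS x, hS z] at h1
      have h2 := card_symmDiff_le h1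
      have h3 : (symmDiff (S x) (S y)).card ≤
          (symmDiff (S x) (S z)).card + (symmDiff (S z) (S y)).card :=
        (Finset.card_le_card (symmDiff_triangle _ _ _)).trans (Finset.card_union_le _ _)
      rw [SimpleGraph.Walk.length_cons]
      omega
  set x : zonotope.extremePoints ℝ := ⟨_, zero_mem_extremePoints⟩
  set y : zonotope.extremePoints ℝ := ⟨_, top_mem_extremePoints⟩
  -- the coordinate sum shows which subsets represent these two vertices
  have hsum : ∀ T : Finset (Fin 8), (sub T = sub ∅ → T = ∅) ∧ (sub T = sub Finset.univ →
      T = Finset.univ) := by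
    have hpos : ∀ k, 0 < ∑ i, gen k i := by decide
    have hrep : ∀ T, ∑ i, sub T i = ∑ k ∈ T, ∑ i, gen k i := fun T => by
      simp only [sub_apply]
      exact Finset.sum_comm
    refine fun T => ⟨fun h => ?_, fun h => ?_⟩
    · have h1 := hrep T
      rw [h, hrep] at h1
      by_contra hne
      have := Finset.sum_pos (fun k _ => hpos k) (Finset.nonempty_iff_ne_empty.2 hne)
      rw [Finset.sum_empty] at h1
      omega
    · have h1 := hrep T
      rw [h, hrep] at h1
      by_contra hne
      obtain ⟨k, hk⟩ : ∃ k, k ∉ T := by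
        by_contra! h'
        exact hne (Finset.eq_univ_of_forall h')
      have := Finset.sum_lt_sum_of_subset (Finset.subset_univ T) (Finset.mem_univ k) hk (hpos k)
        fun j _ _ => (hpos j).le
      omega
  have hx : S x = ∅ := (hsum _).1 (toReal_injective (hS x).symm)
  have hy : S y = Finset.univ := (hsum _).2 (toReal_injective (hS y).symm)
  refine le_trans ?_ (SimpleGraph.edist_le_ediam (u := x) (v := y))
  refine le_iInf fun p => ?_
  have := hwalk p
  rw [hx, hy] at this
  have h8 : (symmDiff (∅ : Finset (Fin 8)) Finset.univ).card = 8 := by decide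
  rw [h8] at this
  exact_mod_cast this

theorem affineSpan_zonotope : affineSpan ℝ zonotope = ⊤ := by
  have h0 : (0 : Fin 4 → ℝ) ∈ zonotope := by
    have := toReal_sub_mem ∅
    have h0 : toReal (sub ∅) = 0 := by funext i; simp [toReal, sub]
    rwa [h0] at this
  have hmem : ∀ i : Fin 4, Pi.single i (1 : ℝ) ∈ zonotope := by
    intro i
    have h1 := toReal_sub_mem {Fin.castLE (by norm_num) i}
    have h2 : toReal (sub {Fin.castLE (by norm_num : 4 ≤ 8) i}) = Pi.single i (1 : ℝ) := by
      funext j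
      have : ∀ i j : Fin 4, sub {Fin.castLE (by norm_num : 4 ≤ 8) i} j = if j = i then 1 else 0 := by
        decide
      simp [toReal, this, Pi.single_apply]
    rwa [h2] at h1
  rw [AffineSubspace.affineSpan_eq_top_iff_vectorSpan_eq_top_of_nonempty _ _ _ ⟨0, h0⟩,
    Submodule.eq_top_iff']
  intro x
  have hx : x = ∑ i, x i • Pi.single i (1 : ℝ) := by
    funext j
    simp [Finset.sum_apply, Pi.single_apply]
  rw [hx]
  refine Submodule.sum_mem _ fun i _ => Submodule.smul_mem _ _ ?_
  simpa using vsub_mem_vectorSpan ℝ (hmem i) h0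

theorem polytopeDiam_eq : polytopeDiam zonotope = 8 :=
  le_antisymm (diamLE_four.polytopeDiam_le isLatticeDKPolytope) eight_le_polytopeDiam

end Zonotope

theorem corollary1 :
    IsGreatest (latticeDiameters 4 3) 8 ∧ IsGreatest (fullDimLatticeDiameters 4 3) 8 := by
  have hle : ∀ P, IsLatticeDKPolytope 4 3 P → polytopeDiam P ≤ 8 := fun P hP =>
    diamLE_four.polytopeDiam_le hP
  refine ⟨⟨⟨Zonotope.zonotope, Zonotope.isLatticeDKPolytope, Zonotope.polytopeDiam_eq⟩, ?_⟩,
    ⟨Zonotope.zonotope, Zonotope.isLatticeDKPolytope, Zonotope.affineSpan_zonotope,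
      Zonotope.polytopeDiam_eq⟩, ?_⟩
  · rintro _ ⟨P, hP, rfl⟩
    exact hle P hP
  · rintro _ ⟨P, hP, -, rfl⟩
    exact hle P hP
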